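/- Throughout, $\mathbb{R}^2\subset\mathbb{RP}^2$ via $(x,y)\mapsto[x:y:1]$. A set $X\subseteq\mathbb{RP}^2$ is \emph{semiconvex} if any two of its points can be joined by a projective line segment contained in $X$, and \emph{convex} if moreover it is disjoint from some projective line (that is, it lies in some affine plane $\rho\subset\mathbb{RP}^2$). A \emph{projective convex hull} of $Y$ is an inclusion-minimal convex subset of $\mathbb{RP}^2$ containing $Y$. For a finite set $P\subset\mathbb{RP}^2$ and $k\ge 3$, a \emph{projective $k$-hole} in $P$ is a projective convex hull of a set $I$ of $k$ points of $P$ which contains all points of $I$ on its boundary and has no point of $P$ in its interior; a \emph{projective hole} in $P$ is a projective $k$-hole for some $k\ge3$. If $P\subset\mathbb{R}^2$, an \emph{affine hole} in $P$ is the convex hull in $\mathbb{R}^2$ of at least three points of $P$ in convex position with no point of $P$ in its interior. \textbf{Theorem.} Let $K\subset\mathbb{R}^2$ be a compact convex set of unit area. For every $n$, let $P$ be a set of $n$ points chosen uniformly and independently at random from $K\subset\mathbb{R}^2\subset\mathbb{RP}^2$. Then, as $n\to\infty$, the expected number of projective $3$-holes in $P$ is in $\Theta(n^2)$. Moreover,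 the expected number of projective holes in $P$ which are not affine holes in $\mathbb{R}^2$ is in $\Theta(n^2)$. -/

import Mathlib

/-- The Euclidean plane `ℝ²`. -/
abbrev Plane : Type := EuclideanSpace ℝ (Fin 2)

/-- The real projective plane: the lines through the origin of `ℝ³`. -/
abbrev RP2 : Type := Projectivization ℝ (Fin 3 → ℝ)

/-- The usual (quotient) topology of the real projective plane. -/
noncomputable instance RP2.instTopologicalSpace : TopologicalSpace RP2 :=
  TopologicalSpace.coinduced
    (fun v : {v : Fin 3 → ℝ // v ≠ 0} => Projectivization.mk ℝ v.1 v.2) inferInstance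

theorem homCoord_ne_zero (p : Plane) : (![p 0, p 1, 1] : Fin 3 → ℝ) ≠ 0 := by
  intro h
  have h2 := congrFun h 2
  simp at h2

/-- The standard inclusion `ℝ² ⊂ ℝP²`, `(x, y) ↦ [x : y : 1]`. -/
noncomputable def toRP2 (p : Plane) : RP2 :=
  Projectivization.mk ℝ ![p 0, p 1, 1] (homCoord_ne_zero p)

/-- The set of points of `ℝP²` that lie in the linear subspace `W` of `ℝ³`. -/
def pointsIn (W : Submodule ℝ (Fin 3 → ℝ)) : Set RP2 :=
  {x | x.submodule ≤ W}

/-- `L` is a projective line of `ℝP²`. -/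
def IsProjLine (L : Set RP2) : Prop :=
  ∃ W : Submodule ℝ (Fin 3 → ℝ), Module.finrank ℝ W = 2 ∧ L = pointsIn W

/-- The projective line segment traced out by the nonnegative combinations of `u` and `v`.
Two distinct points `[u]`, `[v]` of `ℝP²` are joined by exactly two line segments, namely
`projSegment u v` and `projSegment u (-v)`. -/
def projSegment (u v : Fin 3 → ℝ) : Set RP2 :=
  {x | ∃ (a b : ℝ) (h : a • u + b • v ≠ 0), 0 ≤ a ∧ 0 ≤ b ∧
    x = Projectivization.mk ℝ (a • u + b • v) h}

/-- `X` is semiconvex: any two points of `X` can be joined by a line segment contained in `X`. -/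
def IsSemiconvex (X : Set RP2) : Prop :=
  ∀ x ∈ X, ∀ y ∈ X, ∃ (u v : Fin 3 → ℝ) (hu : u ≠ 0) (hv : v ≠ 0),
    Projectivization.mk ℝ u hu = x ∧ Projectivization.mk ℝ v hv = y ∧ projSegment u v ⊆ X

/-- `X` is a convex subset of `ℝP²`: it is semiconvex and misses some projective line, that is,
it is contained in one of the affine planes obtained from `ℝP²` by removing a projective line. -/
def IsProjConvex (X : Set RP2) : Prop :=
  IsSemiconvex X ∧ ∃ L : Set RP2, IsProjLine L ∧ X ⊆ Lᶜ

/-- `X` is a projective convex hull of `Y`: an inclusion-wise minimal convex subset of `ℝP²`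
containing `Y`. -/
def IsProjConvexHull (Y X : Set RP2) : Prop :=
  Minimal (fun Z : Set RP2 => IsProjConvex Z ∧ Y ⊆ Z) X

/-- `X` is a projective `k`-gon determined by `P`: a projective convex hull of a set `I` of `k`
points of `P` which has all points of `I` on its boundary. -/
def IsProjGon (k : ℕ) (P X : Set RP2) : Prop :=
  ∃ I : Finset RP2, (I : Set RP2) ⊆ P ∧ I.card = k ∧
    IsProjConvexHull (I : Set RP2) X ∧ (I : Set RP2) ⊆ frontier X

/-- `X` is a projective `k`-hole in `P`. -/
def IsProjKHole (k : ℕ) (P X : Set RP2) : Prop :=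
  3 ≤ k ∧ IsProjGon k P X ∧ Disjoint (interior X) P

/-- `X` is a projective hole in `P`. -/
def IsProjHole (P X : Set RP2) : Prop :=
  ∃ k, IsProjKHole k P X

/-- `H` is an (affine) hole in `S ⊆ ℝ²`: the convex polygon spanned by at least three points of `S`
in convex position, with no point of `S` in its interior. -/
def IsAffineHole (S H : Set Plane) : Prop :=
  ∃ I : Finset Plane, (I : Set Plane) ⊆ S ∧ 3 ≤ I.card ∧
    ConvexIndependent ℝ ((↑) : I → Plane) ∧
    H = convexHull ℝ (I : Set Plane) ∧ Disjoint (interior H) S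

/-- The number of projective 3-holes in `S ⊆ ℝ² ⊂ ℝP²`. -/
noncomputable def numProj3Holes (S : Set Plane) : ℕ :=
  Set.ncard {X : Set RP2 | IsProjKHole 3 (toRP2 '' S) X}

/-- The number of projective holes in `S ⊆ ℝ² ⊂ ℝP²` which are not affine holes in `ℝ²`. -/
noncomputable def numNonaffineProjHoles (S : Set Plane) : ℕ :=
  Set.ncard {X : Set RP2 | IsProjHole (toRP2 '' S) X ∧
    ¬ ∃ H : Set Plane, IsAffineHole S H ∧ X = toRP2 '' H}

/-- The law of `n` points chosen independently and uniformly at random from a set `K ⊆ ℝ²` of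
unit area. -/
noncomputable def uniformPoints (K : Set Plane) (n : ℕ) : MeasureTheory.Measure (Fin n → Plane) :=
  MeasureTheory.Measure.pi fun _ => MeasureTheory.volume.restrict K

/-! Lift the points of the plane to the vectors `(x, y, 1)`. A projective convex hull of finitely
many points misses a line `ker f`, and the signs of `f` at the lifts say which of them to negate;
the hull is then the image of the cone over the signed lifts (`isProjConvexHull_iff`). For points in
general position, holes thus correspond to pairs `(J, B)`: the vertex set and the negated vertices.
The pairs `(J, B)` and `(J, J \ B)` give the same hull, so one asks that the least index of `J` is
not in `B`. With this choice the hole is affine exactly when `B = ∅`. Almost every configuration is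
in general position, so both expectations become expectations of cardinalities of finite sets.

Lower bound, valid for every configuration in general position with at least three points: given
distinct `p`, `q`, consider the triangles in which `p` and `q` have opposite signs, and choose the
third vertex and its sign so that the fewest points are covered. A covered point could replace the
third vertex and shrink the cone, so this triangle is empty. A triangle arises from at most 9 pairs
(`card_le_signedHoles`).

Upper bound, affine triangles: with the longest edge `p q` fixed, the probability that the triangle
`p q r` is empty is at most a constant times `exp (-n * area)`. Its integral over `r` is `O(1 / n)`
uniformly in `p`, `q`, because the length of the edge cancels. There are at most `n ^ 3` ordered
triples, whence `O(n ^ 2)`.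

Upper bound, non-affine holes of all sizes: such a hole has an edge `a b` through infinity, along an
inner common tangent of the two sign classes (`exists_tangent`). On the side of `b`, let `b'` be the
last vertex in angular order around `a`, `v` the vertex furthest from `b b'`, and `w` the one
furthest, in terms of triangle areas, from the path `b v b'` (`exists_side`). Known parts of the
hole form an empty region `E`, and all further vertices lie in a region `R`. Summing over all
subsets of further vertices gives each remaining point the weight 0 on `E`, at most 2 on `R`, and 1
elsewhere. Since `|R| ≤ 4/5 * |E|`, the mean weight is at most `1 - |E| / 5`, and the sum over holes
of every size is controlled by `exp (-n * |E| / 5)` for at most three listed vertices per side.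

Integrating out a listed vertex gains a factor of order `1 / n`. For `v` and `w` this is an exact
integral over a half strip. For `b'` the area of the part of `K` beyond `b b'` is estimated from how
far `K` continues past `b` and past `b'` in direction `b - a`; this costs a weight `1 / √(dist(b,
Kᶜ))`, which is integrable over `K`. Only `a` and `b` remain free, and they give `n ^ 2`. -/

/-! ### Homogeneous coordinates and finitely generated cones -/

/-- The homogeneous coordinates `(x, y, 1)` of a point of the plane. -/
def homCoord (p : Plane) : Fin 3 → ℝ := ![p 0, p 1, 1]

theorem homCoord_ne (p : Plane) : homCoord p ≠ 0 := homCoord_ne_zero p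

theorem toRP2_eq (p : Plane) : toRP2 p = Projectivization.mk ℝ (homCoord p) (homCoord_ne p) := rfl

/-- The (doubled, signed) area of the triangle `p q r`. -/
def orient (p q r : Plane) : ℝ := (q 0 - p 0) * (r 1 - p 1) - (q 1 - p 1) * (r 0 - p 0)

theorem orient_swap (p q r : Plane) : orient q p r = -orient p q r := by
  unfold orient; ring

/-- Cramer's rule: barycentric coordinates cleared of their denominator. The signs of the three
coefficients tell in which signed cone over `a`, `b`, `c` the point `x` lies. -/
theorem orient_smul_homCoord (a b c x : Plane) :
    orient a b c • homCoord x =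
      orient x b c • homCoord a + orient a x c • homCoord b + orient a b x • homCoord c := by
  ext i
  fin_cases i <;> simp [homCoord, orient] <;> ring

/-- The convex cone generated by the vectors `g j`, `j ∈ J`. -/
def conicHull {ι : Type*} (g : ι → Fin 3 → ℝ) (J : Finset ι) : Set (Fin 3 → ℝ) :=
  {v | ∃ c : ι → ℝ, (∀ j, 0 ≤ c j) ∧ v = ∑ j ∈ J, c j • g j}

section conicHull
variable {ι : Type*} {g : ι → Fin 3 → ℝ} {J : Finset ι}

theorem mem_conicHull_of_mem {j : ι} (hj : j ∈ J) : g j ∈ conicHull g J := by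
  classical
  refine ⟨fun i => if i = j then 1 else 0, fun i => by dsimp only; split_ifs <;> simp, ?_⟩
  simp [hj]

theorem zero_mem_conicHull : (0 : Fin 3 → ℝ) ∈ conicHull g J :=
  ⟨fun _ => 0, fun _ => le_rfl, by simp⟩

theorem add_mem_conicHull {v w : Fin 3 → ℝ} (hv : v ∈ conicHull g J) (hw : w ∈ conicHull g J) :
    v + w ∈ conicHull g J := by
  obtain ⟨c, hc, rfl⟩ := hv
  obtain ⟨d, hd, rfl⟩ := hw
  refine ⟨fun j => c j + d j, fun j => add_nonneg (hc j) (hd j), ?_⟩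
  simp [add_smul, Finset.sum_add_distrib]

theorem smul_mem_conicHull {v : Fin 3 → ℝ} {t : ℝ} (ht : 0 ≤ t) (hv : v ∈ conicHull g J) :
    t • v ∈ conicHull g J := by
  obtain ⟨c, hc, rfl⟩ := hv
  exact ⟨fun j => t * c j, fun j => mul_nonneg ht (hc j), by simp [Finset.smul_sum, mul_smul]⟩

theorem conicHull_induction {C : Set (Fin 3 → ℝ)} (h0 : (0 : Fin 3 → ℝ) ∈ C)
    (hadd : ∀ v ∈ C, ∀ w ∈ C, v + w ∈ C) (hsmul : ∀ t : ℝ, 0 ≤ t → ∀ v ∈ C, t • v ∈ C)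
    (hg : ∀ j ∈ J, g j ∈ C) : conicHull g J ⊆ C := by
  classical
  rintro v ⟨c, hc, rfl⟩
  exact Finset.sum_induction _ (· ∈ C) (fun a b ha hb => hadd a ha b hb) h0
    (fun j hj => hsmul _ (hc j) _ (hg j hj))

theorem conicHull_mono {J' : Finset ι} (h : J ⊆ J') : conicHull g J ⊆ conicHull g J' :=
  conicHull_induction zero_mem_conicHull (fun _ hv _ hw => add_mem_conicHull hv hw)
    (fun _ ht _ hv => smul_mem_conicHull ht hv) (fun _ hj => mem_conicHull_of_mem (h hj))

/-- Positivity on the generators makes the cone pointed, so its projective image misses the line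
`ker f`. -/
theorem pos_or_eq_zero_of_mem_conicHull {f : (Fin 3 → ℝ) →ₗ[ℝ] ℝ} (hf : ∀ j ∈ J, 0 < f (g j))
    {v : Fin 3 → ℝ} (hv : v ∈ conicHull g J) : 0 < f v ∨ v = 0 := by
  suffices key : conicHull g J ⊆ {v | 0 < f v ∨ v = 0} from key hv
  clear hv v
  refine conicHull_induction (Or.inr rfl) ?_ ?_ (fun j hj => Or.inl (hf j hj))
  · rintro v (hv | rfl) w (hw | rfl)
    · left; rw [map_add]; exact add_pos hv hw
    · left; simpa using hv
    · left; simpa using hw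
    · right; simp
  · rintro t ht v (hv | rfl)
    · rcases ht.eq_or_lt with rfl | ht
      · right; simp
      · left; rw [map_smul]; exact mul_pos ht hv
    · right; simp

end conicHull

/-! ### Projective hulls as images of cones -/

/-- The subset of the projective plane covered by the cone generated by `g j`, `j ∈ J`. -/
def projHull {ι : Type*} (g : ι → Fin 3 → ℝ) (J : Finset ι) : Set RP2 :=
  {x | ∃ v ∈ conicHull g J, ∃ h : v ≠ 0, x = Projectivization.mk ℝ v h}

theorem mk_mem_pointsIn (W : Submodule ℝ (Fin 3 → ℝ)) (v : Fin 3 → ℝ) (h : v ≠ 0) :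
    Projectivization.mk ℝ v h ∈ pointsIn W ↔ v ∈ W := by
  simp [pointsIn, Projectivization.submodule_mk]

theorem IsProjLine.exists_functional {L : Set RP2} (hL : IsProjLine L) :
    ∃ f : (Fin 3 → ℝ) →ₗ[ℝ] ℝ, ∀ v (h : v ≠ 0), Projectivization.mk ℝ v h ∈ L ↔ f v = 0 := by
  obtain ⟨W, hW, rfl⟩ := hL
  have hlt : W < ⊤ := by
    rw [lt_top_iff_ne_top]
    rintro rfl
    simp at hW
  obtain ⟨f, hf, hle⟩ := Submodule.exists_le_ker_of_lt_top W hlt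
  have h1 := LinearMap.finrank_range_add_finrank_ker f
  have h2 : LinearMap.range f = ⊤ := LinearMap.range_eq_top.2 (LinearMap.surjective hf)
  rw [h2] at h1
  simp at h1
  have heq : W = LinearMap.ker f := Submodule.eq_of_le_of_finrank_eq hle (by omega)
  refine ⟨f, fun v h => ?_⟩
  rw [mk_mem_pointsIn, heq, LinearMap.mem_ker]

theorem isProjLine_ker {f : (Fin 3 → ℝ) →ₗ[ℝ] ℝ} (hf : f ≠ 0) :
    IsProjLine (pointsIn (LinearMap.ker f)) := by
  refine ⟨_, ?_, rfl⟩
  have h1 := LinearMap.finrank_range_add_finrank_ker f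
  rw [LinearMap.range_eq_top.2 (LinearMap.surjective hf)] at h1
  simp at h1
  omega

theorem projSegment_subset {C : Set (Fin 3 → ℝ)} {X : Set RP2}
    (hadd : ∀ v ∈ C, ∀ w ∈ C, v + w ∈ C) (hsmul : ∀ t : ℝ, 0 ≤ t → ∀ v ∈ C, t • v ∈ C)
    (hX : ∀ v ∈ C, ∀ h : v ≠ 0, Projectivization.mk ℝ v h ∈ X) {u v : Fin 3 → ℝ}
    (hu : u ∈ C) (hv : v ∈ C) : projSegment u v ⊆ X := by
  rintro x ⟨a, b, h, ha, hb, rfl⟩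
  exact hX _ (hadd _ (hsmul a ha _ hu) _ (hsmul b hb _ hv)) h

theorem isProjConvex_projHull {ι : Type*} {g : ι → Fin 3 → ℝ} {J : Finset ι}
    (hJ : J.Nonempty) {f : (Fin 3 → ℝ) →ₗ[ℝ] ℝ} (hf : ∀ j ∈ J, 0 < f (g j)) :
    IsProjConvex (projHull g J) := by
  constructor
  · rintro x ⟨v, hv, hv0, rfl⟩ y ⟨w, hw, hw0, rfl⟩
    refine ⟨v, w, hv0, hw0, rfl, rfl, projSegment_subset (C := conicHull g J)
      (fun _ hv _ hw => add_mem_conicHull hv hw) (fun _ ht _ hv => smul_mem_conicHull ht hv) ?_ hv hw⟩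
    exact fun u hu h => ⟨u, hu, h, rfl⟩
  · obtain ⟨j, hj⟩ := hJ
    refine ⟨_, isProjLine_ker (f := f) ?_, ?_⟩
    · rintro rfl
      simpa using hf j hj
    · rintro x ⟨v, hv, hv0, rfl⟩
      rw [Set.mem_compl_iff, mk_mem_pointsIn, LinearMap.mem_ker]
      have := pos_or_eq_zero_of_mem_conicHull hf hv
      rcases this with h | h
      · exact h.ne'
      · exact absurd h hv0

theorem mk_smul_eq {v : Fin 3 → ℝ} (hv : v ≠ 0) {t : ℝ} (ht : t ≠ 0) :
    Projectivization.mk ℝ (t • v) (smul_ne_zero ht hv) = Projectivization.mk ℝ v hv := by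
  rw [Projectivization.mk_eq_mk_iff']
  exact ⟨t, rfl⟩

/-- The representatives with `f > 0` of points of `Z` are closed under addition: of the two segments
joining `[v]` and `[w]`, one contains `[v + w]`, while the other meets `ker f`, which `Z` avoids.
They therefore contain the whole cone as soon as they contain its generators. -/
theorem projHull_subset_of_isSemiconvex {ι : Type*} {g : ι → Fin 3 → ℝ} {J : Finset ι}
    {f : (Fin 3 → ℝ) →ₗ[ℝ] ℝ} (hf : ∀ j ∈ J, 0 < f (g j)) {Z : Set RP2} (hZ : IsSemiconvex Z)
    (hZf : ∀ v (h : v ≠ 0), Projectivization.mk ℝ v h ∈ Z → f v ≠ 0)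
    (hg : ∀ j ∈ J, ∃ h : g j ≠ 0, Projectivization.mk ℝ (g j) h ∈ Z) :
    projHull g J ⊆ Z := by
  have key : conicHull g J ⊆ {v | (0 < f v ∧ ∃ h : v ≠ 0, Projectivization.mk ℝ v h ∈ Z) ∨ v = 0} := by
    refine conicHull_induction (Or.inr rfl) ?_ ?_ (fun j hj => Or.inl ⟨hf j hj, hg j hj⟩)
    · rintro v (⟨hv, hv0, hvZ⟩ | rfl) w (⟨hw, hw0, hwZ⟩ | rfl)
      · left
        have hvw : 0 < f (v + w) := by rw [map_add]; exact add_pos hv hw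
        have hvw0 : v + w ≠ 0 := by rintro h; simp [h] at hvw
        refine ⟨hvw, hvw0, ?_⟩
        obtain ⟨u', v', hu', hv', h1, h2, hsub⟩ := hZ _ hvZ _ hwZ
        rw [Projectivization.mk_eq_mk_iff'] at h1 h2
        obtain ⟨α, rfl⟩ := h1
        obtain ⟨β, rfl⟩ := h2
        have hα : α ≠ 0 := by rintro rfl; simp at hu'
        have hβ : β ≠ 0 := by rintro rfl; simp at hv'
        -- The segment provided by semiconvexity is spanned by `α • v` and `β • w`. Equal signs mean
        -- that it is the segment through `[v + w]`.
        by_cases hs : 0 < α * β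
        · have e : |α|⁻¹ • α • v + |β|⁻¹ • β • w = (α / |α|) • (v + w) := by
            have : α / |α| = β / |β| := by
              rcases hα.lt_or_gt with h | h
              · have h' : β < 0 := by nlinarith
                rw [abs_of_neg h, abs_of_neg h', div_neg, div_neg, div_self hα, div_self hβ]
              · have h' : 0 < β := by nlinarith
                rw [abs_of_pos h, abs_of_pos h', div_self hα, div_self hβ]
            rw [smul_add]
            nth_rw 2 [this]
            simp only [smul_smul, div_eq_inv_mul]
          have hne : (α / |α|) ≠ 0 := div_ne_zero hα (abs_ne_zero.2 hα)
          have := hsub (show Projectivization.mk ℝ (|α|⁻¹ • α • v + |β|⁻¹ • β • w)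
            (by rw [e]; exact smul_ne_zero hne hvw0) ∈ _ from
            ⟨|α|⁻¹, |β|⁻¹, _, by positivity, by positivity, rfl⟩)
          rw [← mk_smul_eq hvw0 hne]
          convert this using 2
          exact e.symm
        · have hs' : α * β < 0 := lt_of_le_of_ne (not_lt.1 hs) (mul_ne_zero hα hβ)
          -- With opposite signs, the coefficients are chosen so that this combination lies in `ker
          -- f`.
          set z := (|α| * f v)⁻¹ • α • v + (|β| * f w)⁻¹ • β • w with hz
          have hfz : f z = 0 := by
            simp only [hz, map_add, map_smul, smul_eq_mul]
            have h3 := abs_ne_zero.2 hα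
            have h4 := abs_ne_zero.2 hβ
            field_simp
            rcases hα.lt_or_gt with h | h
            · have h' : 0 < β := by nlinarith
              rw [abs_of_neg h, abs_of_pos h']; ring
            · have h' : β < 0 := by nlinarith
              rw [abs_of_pos h, abs_of_neg h']; ring
          -- The combination vanishes only if `v` and `w` are proportional, and then `v + w`
          -- represents the same point as `v`.
          by_cases hz0 : z = 0
          · have hw' : w = (-(((|β| * f w)⁻¹ * β)⁻¹ * ((|α| * f v)⁻¹ * α))) • v := by
              have hc : (|β| * f w)⁻¹ * β ≠ 0 :=
                mul_ne_zero (inv_ne_zero (mul_ne_zero (abs_ne_zero.2 hβ) hw.ne')) hβ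
              have h5 : ((|β| * f w)⁻¹ * β) • w = -(((|α| * f v)⁻¹ * α) • v) := by
                rw [mul_smul, mul_smul, eq_neg_iff_add_eq_zero, add_comm]
                exact hz0
              calc w = ((|β| * f w)⁻¹ * β)⁻¹ • ((|β| * f w)⁻¹ * β) • w := by
                    rw [smul_smul, inv_mul_cancel₀ hc, one_smul]
                _ = _ := by rw [h5, smul_neg, smul_smul, neg_smul]
            set t := -(((|β| * f w)⁻¹ * β)⁻¹ * ((|α| * f v)⁻¹ * α))
            have e : v + w = (1 + t) • v := by rw [hw', add_smul, one_smul]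
            have ht : 1 + t ≠ 0 := by
              intro h
              rw [e, h, zero_smul] at hvw0
              exact hvw0 rfl
            rw [← mk_smul_eq hv0 ht] at hvZ
            convert hvZ using 2
          · exact absurd hfz (hZf z hz0 (hsub ⟨_, _, hz0, by positivity, by positivity, rfl⟩))
      · left; simpa using ⟨hv, hv0, hvZ⟩
      · left; simpa using ⟨hw, hw0, hwZ⟩
      · right; simp
    · rintro t ht v (⟨hv, hv0, hvZ⟩ | rfl)
      · rcases ht.eq_or_lt with rfl | ht
        · right; simp
        · left
          refine ⟨by rw [map_smul]; exact mul_pos ht hv, smul_ne_zero ht.ne' hv0, ?_⟩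
          rwa [mk_smul_eq hv0 ht.ne']
      · right; simp
  rintro x ⟨v, hv, hv0, rfl⟩
  rcases key hv with ⟨_, _, h⟩ | h
  · exact h
  · exact absurd h hv0

/-! ### Signed configurations and their convex hulls -/

/-- The homogeneous coordinates of the points `ω j`, with the sign changed for `j ∈ B`. -/
def signedCoord {n : ℕ} (ω : Fin n → Plane) (B : Finset (Fin n)) (j : Fin n) : Fin 3 → ℝ :=
  if j ∈ B then -homCoord (ω j) else homCoord (ω j)

/-- The points `ω j` are distinct and no three of them are collinear. -/
def GeneralPosition {n : ℕ} (ω : Fin n → Plane) : Prop :=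
  Function.Injective ω ∧ ∀ i j k, i ≠ j → i ≠ k → j ≠ k → orient (ω i) (ω j) (ω k) ≠ 0

/-- The points `ω j`, `j ∈ J`, of which those with `j ∈ B` can be separated from the others by a
line, span a projective polygon that contains no other point of the configuration and has all the
`ω j`, `j ∈ J`, as vertices. -/
def IsSignedHole {n : ℕ} (ω : Fin n → Plane) (J B : Finset (Fin n)) : Prop :=
  (∃ f : (Fin 3 → ℝ) →ₗ[ℝ] ℝ, ∀ j ∈ J, 0 < f (signedCoord ω B j)) ∧
    ∀ i, homCoord (ω i) ∉ conicHull (signedCoord ω B) (J.erase i) ∧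
      -homCoord (ω i) ∉ conicHull (signedCoord ω B) (J.erase i)

section
variable {n : ℕ} {ω : Fin n → Plane} {J B : Finset (Fin n)}

theorem signedCoord_eq_or (ω : Fin n → Plane) (B : Finset (Fin n)) (j : Fin n) :
    signedCoord ω B j = homCoord (ω j) ∨ signedCoord ω B j = -homCoord (ω j) := by
  unfold signedCoord; split_ifs <;> simp

theorem signedCoord_ne_zero (ω : Fin n → Plane) (B : Finset (Fin n)) (j : Fin n) :
    signedCoord ω B j ≠ 0 := by
  rcases signedCoord_eq_or ω B j with h | h <;> rw [h]
  · exact homCoord_ne _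
  · exact neg_ne_zero.2 (homCoord_ne _)

theorem mk_signedCoord (ω : Fin n → Plane) (B : Finset (Fin n)) (j : Fin n) :
    Projectivization.mk ℝ (signedCoord ω B j) (signedCoord_ne_zero ω B j) = toRP2 (ω j) := by
  rw [toRP2_eq, Projectivization.mk_eq_mk_iff']
  rcases signedCoord_eq_or ω B j with h | h <;> rw [h]
  · exact ⟨1, by simp⟩
  · exact ⟨-1, by simp⟩

theorem toRP2_injective : Function.Injective toRP2 := by
  intro p q h
  rw [toRP2_eq, toRP2_eq, Projectivization.mk_eq_mk_iff'] at h
  obtain ⟨a, ha⟩ := h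
  have h2 := congrFun ha 2
  have h0 := congrFun ha 0
  have h1 := congrFun ha 1
  simp [homCoord] at h0 h1 h2
  subst h2
  ext i
  fin_cases i
  · simpa using h0.symm
  · simpa using h1.symm

theorem toRP2_mem_projHull {j : Fin n} (hj : j ∈ J) :
    toRP2 (ω j) ∈ projHull (signedCoord ω B) J :=
  ⟨_, mem_conicHull_of_mem hj, signedCoord_ne_zero ω B j, (mk_signedCoord ω B j).symm⟩

theorem mk_mem_projHull {v : Fin 3 → ℝ} (hv : v ≠ 0) {g : Fin n → Fin 3 → ℝ} :
    Projectivization.mk ℝ v hv ∈ projHull g J ↔ v ∈ conicHull g J ∨ -v ∈ conicHull g J := by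
  constructor
  · rintro ⟨w, hw, hw0, h⟩
    rw [Projectivization.mk_eq_mk_iff'] at h
    obtain ⟨a, rfl⟩ := h
    rcases le_total 0 a with ha | ha
    · exact Or.inl (smul_mem_conicHull ha hw)
    · right
      rw [← neg_smul]
      exact smul_mem_conicHull (neg_nonneg.2 ha) hw
  · rintro (h | h)
    · exact ⟨v, h, hv, rfl⟩
    · refine ⟨-v, h, neg_ne_zero.2 hv, ?_⟩
      rw [Projectivization.mk_eq_mk_iff']
      exact ⟨-1, by simp⟩

/-- A hull misses a line `ker f`; negating the points with `f < 0` puts all lifts on the positive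
side, and the resulting cone lies in every convex set that contains the points and avoids `ker f`.
Conversely, any convex set inside such a cone image avoids `ker f` as well, which gives minimality.
-/
theorem isProjConvexHull_iff (hJ : J.Nonempty) (X : Set RP2) :
    IsProjConvexHull ((fun j => toRP2 (ω j)) '' (J : Set (Fin n))) X ↔
      ∃ B ⊆ J, (∃ f : (Fin 3 → ℝ) →ₗ[ℝ] ℝ, ∀ j ∈ J, 0 < f (signedCoord ω B j)) ∧
        X = projHull (signedCoord ω B) J := by
  classical
  constructor
  · rintro ⟨⟨hX, hIX⟩, hmin⟩
    obtain ⟨hsemi, L, hL, hXL⟩ := hX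
    obtain ⟨f, hf⟩ := hL.exists_functional
    have hXf : ∀ v (h : v ≠ 0), Projectivization.mk ℝ v h ∈ X → f v ≠ 0 := fun v h hv h0 =>
      hXL hv ((hf v h).2 h0)
    have hmem : ∀ j ∈ J, toRP2 (ω j) ∈ X := fun j hj => hIX ⟨j, hj, rfl⟩
    let B := J.filter fun j => f (homCoord (ω j)) < 0
    have hB : ∀ j ∈ J, 0 < f (signedCoord ω B j) := by
      intro j hj
      have h1 := hXf _ (homCoord_ne (ω j)) (hmem j hj)
      unfold signedCoord
      split_ifs with h2
      · have := (Finset.mem_filter.1 h2).2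
        rw [map_neg]; linarith
      · have : ¬ f (homCoord (ω j)) < 0 := fun h => h2 (Finset.mem_filter.2 ⟨hj, h⟩)
        exact lt_of_le_of_ne (not_lt.1 this) h1.symm
    refine ⟨B, Finset.filter_subset _ _, ⟨f, hB⟩, ?_⟩
    have hsub : projHull (signedCoord ω B) J ⊆ X := by
      refine projHull_subset_of_isSemiconvex hB hsemi hXf fun j hj => ⟨signedCoord_ne_zero ω B j, ?_⟩
      rw [mk_signedCoord]
      exact hmem j hj
    refine Set.Subset.antisymm (hmin ⟨isProjConvex_projHull hJ hB, ?_⟩ hsub) hsub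
    rintro _ ⟨j, hj, rfl⟩
    exact toRP2_mem_projHull hj
  · rintro ⟨B, -, ⟨f, hf⟩, rfl⟩
    refine ⟨⟨isProjConvex_projHull hJ hf, ?_⟩, ?_⟩
    · rintro _ ⟨j, hj, rfl⟩
      exact toRP2_mem_projHull hj
    · rintro Z ⟨hZ, hIZ⟩ hZX
      refine projHull_subset_of_isSemiconvex hf hZ.1 ?_ fun j hj => ⟨signedCoord_ne_zero ω B j, ?_⟩
      · intro v h hv hfv
        rcases (mk_mem_projHull h).1 (hZX hv) with h1 | h1
        · rcases pos_or_eq_zero_of_mem_conicHull hf h1 with h2 | h2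
          · exact h2.ne' hfv
          · exact h h2
        · rcases pos_or_eq_zero_of_mem_conicHull hf h1 with h2 | h2
          · rw [map_neg, hfv] at h2; simp at h2
          · exact h (neg_eq_zero.1 h2)
      · rw [mk_signedCoord]
        exact hIZ ⟨j, hj, rfl⟩

/-- Three points of a configuration in general position have independent coordinates. -/
theorem GeneralPosition.eq_zero_of_sum (hω : GeneralPosition ω) {i j k : Fin n} (hij : i ≠ j)
    (hik : i ≠ k) (hjk : j ≠ k) {a b c : ℝ}
    (h : a • homCoord (ω i) + b • homCoord (ω j) + c • homCoord (ω k) = 0) :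
    a = 0 ∧ b = 0 ∧ c = 0 := by
  have ho := hω.2 i j k hij hik hjk
  have h0 := congrFun h 0
  have h1 := congrFun h 1
  have h2 := congrFun h 2
  simp [homCoord] at h0 h1 h2
  unfold orient at ho
  refine ⟨?_, ?_, ?_⟩
  · apply mul_left_cancel₀ ho
    linear_combination (ω j 1 - ω k 1) * h0 - (ω j 0 - ω k 0) * h1 + (ω j 0 * ω k 1 - ω k 0 * ω j 1) * h2
  · apply mul_left_cancel₀ ho
    linear_combination (ω k 1 - ω i 1) * h0 - (ω k 0 - ω i 0) * h1 + (ω k 0 * ω i 1 - ω i 0 * ω k 1) * h2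
  · apply mul_left_cancel₀ ho
    linear_combination (ω i 1 - ω j 1) * h0 - (ω i 0 - ω j 0) * h1 + (ω i 0 * ω j 1 - ω j 0 * ω i 1) * h2

end

/-! ### Interior points and vertices of a hull -/

theorem continuous_projMk : Continuous
    (fun v : {v : Fin 3 → ℝ // v ≠ 0} => (Projectivization.mk ℝ v.1 v.2 : RP2)) :=
  continuous_coinduced_rng

/-- The preimage in `ℝ³` without the origin is `V ∪ -V`. -/
theorem isOpen_projImage {V : Set (Fin 3 → ℝ)} (hV : IsOpen V)
    (hs : ∀ t : ℝ, 0 < t → ∀ v ∈ V, t • v ∈ V) :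
    IsOpen {x : RP2 | ∃ v ∈ V, ∃ h : v ≠ 0, x = Projectivization.mk ℝ v h} := by
  rw [isOpen_coinduced]
  have : (fun v : {v : Fin 3 → ℝ // v ≠ 0} => (Projectivization.mk ℝ v.1 v.2 : RP2)) ⁻¹'
      {x : RP2 | ∃ v ∈ V, ∃ h : v ≠ 0, x = Projectivization.mk ℝ v h} =
      Subtype.val ⁻¹' (V ∪ Neg.neg ⁻¹' V) := by
    ext ⟨v, hv⟩
    constructor
    · rintro ⟨w, hw, hw0, h⟩
      obtain ⟨a, rfl⟩ := (Projectivization.mk_eq_mk_iff' ℝ _ _ _ _).1 h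
      have ha : a ≠ 0 := by rintro rfl; simp at hv
      rcases ha.lt_or_gt with ha | ha
      · right
        change -(a • w) ∈ V
        rw [← neg_smul]
        exact hs _ (neg_pos.2 ha) _ hw
      · exact Or.inl (hs _ ha _ hw)
    · rintro (h | h)
      · exact ⟨v, h, hv, rfl⟩
      · exact ⟨-v, h, neg_ne_zero.2 hv, (Projectivization.mk_eq_mk_iff' ℝ _ _ _ _).2 ⟨-1, by simp⟩⟩
  rw [this]
  exact (hV.union (hV.preimage continuous_neg)).preimage continuous_subtype_val

section
variable {n : ℕ} {ω : Fin n → Plane} {J B : Finset (Fin n)}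

theorem exists_signedCoord_eq (ω : Fin n → Plane) (B : Finset (Fin n)) (j : Fin n) :
    ∃ s : ℝ, s ≠ 0 ∧ signedCoord ω B j = s • homCoord (ω j) := by
  rcases signedCoord_eq_or ω B j with h | h
  · exact ⟨1, one_ne_zero, by simpa using h⟩
  · exact ⟨-1, by norm_num, by simpa using h⟩

theorem GeneralPosition.signedCoord_eq_zero_of_sum (hω : GeneralPosition ω) {i j k : Fin n}
    (hij : i ≠ j) (hik : i ≠ k) (hjk : j ≠ k) {a b c : ℝ}
    (h : a • signedCoord ω B i + b • signedCoord ω B j + c • signedCoord ω B k = 0) :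
    a = 0 ∧ b = 0 ∧ c = 0 := by
  obtain ⟨s, hs, hs'⟩ := exists_signedCoord_eq ω B i
  obtain ⟨t, ht, ht'⟩ := exists_signedCoord_eq ω B j
  obtain ⟨u, hu, hu'⟩ := exists_signedCoord_eq ω B k
  rw [hs', ht', hu', smul_smul, smul_smul, smul_smul] at h
  have := hω.eq_zero_of_sum hij hik hjk h
  simpa [hs, ht, hu] using this

theorem homCoord_smul_ne (hω : GeneralPosition ω) {i j : Fin n} (hij : i ≠ j) {s t : ℝ}
    (hs : s ≠ 0) : s • homCoord (ω i) ≠ t • homCoord (ω j) := by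
  intro h
  apply hij
  apply hω.1
  have h0 := congrFun h 0
  have h1 := congrFun h 1
  have h2 := congrFun h 2
  simp [homCoord] at h0 h1 h2
  subst h2
  ext l
  fin_cases l
  · simpa [hs] using h0
  · simpa [hs] using h1

/-- A point of the configuration in the cone spanned by other points is an interior point. -/
theorem toRP2_mem_interior (hω : GeneralPosition ω) {i : Fin n} (hi : i ∉ J)
    (h : homCoord (ω i) ∈ conicHull (signedCoord ω B) J ∨
      -homCoord (ω i) ∈ conicHull (signedCoord ω B) J) :
    toRP2 (ω i) ∈ interior (projHull (signedCoord ω B) J) := by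
  classical
  obtain ⟨t, ht, hv⟩ : ∃ t : ℝ, t ≠ 0 ∧ t • homCoord (ω i) ∈ conicHull (signedCoord ω B) J := by
    rcases h with h | h
    · exact ⟨1, one_ne_zero, by simpa using h⟩
    · exact ⟨-1, by norm_num, by simpa using h⟩
  obtain ⟨c, hc, hsum⟩ := hv
  set g := signedCoord ω B with hg
  let T := J.filter fun j => 0 < c j
  have hT : t • homCoord (ω i) = ∑ j ∈ T, c j • g j := by
    rw [hsum]
    symm
    apply Finset.sum_subset (Finset.filter_subset _ _)
    intro j hj hjT
    have : ¬ 0 < c j := fun h => hjT (Finset.mem_filter.2 ⟨hj, h⟩)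
    rw [le_antisymm (not_lt.1 this) (hc j), zero_smul]
  have hiT : ∀ j ∈ T, i ≠ j := by
    rintro j hj rfl
    exact hi (Finset.mem_filter.1 hj).1
  -- With at most two positive coefficients the point would coincide with another one or be
  -- collinear with two others.
  have hcard : 2 < T.card := by
    by_contra hlt
    have : T.card = 0 ∨ T.card = 1 ∨ T.card = 2 := by omega
    rcases this with h0 | h1 | h2
    · rw [Finset.card_eq_zero] at h0
      rw [h0, Finset.sum_empty] at hT
      exact smul_ne_zero ht (homCoord_ne _) hT
    · obtain ⟨j, hj⟩ := Finset.card_eq_one.1 h1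
      rw [hj, Finset.sum_singleton] at hT
      obtain ⟨s, hs, hs'⟩ := exists_signedCoord_eq ω B j
      rw [hg, hs', smul_smul] at hT
      exact homCoord_smul_ne hω (hiT j (by simp [hj])) ht hT
    · obtain ⟨j, k, hjk, hj⟩ := Finset.card_eq_two.1 h2
      rw [hj, Finset.sum_pair hjk] at hT
      obtain ⟨s, hs, hs'⟩ := exists_signedCoord_eq ω B i
      have hT' : (t * s⁻¹) • g i + (-c j) • g j + (-c k) • g k = 0 := by
        rw [hg, hs', smul_smul, mul_assoc, inv_mul_cancel₀ hs, mul_one, hT]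
        simp only [neg_smul]; abel
      have := (hω.signedCoord_eq_zero_of_sum (hiT j (by simp [hj])) (hiT k (by simp [hj])) hjk hT').1
      exact mul_ne_zero ht (inv_ne_zero hs) this
  obtain ⟨k₁, k₂, k₃, h1, h2, h3, h12, h13, h23⟩ := Finset.two_lt_card_iff.1 hcard
  -- Three of the generators with positive coefficient form a basis, so the map from coefficients to
  -- vectors is onto, hence open. The image of the positive orthant is the required open set.
  let Ψ : (Fin n → ℝ) →ₗ[ℝ] (Fin 3 → ℝ) := ∑ j ∈ T, (LinearMap.proj j).smulRight (g j)
  have hΨ : ∀ d, Ψ d = ∑ j ∈ T, d j • g j := fun d => by simp [Ψ]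
  have hsurj : Function.Surjective Ψ := by
    let Θ : (Fin 3 → ℝ) →ₗ[ℝ] (Fin 3 → ℝ) :=
      (LinearMap.proj 0).smulRight (g k₁) + (LinearMap.proj 1).smulRight (g k₂) +
        (LinearMap.proj 2).smulRight (g k₃)
    have hΘ : Function.Injective Θ := by
      rw [← LinearMap.ker_eq_bot, LinearMap.ker_eq_bot']
      intro m hm
      simp only [Θ, LinearMap.add_apply, LinearMap.smulRight_apply, LinearMap.proj_apply] at hm
      obtain ⟨ha, hb, hc⟩ := hω.signedCoord_eq_zero_of_sum h12 h13 h23 hm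
      ext l
      fin_cases l <;> simp [ha, hb, hc]
    rw [LinearMap.injective_iff_surjective] at hΘ
    intro v
    obtain ⟨m, hm⟩ := hΘ v
    refine ⟨fun j => if j = k₁ then m 0 else if j = k₂ then m 1 else if j = k₃ then m 2 else 0, ?_⟩
    rw [hΨ, ← hm]
    have hsub : ({k₁, k₂, k₃} : Finset (Fin n)) ⊆ T := by
      intro x hx
      simp only [Finset.mem_insert, Finset.mem_singleton] at hx
      rcases hx with rfl | rfl | rfl <;> assumption
    rw [← Finset.sum_subset hsub]
    · rw [Finset.sum_insert (by simp [h12, h13]), Finset.sum_pair h23]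
      simp [Θ, h12.symm, h13.symm, h23.symm, add_assoc]
    · intro x _ hx
      simp only [Finset.mem_insert, Finset.mem_singleton, not_or] at hx
      simp [hx]
  have hopen : IsOpen (Ψ '' {d | ∀ j, 0 < d j}) := by
    apply LinearMap.isOpenMap_of_finiteDimensional Ψ hsurj
    rw [Set.ofPred_forall]
    exact isOpen_iInter_of_finite fun j => isOpen_lt continuous_const (continuous_apply j)
  rw [mem_interior]
  refine ⟨_, ?_, isOpen_projImage hopen ?_, ?_⟩
  · rintro x ⟨v, ⟨d, hd, rfl⟩, hv, rfl⟩
    refine ⟨_, conicHull_mono (Finset.filter_subset _ _ : T ⊆ J) ?_, hv, rfl⟩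
    exact ⟨d, fun j => (hd j).le, hΨ d⟩
  · rintro s hs _ ⟨d, hd, rfl⟩
    exact ⟨s • d, fun j => mul_pos hs (hd j), by simp⟩
  -- Coefficients outside `T` do not enter `Ψ`; the value 1 is only there to be positive.
  · refine ⟨t • homCoord (ω i), ⟨fun j => if j ∈ T then c j else 1, ?_, ?_⟩,
      smul_ne_zero ht (homCoord_ne _), ?_⟩
    · intro j
      dsimp only
      split_ifs with hj
      · exact (Finset.mem_filter.1 hj).2
      · exact one_pos
    · rw [hΨ, hT]
      exact Finset.sum_congr rfl fun j hj => by simp [hj]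
    · rw [mk_smul_eq _ ht]; rfl

/-- Collect the multiples of `g i` on one side: the other side has positive `f`, so the remaining
coefficient of `g i` is positive and can be divided out. -/
theorem mem_conicHull_erase_of_sub_mem {g : Fin n → Fin 3 → ℝ} {f : (Fin 3 → ℝ) →ₗ[ℝ] ℝ}
    (hf : ∀ j ∈ J, 0 < f (g j)) {i j : Fin n} (hi : i ∈ J) (hj : j ∈ J) (hij : i ≠ j) {δ : ℝ}
    (hδ : 0 < δ) (h : g i - δ • g j ∈ conicHull g J) : g i ∈ conicHull g (J.erase i) := by
  classical
  obtain ⟨c, hc, hsum⟩ := h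
  rw [← Finset.add_sum_erase _ _ hi] at hsum
  have hmem : δ • g j + ∑ k ∈ J.erase i, c k • g k ∈ conicHull g (J.erase i) :=
    add_mem_conicHull (smul_mem_conicHull hδ.le (mem_conicHull_of_mem (by simp [hj, hij.symm])))
      ⟨c, hc, rfl⟩
  have heq : (1 - c i) • g i = δ • g j + ∑ k ∈ J.erase i, c k • g k := by
    rw [sub_smul, one_smul, sub_eq_iff_eq_add, add_assoc, add_comm _ (c i • g i), ← hsum]
    abel
  have hpos : 0 < f ((1 - c i) • g i) := by
    rw [heq, map_add, map_smul]
    refine add_pos_of_pos_of_nonneg (mul_pos hδ (hf j hj)) ?_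
    rw [map_sum]
    refine Finset.sum_nonneg fun k hk => ?_
    rw [map_smul]
    exact mul_nonneg (hc k) (hf k (Finset.mem_of_mem_erase hk)).le
  rw [map_smul, smul_eq_mul] at hpos
  have h1 : 0 < 1 - c i := pos_of_mul_pos_left hpos (hf i hi).le
  rw [← heq] at hmem
  have := smul_mem_conicHull (inv_nonneg.2 h1.le) hmem
  rwa [smul_smul, inv_mul_cancel₀ h1.ne', one_smul] at this

/-- A vertex of a signed hole is not an interior point. -/
theorem toRP2_notMem_interior (h : IsSignedHole ω J B) (hJ : 1 < J.card) {i : Fin n}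
    (hi : i ∈ J) : toRP2 (ω i) ∉ interior (projHull (signedCoord ω B) J) := by
  intro hint
  obtain ⟨⟨f, hf⟩, hmem⟩ := h
  obtain ⟨j, hj, hji⟩ := Finset.exists_mem_ne hJ i
  set g := signedCoord ω B with hg
  rw [← mk_signedCoord ω B i] at hint
  have hopen : IsOpen ((fun v : {v : Fin 3 → ℝ // v ≠ 0} => (Projectivization.mk ℝ v.1 v.2 : RP2)) ⁻¹'
    interior (projHull g J)) := isOpen_interior.preimage continuous_projMk
  obtain ⟨U, hU, hUeq⟩ := isOpen_induced_iff.1 hopen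
  have hgU : g i ∈ U := by
    have : (⟨g i, signedCoord_ne_zero ω B i⟩ : {v : Fin 3 → ℝ // v ≠ 0}) ∈ Subtype.val ⁻¹' U := by
      rw [hUeq]; exact hint
    exact this
  -- An interior vertex could be pushed slightly away from another vertex `j` without leaving the
  -- hull, and then it would lie in the cone of the other vertices.
  have hcont : Continuous fun δ : ℝ => g i - δ • g j := by fun_prop
  have h1 : ∀ᶠ δ : ℝ in nhdsWithin 0 (Set.Ioi 0), g i - δ • g j ∈ U :=
    (hcont.tendsto 0).mono_left nhdsWithin_le_nhds |>.eventually_mem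
      (hU.mem_nhds (by simpa using hgU))
  have hcf : Continuous fun δ : ℝ => f (g i) - δ * f (g j) := by fun_prop
  -- Keeping `f` positive excludes that only the negative of the perturbed vector lies in the cone.
  have h2 : ∀ᶠ δ : ℝ in nhdsWithin 0 (Set.Ioi 0), f (g i) - δ * f (g j) ∈ Set.Ioi 0 :=
    (hcf.tendsto 0).mono_left nhdsWithin_le_nhds |>.eventually_mem
      (isOpen_Ioi.mem_nhds (by simpa using hf i hi))
  obtain ⟨δ, ⟨hδU, hδf⟩, hδ⟩ := ((h1.and h2).and self_mem_nhdsWithin).exists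
  have hδf' : 0 < f (g i - δ • g j) := by simpa using hδf
  have hne : g i - δ • g j ≠ 0 := by
    intro h0
    rw [h0, map_zero] at hδf'
    exact lt_irrefl _ hδf'
  have hin : (⟨g i - δ • g j, hne⟩ : {v : Fin 3 → ℝ // v ≠ 0}) ∈ Subtype.val ⁻¹' U := hδU
  rw [hUeq] at hin
  have hcone : g i - δ • g j ∈ conicHull g J := by
    rcases (mk_mem_projHull hne).1 (interior_subset hin) with h | h
    · exact h
    · rcases pos_or_eq_zero_of_mem_conicHull hf h with h3 | h3
      · rw [map_neg] at h3; linarith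
      · exact absurd (neg_eq_zero.1 h3) hne
  have := mem_conicHull_erase_of_sub_mem hf hi hj hji.symm hδ hcone
  rcases signedCoord_eq_or ω B i with h | h
  · rw [hg, h] at this; exact (hmem i).1 this
  · rw [hg, h] at this; exact (hmem i).2 this

end

/-! ### Holes as normalized sign patterns -/

section
variable {n : ℕ} {ω : Fin n → Plane} {J B : Finset (Fin n)}

/-- For `i ∉ J` the erasure `J.erase i` changes nothing, so the second clause of `IsSignedHole` says
that the hull covers no further point of the configuration. -/
theorem IsSignedHole.mem_iff (h : IsSignedHole ω J B) (i : Fin n) :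
    i ∈ J ↔ toRP2 (ω i) ∈ projHull (signedCoord ω B) J := by
  refine ⟨toRP2_mem_projHull, fun hi => ?_⟩
  by_contra hiJ
  have := h.2 i
  rw [Finset.erase_eq_of_notMem hiJ] at this
  rw [toRP2_eq, mk_mem_projHull] at hi
  tauto

/-- The topological conditions turn into cone conditions: in general position a point in a cone over
other points is interior, and a vertex outside the cone of the other vertices is not. -/
theorem isProjKHole_iff (hω : GeneralPosition ω) (k : ℕ) (X : Set RP2) :
    IsProjKHole k (toRP2 '' Set.range ω) X ↔
      3 ≤ k ∧ ∃ J B : Finset (Fin n), B ⊆ J ∧ J.card = k ∧ IsSignedHole ω J B ∧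
        X = projHull (signedCoord ω B) J := by
  classical
  have hinj : Function.Injective fun j => toRP2 (ω j) := toRP2_injective.comp hω.1
  refine and_congr_right fun hk => ?_
  constructor
  · rintro ⟨⟨I, hIP, hIk, hhull, hfr⟩, hdisj⟩
    let J : Finset (Fin n) := Finset.univ.filter fun j => toRP2 (ω j) ∈ I
    have hJI : I = J.image fun j => toRP2 (ω j) := by
      ext x
      simp only [Finset.mem_image, J, Finset.mem_filter, Finset.mem_univ, true_and]
      constructor
      · intro hx
        obtain ⟨_, ⟨j, rfl⟩, rfl⟩ := hIP hx
        exact ⟨j, hx, rfl⟩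
      · rintro ⟨j, hj, rfl⟩
        exact hj
    have hJk : J.card = k := by
      rw [← hIk, hJI, Finset.card_image_of_injective _ hinj]
    have hJ : J.Nonempty := Finset.card_pos.1 (by omega)
    rw [hJI, Finset.coe_image] at hhull
    obtain ⟨B, hBJ, hf, rfl⟩ := (isProjConvexHull_iff hJ X).1 hhull
    refine ⟨J, B, hBJ, hJk, ⟨hf, fun i => ?_⟩, rfl⟩
    rw [← not_or]
    intro h
    have hint := toRP2_mem_interior hω (Finset.notMem_erase i J) h
    have hint' : toRP2 (ω i) ∈ interior (projHull (signedCoord ω B) J) := by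
      refine interior_mono ?_ hint
      rintro x ⟨v, hv, hv0, rfl⟩
      exact ⟨v, conicHull_mono (Finset.erase_subset _ _) hv, hv0, rfl⟩
    exact Set.disjoint_left.1 hdisj hint' ⟨ω i, ⟨i, rfl⟩, rfl⟩
  · rintro ⟨J, B, hBJ, hJk, hhole, rfl⟩
    have hJ : J.Nonempty := Finset.card_pos.1 (by omega)
    refine ⟨⟨J.image fun j => toRP2 (ω j), ?_, ?_, ?_, ?_⟩, ?_⟩
    · rw [Finset.coe_image]
      rintro _ ⟨j, -, rfl⟩
      exact ⟨_, ⟨j, rfl⟩, rfl⟩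
    · rw [Finset.card_image_of_injective _ hinj, hJk]
    · rw [Finset.coe_image]
      exact (isProjConvexHull_iff hJ _).2 ⟨B, hBJ, hhole.1, rfl⟩
    · rw [Finset.coe_image]
      rintro _ ⟨j, hj, rfl⟩
      exact ⟨subset_closure (toRP2_mem_projHull hj),
        toRP2_notMem_interior hhole (by omega) hj⟩
    · rw [Set.disjoint_left]
      rintro _ hint ⟨_, ⟨j, rfl⟩, rfl⟩
      exact toRP2_notMem_interior hhole (by omega)
        ((hhole.mem_iff j).2 (interior_subset hint)) hint

/-- A hull determines relative signs. If `j` and `k` had equal signs for `B` but opposite signs for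
`B'`, then the point of `ker f` on their line would lie in the second hull, whereas the first one
misses `ker f`. -/
theorem IsSignedHole.sign_iff (hω : GeneralPosition ω) {B' : Finset (Fin n)} (h : IsSignedHole ω J B)
    (heq : projHull (signedCoord ω B) J = projHull (signedCoord ω B') J) {j k : Fin n}
    (hj : j ∈ J) (hk : k ∈ J) (hjk : (j ∈ B) ↔ (k ∈ B)) : (j ∈ B') ↔ (k ∈ B') := by
  by_contra hne
  have hjk' : j ≠ k := by rintro rfl; exact hne Iff.rfl
  obtain ⟨⟨f, hf⟩, -⟩ := h
  set g := signedCoord ω B with hg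
  set g' := signedCoord ω B' with hg'
  set z := f (g k) • g j - f (g j) • g k with hz
  have hfz : f z = 0 := by simp [hz]; ring
  have hz0 : z ≠ 0 := by
    intro h0
    rw [hz, sub_eq_zero] at h0
    obtain ⟨s, hs, hs'⟩ := exists_signedCoord_eq ω B j
    obtain ⟨t, ht, ht'⟩ := exists_signedCoord_eq ω B k
    rw [hg, hs', ht', smul_smul, smul_smul] at h0
    rw [← ht'] at h0
    exact homCoord_smul_ne hω hjk' (mul_ne_zero (hf k hk).ne' hs) h0
  have hcomb : ∀ a b : ℝ, 0 ≤ a → 0 ≤ b → a • g' j + b • g' k ∈ conicHull g' J := fun a b ha hb =>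
    add_mem_conicHull (smul_mem_conicHull ha (mem_conicHull_of_mem hj))
      (smul_mem_conicHull hb (mem_conicHull_of_mem hk))
  have hmem : z ∈ conicHull g' J ∨ -z ∈ conicHull g' J := by
    have := hcomb _ _ (hf k hk).le (hf j hj).le
    have hs : (g' j = g j ∧ g' k = -g k) ∨ (g' j = -g j ∧ g' k = g k) := by
      simp only [hg, hg', signedCoord]
      by_cases h1 : j ∈ B <;> by_cases h2 : k ∈ B <;> by_cases h3 : j ∈ B' <;>
        by_cases h4 : k ∈ B' <;> simp_all
    rcases hs with ⟨h1, h2⟩ | ⟨h1, h2⟩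
    · left
      rw [h1, h2] at this
      convert this using 1
      rw [hz, smul_neg, sub_eq_add_neg]
    · right
      rw [h1, h2] at this
      convert this using 1
      rw [hz, smul_neg, neg_sub, sub_eq_neg_add]
  have hX : Projectivization.mk ℝ z hz0 ∈ projHull g J := by
    rw [heq]
    exact (mk_mem_projHull hz0).2 hmem
  rcases (mk_mem_projHull hz0).1 hX with h | h
  · rcases pos_or_eq_zero_of_mem_conicHull hf h with h1 | h1
    · exact h1.ne' hfz
    · exact hz0 h1
  · rcases pos_or_eq_zero_of_mem_conicHull hf h with h1 | h1
    · rw [map_neg, hfz] at h1; simp at h1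
    · exact hz0 (neg_eq_zero.1 h1)

theorem conicHull_neg {ι : Type*} {g g' : ι → Fin 3 → ℝ} {J : Finset ι}
    (h : ∀ j ∈ J, g' j = -g j) (v : Fin 3 → ℝ) : v ∈ conicHull g' J ↔ -v ∈ conicHull g J := by
  refine exists_congr fun c => and_congr_right fun _ => ?_
  rw [neg_eq_iff_eq_neg, ← Finset.sum_neg_distrib]
  rw [Finset.sum_congr rfl fun j hj => by rw [h j hj, smul_neg]]

theorem signedCoord_sdiff {j : Fin n} (hj : j ∈ J) :
    signedCoord ω (J \ B) j = -signedCoord ω B j := by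
  unfold signedCoord
  by_cases h : j ∈ B <;> simp [h, hj]

/-- Complementing the sign set negates every generator, which projective points do not see. -/
theorem projHull_sdiff :
    projHull (signedCoord ω (J \ B)) J = projHull (signedCoord ω B) J := by
  ext x
  induction x using Projectivization.ind with
  | h v hv =>
    rw [mk_mem_projHull, mk_mem_projHull,
      conicHull_neg (g := signedCoord ω B) fun j hj => signedCoord_sdiff hj,
      conicHull_neg (g := signedCoord ω B) fun j hj => signedCoord_sdiff hj, neg_neg, or_comm]

theorem IsSignedHole.sdiff (h : IsSignedHole ω J B) : IsSignedHole ω J (J \ B) := by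
  obtain ⟨⟨f, hf⟩, h2⟩ := h
  refine ⟨⟨-f, fun j hj => ?_⟩, fun i => ?_⟩
  · rw [signedCoord_sdiff hj, LinearMap.neg_apply, map_neg, neg_neg]
    exact hf j hj
  · rw [conicHull_neg (g := signedCoord ω B) fun j hj =>
      signedCoord_sdiff (Finset.mem_of_mem_erase hj),
      conicHull_neg (g := signedCoord ω B) fun j hj =>
      signedCoord_sdiff (Finset.mem_of_mem_erase hj), neg_neg]
    exact (h2 i).symm

/-- A representative of each signed hole, in which the least index has positive sign. -/
def IsNormalized (p : Finset (Fin n) × Finset (Fin n)) : Prop :=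
  p.2 ⊆ p.1 ∧ 3 ≤ p.1.card ∧ ∀ b ∈ p.2, ∃ a ∈ p.1, a < b

/-- The projective polygon described by a set of indices and a set of signs. -/
def pairHull (ω : Fin n → Plane) (p : Finset (Fin n) × Finset (Fin n)) : Set RP2 :=
  projHull (signedCoord ω p.2) p.1

theorem IsNormalized.min_notMem {p : Finset (Fin n) × Finset (Fin n)} (h : IsNormalized p)
    (hne : p.1.Nonempty) : p.1.min' hne ∉ p.2 := by
  intro hm
  obtain ⟨a, ha, hlt⟩ := h.2.2 _ hm
  exact absurd (p.1.min'_le a ha) (not_le.2 hlt)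

theorem isProjHole_iff (hω : GeneralPosition ω) (k : ℕ) (X : Set RP2) :
    IsProjKHole k (toRP2 '' Set.range ω) X ↔
      ∃ p : Finset (Fin n) × Finset (Fin n), IsNormalized p ∧ p.1.card = k ∧
        IsSignedHole ω p.1 p.2 ∧ X = pairHull ω p := by
  rw [isProjKHole_iff hω]
  constructor
  · rintro ⟨hk, J, B, hBJ, hJ, hh, rfl⟩
    by_cases hmin : ∀ b ∈ B, ∃ a ∈ J, a < b
    · exact ⟨(J, B), ⟨hBJ, by rw [hJ]; exact hk, hmin⟩, hJ, hh, rfl⟩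
    · push Not at hmin
      obtain ⟨b, hb, hle⟩ := hmin
      refine ⟨(J, J \ B), ⟨Finset.sdiff_subset, by simp; omega, fun c hc => ⟨b, hBJ hb, ?_⟩⟩, hJ,
        hh.sdiff, projHull_sdiff.symm⟩
      have hc' := Finset.mem_sdiff.1 hc
      exact lt_of_le_of_ne (hle c hc'.1) (by rintro rfl; exact hc'.2 hb)
  · rintro ⟨p, hp, hk, hh, rfl⟩
    exact ⟨hk ▸ hp.2.1, p.1, p.2, hp.1, hk, hh, rfl⟩

/-- The set `J` is read off as the configuration points covered by the hull, and `B` from the signs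
relative to the least index, which is positive by normalization. -/
theorem pairHull_injOn (hω : GeneralPosition ω) :
    Set.InjOn (pairHull ω) {p | IsNormalized p ∧ IsSignedHole ω p.1 p.2} := by
  rintro ⟨J, B⟩ ⟨hp, hh⟩ ⟨J', B'⟩ ⟨hp', hh'⟩ heq
  have hJ : J = J' := by
    ext i
    rw [hh.mem_iff, hh'.mem_iff]
    exact iff_of_eq (congrArg (fun X => toRP2 (ω i) ∈ X) heq)
  subst hJ
  have hne : J.Nonempty := Finset.card_pos.1 (by have := hp.2.1; simp at this; omega)
  have h1 := hp.min_notMem hne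
  have h2 := hp'.min_notMem hne
  simp only at h1 h2
  have hm := J.min'_mem hne
  have key : ∀ k ∈ J, k ∈ B ↔ k ∈ B' := by
    intro k hk
    have e1 := hh.sign_iff hω heq hm hk
    have e2 := hh'.sign_iff hω heq.symm hm hk
    tauto
  ext1
  · rfl
  · ext k
    exact ⟨fun hk => (key k (hp.1 hk)).1 hk, fun hk => (key k (hp'.1 hk)).2 hk⟩

/-! ### Affine holes among the projective ones -/

theorem mem_convexHull_iff_homCoord (A : Finset (Fin n)) (p : Plane) :
    p ∈ convexHull ℝ (ω '' (A : Set (Fin n))) ↔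
      homCoord p ∈ conicHull (fun j => homCoord (ω j)) A := by
  constructor
  · intro hp
    have hsub : convexHull ℝ (ω '' (A : Set (Fin n))) ⊆
        {p | homCoord p ∈ conicHull (fun j => homCoord (ω j)) A} := by
      refine convexHull_min ?_ ?_
      · rintro _ ⟨j, hj, rfl⟩
        exact mem_conicHull_of_mem (g := fun j => homCoord (ω j)) hj
      · intro x hx y hy a b ha hb hab
        have : homCoord (a • x + b • y) = a • homCoord x + b • homCoord y := by
          ext i; fin_cases i <;> simp [homCoord, hab]
        rw [Set.mem_ofPred_eq, this]
        exact add_mem_conicHull (smul_mem_conicHull ha hx) (smul_mem_conicHull hb hy)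
    exact hsub hp
  · intro hp
    have hsub : conicHull (fun j => homCoord (ω j)) A ⊆
        {v | v = 0 ∨ ∃ s : ℝ, 0 < s ∧ ∃ q ∈ convexHull ℝ (ω '' (A : Set (Fin n))),
          v = s • homCoord q} := by
      refine conicHull_induction (Or.inl rfl) ?_ ?_ ?_
      · rintro v (rfl | ⟨s, hs, q, hq, rfl⟩) w (rfl | ⟨t, ht, r, hr, rfl⟩)
        · left; simp
        · right; exact ⟨t, ht, r, hr, by simp⟩
        · right; exact ⟨s, hs, q, hq, by simp⟩
        · right
          refine ⟨s + t, add_pos hs ht, (s / (s + t)) • q + (t / (s + t)) • r,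
            convex_convexHull ℝ _ hq hr (by positivity) (by positivity) (by field_simp), ?_⟩
          have : s + t ≠ 0 := (add_pos hs ht).ne'
          ext i
          fin_cases i <;> simp [homCoord] <;> field_simp
      · rintro t ht v (rfl | ⟨s, hs, q, hq, rfl⟩)
        · left; simp
        · rcases ht.eq_or_lt with rfl | ht
          · left; simp
          · right; exact ⟨t * s, mul_pos ht hs, q, hq, by rw [mul_smul]⟩
      · intro j hj
        exact Or.inr ⟨1, one_pos, ω j, subset_convexHull ℝ _ ⟨j, hj, rfl⟩, by simp⟩
    rcases hsub hp with h | ⟨s, hs, q, hq, h⟩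
    · exact absurd h (homCoord_ne p)
    · have h2 := congrFun h 2
      simp [homCoord] at h2
      subst h2
      have h0 := congrFun h 0
      have h1 := congrFun h 1
      simp [homCoord] at h0 h1
      have : p = q := by
        ext i; fin_cases i
        · exact h0
        · exact h1
      rwa [this]

theorem projHull_homCoord (A : Finset (Fin n)) :
    projHull (fun j => homCoord (ω j)) A = toRP2 '' convexHull ℝ (ω '' (A : Set (Fin n))) := by
  ext x
  constructor
  · rintro ⟨v, hv, hv0, rfl⟩
    have hpos : ∀ j ∈ A, 0 < (LinearMap.proj 2 : (Fin 3 → ℝ) →ₗ[ℝ] ℝ) (homCoord (ω j)) := by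
      intro j _; simp [homCoord]
    have h2 : 0 < v 2 := by
      rcases pos_or_eq_zero_of_mem_conicHull hpos hv with h | h
      · exact h
      · exact absurd h hv0
    have hv' : v = v 2 • homCoord !₂[v 0 / v 2, v 1 / v 2] := by
      ext i; fin_cases i <;> simp [homCoord] <;> field_simp
    refine ⟨!₂[v 0 / v 2, v 1 / v 2], ?_, ?_⟩
    · rw [mem_convexHull_iff_homCoord]
      have := smul_mem_conicHull (inv_nonneg.2 h2.le) hv
      rw [hv'] at this
      simpa [homCoord, smul_smul, h2.ne'] using this
    · rw [toRP2_eq, Projectivization.mk_eq_mk_iff']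
      refine ⟨(v 2)⁻¹, ?_⟩
      nth_rw 2 [hv']
      rw [smul_smul, inv_mul_cancel₀ h2.ne', one_smul]
  · rintro ⟨p, hp, rfl⟩
    exact ⟨homCoord p, (mem_convexHull_iff_homCoord A p).1 hp, homCoord_ne p, rfl⟩

theorem signedCoord_empty (ω : Fin n → Plane) :
    signedCoord ω ∅ = fun j => homCoord (ω j) := by
  ext1 j; simp [signedCoord]

theorem IsSignedHole.isAffineHole (hω : GeneralPosition ω) (hJ : 3 ≤ J.card)
    (h : IsSignedHole ω J ∅) :
    IsAffineHole (Set.range ω) (convexHull ℝ (ω '' (J : Set (Fin n)))) := by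
  classical
  obtain ⟨⟨f, hf⟩, h2⟩ := h
  rw [signedCoord_empty] at hf h2
  refine ⟨J.image ω, ?_, ?_, ?_, ?_, ?_⟩
  · rw [Finset.coe_image]
    rintro _ ⟨j, -, rfl⟩
    exact ⟨j, rfl⟩
  · rwa [Finset.card_image_of_injective _ hω.1]
  · have : ConvexIndependent ℝ ((↑) : ((J.image ω : Finset Plane) : Set Plane) → Plane) := by
      rw [convexIndependent_set_iff_notMem_convexHull_sdiff]
      rw [Finset.coe_image]
      rintro _ ⟨i, hi, rfl⟩ hmem
      rw [← Set.image_singleton, ← Set.image_sdiff hω.1, ← Finset.coe_erase,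
        mem_convexHull_iff_homCoord] at hmem
      exact (h2 i).1 hmem
    exact this
  · rw [Finset.coe_image]
  · rw [Set.disjoint_left]
    rintro _ hint ⟨i, rfl⟩
    have hmem := (mem_convexHull_iff_homCoord J (ω i)).1 (interior_subset hint)
    by_cases hi : i ∈ J
    -- Extend the segment from `ω j` slightly past the vertex `ω i`. After rescaling, the new point
    -- is `homCoord (ω i)` minus a positive multiple of `homCoord (ω j)`.
    · obtain ⟨j, hj, hji⟩ := Finset.exists_mem_ne (show 1 < J.card by omega) i
      have hcont : Continuous fun δ : ℝ => ω i + δ • (ω i - ω j) := by fun_prop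
      have h1 : ∀ᶠ δ : ℝ in nhdsWithin 0 (Set.Ioi 0),
          ω i + δ • (ω i - ω j) ∈ interior (convexHull ℝ (ω '' (J : Set (Fin n)))) :=
        (hcont.tendsto 0).mono_left nhdsWithin_le_nhds |>.eventually_mem
          (isOpen_interior.mem_nhds (by simpa using hint))
      obtain ⟨δ, hδ1, hδ⟩ := (h1.and self_mem_nhdsWithin).exists
      have hδ : 0 < δ := hδ
      have h3 := (mem_convexHull_iff_homCoord J _).1 (interior_subset hδ1)
      have h4 := smul_mem_conicHull (inv_nonneg.2 (by linarith : 0 ≤ 1 + δ)) h3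
      have h5 : (1 + δ)⁻¹ • homCoord (ω i + δ • (ω i - ω j)) =
          homCoord (ω i) - (δ / (1 + δ)) • homCoord (ω j) := by
        have : 1 + δ ≠ 0 := by linarith
        ext l
        fin_cases l <;> simp [homCoord] <;> field_simp <;> ring
      rw [h5] at h4
      exact (h2 i).1 (mem_conicHull_erase_of_sub_mem (g := fun j => homCoord (ω j)) hf hi hj
        hji.symm (by positivity) h4)
    · have h3 := (h2 i).1
      rw [Finset.erase_eq_of_notMem hi] at h3
      exact h3 hmem

/-- The difference of the lifts of a positive and a negative vertex has last coordinate 0, so the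
hull contains a point at infinity. -/
theorem not_subset_range_toRP2 {p : Finset (Fin n) × Finset (Fin n)} (hω : GeneralPosition ω)
    (hp : IsNormalized p) (hB : p.2.Nonempty) : ¬ pairHull ω p ⊆ Set.range toRP2 := by
  intro hsub
  obtain ⟨b, hb⟩ := hB
  have hbJ := hp.1 hb
  have hne : p.1.Nonempty := ⟨b, hbJ⟩
  have ha := p.1.min'_mem hne
  have haB := hp.min_notMem hne
  set a := p.1.min' hne
  have hab : a ≠ b := by rintro h; rw [h] at haB; exact haB hb
  set z := signedCoord ω p.2 a + signedCoord ω p.2 b with hz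
  have hzeq : z = homCoord (ω a) - homCoord (ω b) := by
    simp [hz, signedCoord, haB, hb, sub_eq_add_neg]
  have hz0 : z ≠ 0 := by
    rw [hzeq, sub_ne_zero]
    simpa using homCoord_smul_ne hω hab (s := 1) (t := 1) one_ne_zero
  have hzX : Projectivization.mk ℝ z hz0 ∈ pairHull ω p :=
    ⟨z, add_mem_conicHull (mem_conicHull_of_mem ha) (mem_conicHull_of_mem hbJ), hz0, rfl⟩
  obtain ⟨q, hq⟩ := hsub hzX
  rw [toRP2_eq, Projectivization.mk_eq_mk_iff'] at hq
  obtain ⟨t, ht⟩ := hq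
  have := congrFun ht 2
  simp [hzeq, homCoord] at this
  
theorem affine_iff (hω : GeneralPosition ω) {p : Finset (Fin n) × Finset (Fin n)}
    (hp : IsNormalized p) (hh : IsSignedHole ω p.1 p.2) :
    (∃ H, IsAffineHole (Set.range ω) H ∧ pairHull ω p = toRP2 '' H) ↔ p.2 = ∅ := by
  constructor
  · rintro ⟨H, -, hH⟩
    by_contra hne
    refine not_subset_range_toRP2 hω hp (Finset.nonempty_iff_ne_empty.2 hne) ?_
    rw [hH]
    exact Set.image_subset_range _ _
  · intro h
    rw [h] at hh
    refine ⟨_, hh.isAffineHole hω hp.2.1, ?_⟩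
    unfold pairHull
    rw [h, signedCoord_empty, projHull_homCoord]

/-! ### The two hole counts as cardinalities -/

open Classical in
theorem numProj3Holes_eq (hω : GeneralPosition ω) :
    numProj3Holes (Set.range ω) =
      (Finset.univ.filter fun p : Finset (Fin n) × Finset (Fin n) =>
        IsNormalized p ∧ IsSignedHole ω p.1 p.2 ∧ p.1.card = 3).card := by
  rw [numProj3Holes, ← Set.ncard_coe_finset,
    ← Set.InjOn.ncard_image ((pairHull_injOn hω).mono (fun p hp => ?_))]
  · congr 1
    ext X
    rw [Set.mem_ofPred_eq, isProjHole_iff hω]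
    simp only [Finset.coe_filter, Finset.mem_univ, true_and, Set.mem_image, Set.mem_ofPred_eq]
    constructor
    · rintro ⟨p, h1, h2, h3, rfl⟩; exact ⟨p, ⟨h1, h3, h2⟩, rfl⟩
    · rintro ⟨p, ⟨h1, h3, h2⟩, rfl⟩; exact ⟨p, h1, h2, h3, rfl⟩
  · simp only [Finset.coe_filter, Finset.mem_univ, true_and, Set.mem_ofPred_eq] at hp
    exact ⟨hp.1, hp.2.1⟩

open Classical in
theorem numNonaffineProjHoles_eq (hω : GeneralPosition ω) :
    numNonaffineProjHoles (Set.range ω) =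
      (Finset.univ.filter fun p : Finset (Fin n) × Finset (Fin n) =>
        IsNormalized p ∧ IsSignedHole ω p.1 p.2 ∧ p.2.Nonempty).card := by
  rw [numNonaffineProjHoles, ← Set.ncard_coe_finset,
    ← Set.InjOn.ncard_image ((pairHull_injOn hω).mono (fun p hp => ?_))]
  · congr 1
    ext X
    rw [Set.mem_ofPred_eq]
    unfold IsProjHole
    simp only [isProjHole_iff hω]
    simp only [Finset.coe_filter, Finset.mem_univ, true_and, Set.mem_image, Set.mem_ofPred_eq]
    constructor
    · rintro ⟨⟨k, p, h1, h2, h3, rfl⟩, h4⟩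
      rw [affine_iff hω h1 h3] at h4
      exact ⟨p, ⟨h1, h3, Finset.nonempty_iff_ne_empty.2 h4⟩, rfl⟩
    · rintro ⟨p, ⟨h1, h3, h2⟩, rfl⟩
      refine ⟨⟨_, p, h1, rfl, h3, rfl⟩, ?_⟩
      rw [affine_iff hω h1 h3]
      exact Finset.nonempty_iff_ne_empty.1 h2
  · simp only [Finset.coe_filter, Finset.mem_univ, true_and, Set.mem_ofPred_eq] at hp
    exact ⟨hp.1, hp.2.1⟩

end

/-! ### Quadratic lower bound -/

section
variable {n : ℕ} {ω : Fin n → Plane} {J B : Finset (Fin n)}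

theorem notMem_conicHull_of_card_le_two (hω : GeneralPosition ω) {i : Fin n} (hi : i ∉ J)
    (hJ : J.card ≤ 2) {t : ℝ} (ht : t ≠ 0) :
    t • homCoord (ω i) ∉ conicHull (signedCoord ω B) J := by
  rintro ⟨c, -, hT⟩
  have hiJ : ∀ j ∈ J, i ≠ j := by
    rintro j hj rfl
    exact hi hj
  have : J.card = 0 ∨ J.card = 1 ∨ J.card = 2 := by omega
  rcases this with h0 | h1 | h2
  · rw [Finset.card_eq_zero] at h0
    rw [h0, Finset.sum_empty] at hT
    exact smul_ne_zero ht (homCoord_ne _) hT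
  · obtain ⟨j, hj⟩ := Finset.card_eq_one.1 h1
    rw [hj, Finset.sum_singleton] at hT
    obtain ⟨s, hs, hs'⟩ := exists_signedCoord_eq ω B j
    rw [hs', smul_smul] at hT
    exact homCoord_smul_ne hω (hiJ j (by simp [hj])) ht hT
  · obtain ⟨j, k, hjk, hj⟩ := Finset.card_eq_two.1 h2
    rw [hj, Finset.sum_pair hjk] at hT
    obtain ⟨s, hs, hs'⟩ := exists_signedCoord_eq ω B i
    have hT' : (t * s⁻¹) • signedCoord ω B i + (-c j) • signedCoord ω B j +
        (-c k) • signedCoord ω B k = 0 := by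
      rw [hs', smul_smul, mul_assoc, inv_mul_cancel₀ hs, mul_one, hT]
      simp only [neg_smul]; abel
    have := (hω.signedCoord_eq_zero_of_sum (hiJ j (by simp [hj])) (hiJ k (by simp [hj])) hjk hT').1
    exact mul_ne_zero ht (inv_ne_zero hs) this

/-- The three signed lifts form a basis, and the sum of the dual coordinates is positive on each of
them. For triangles every choice of signs is therefore admissible. -/
theorem exists_functional_triple (hω : GeneralPosition ω) {i j k : Fin n} (hij : i ≠ j)
    (hik : i ≠ k) (hjk : j ≠ k) : ∃ f : (Fin 3 → ℝ) →ₗ[ℝ] ℝ,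
      ∀ l ∈ ({i, j, k} : Finset (Fin n)), 0 < f (signedCoord ω B l) := by
  let Θ : (Fin 3 → ℝ) →ₗ[ℝ] (Fin 3 → ℝ) :=
    (LinearMap.proj 0).smulRight (signedCoord ω B i) +
      (LinearMap.proj 1).smulRight (signedCoord ω B j) +
      (LinearMap.proj 2).smulRight (signedCoord ω B k)
  have hΘ : Function.Injective Θ := by
    rw [← LinearMap.ker_eq_bot, LinearMap.ker_eq_bot']
    intro m hm
    simp only [Θ, LinearMap.add_apply, LinearMap.smulRight_apply, LinearMap.proj_apply] at hm
    obtain ⟨ha, hb, hc⟩ := hω.signedCoord_eq_zero_of_sum hij hik hjk hm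
    ext l
    fin_cases l <;> simp [ha, hb, hc]
  let e := LinearEquiv.ofInjectiveEndo Θ hΘ
  have he : ∀ v, e v = Θ v := fun v => rfl
  have hv : ∀ v w, Θ v = w → e.symm w = v := by
    intro v w h
    rw [LinearEquiv.symm_apply_eq, he, h]
  let σ : (Fin 3 → ℝ) →ₗ[ℝ] ℝ :=
    LinearMap.proj (R := ℝ) (φ := fun _ : Fin 3 => ℝ) 0 + LinearMap.proj (R := ℝ) (φ := fun _ : Fin 3 => ℝ) 1 +
      LinearMap.proj (R := ℝ) (φ := fun _ : Fin 3 => ℝ) 2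
  refine ⟨σ.comp e.symm.toLinearMap, fun l hl => ?_⟩
  simp only [Finset.mem_insert, Finset.mem_singleton] at hl
  rcases hl with rfl | rfl | rfl
  · have := hv ![1, 0, 0] (signedCoord ω B l) (by simp [Θ])
    simp [σ, this]
  · have := hv ![0, 1, 0] (signedCoord ω B l) (by simp [Θ])
    simp [σ, this]
  · have := hv ![0, 0, 1] (signedCoord ω B l) (by simp [Θ])
    simp [σ, this]

theorem mem_conicHull_triple {i j k : Fin n} (hij : i ≠ j) (hik : i ≠ k) (hjk : j ≠ k)
    {g : Fin n → Fin 3 → ℝ} {v : Fin 3 → ℝ} (h : v ∈ conicHull g {i, j, k}) :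
    ∃ a b c : ℝ, 0 ≤ a ∧ 0 ≤ b ∧ 0 ≤ c ∧ v = a • g i + b • g j + c • g k := by
  obtain ⟨d, hd, rfl⟩ := h
  refine ⟨d i, d j, d k, hd i, hd j, hd k, ?_⟩
  rw [Finset.sum_insert (by simp [hij, hik]), Finset.sum_pair hjk, add_assoc]

/-- Every pair of points is an edge of a projective triangle which crosses the line at infinity
and has no other point in its interior. -/
theorem exists_isSignedHole_of_pair (hω : GeneralPosition ω) (hn : 3 ≤ n) {p q : Fin n}
    (hpq : p ≠ q) : ∃ J B : Finset (Fin n), p ∈ J ∧ q ∈ J ∧ B ⊆ J ∧ p ∉ B ∧ q ∈ B ∧ J.card = 3 ∧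
      IsSignedHole ω J B := by
  classical
  -- The candidates are the triangles in which `p` is positive and `q` negative; the third vertex
  -- and its sign are free. Below, `S` collects the other points that a candidate covers, and a
  -- candidate with the fewest such points is empty.
  let C : Finset (Finset (Fin n) × Finset (Fin n)) := Finset.univ.filter fun x =>
    ∃ r, r ≠ p ∧ r ≠ q ∧ x.1 = {p, q, r} ∧ (x.2 = {q} ∨ x.2 = {q, r})
  let S : Finset (Fin n) × Finset (Fin n) → Finset (Fin n) := fun x => Finset.univ.filter fun i =>
    i ∉ x.1 ∧ (homCoord (ω i) ∈ conicHull (signedCoord ω x.2) x.1 ∨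
      -homCoord (ω i) ∈ conicHull (signedCoord ω x.2) x.1)
  have hC : C.Nonempty := by
    obtain ⟨r, hr⟩ : ∃ r, r ∉ ({p, q} : Finset (Fin n)) := by
      by_contra hall
      push Not at hall
      have h1 : (Finset.univ : Finset (Fin n)) ⊆ {p, q} := fun r _ => hall r
      have h2 := Finset.card_le_card h1
      have h3 := Finset.card_le_two (a := p) (b := q)
      rw [Finset.card_univ, Fintype.card_fin] at h2
      omega
    simp only [Finset.mem_insert, Finset.mem_singleton, not_or] at hr
    exact ⟨({p, q, r}, {q}), Finset.mem_filter.2 ⟨Finset.mem_univ _, r, hr.1, hr.2, rfl, Or.inl rfl⟩⟩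
  obtain ⟨⟨J, B⟩, hx, hmin⟩ := Finset.exists_min_image C (fun x => (S x).card) hC
  obtain ⟨-, r, hrp, hrq, hJ, hB⟩ := Finset.mem_filter.1 hx
  simp only at hJ hB
  subst hJ
  have hpB : p ∉ B := by rcases hB with rfl | rfl <;> simp [hpq, hrp.symm]
  have hqB : q ∈ B := by rcases hB with rfl | rfl <;> simp
  have hcard : ({p, q, r} : Finset (Fin n)).card = 3 := Finset.card_eq_three.2
    ⟨p, q, r, hpq, hrp.symm, hrq.symm, rfl⟩
  have hgp : ∀ B : Finset (Fin n), p ∉ B → signedCoord ω B p = homCoord (ω p) := fun B h => by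
    simp [signedCoord, h]
  have hgq : ∀ B : Finset (Fin n), q ∈ B → signedCoord ω B q = -homCoord (ω q) := fun B h => by
    simp [signedCoord, h]
  refine ⟨{p, q, r}, B, by simp, by simp, ?_, hpB, hqB, hcard,
    exists_functional_triple hω hpq hrp.symm hrq.symm, fun i => ?_⟩
  · rcases hB with rfl | rfl <;> intro x <;> simp <;> tauto
  by_cases hi : i ∈ ({p, q, r} : Finset (Fin n))
  · have hle : (({p, q, r} : Finset (Fin n)).erase i).card ≤ 2 := by
      rw [Finset.card_erase_of_mem hi, hcard]
    have h1 := notMem_conicHull_of_card_le_two (B := B) hω (Finset.notMem_erase i _) hle one_ne_zero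
    have h2 := notMem_conicHull_of_card_le_two (B := B) hω (Finset.notMem_erase i _) hle
      (neg_ne_zero.2 (one_ne_zero (α := ℝ)))
    rw [one_smul] at h1
    rw [neg_one_smul] at h2
    exact ⟨h1, h2⟩
  · rw [Finset.erase_eq_of_notMem hi, ← not_or]
    intro hmem
    have hiS : i ∈ S ({p, q, r}, B) := Finset.mem_filter.2 ⟨Finset.mem_univ _, hi, hmem⟩
    simp only [Finset.mem_insert, Finset.mem_singleton, not_or] at hi
    obtain ⟨hip, hiq, hir⟩ : i ≠ p ∧ i ≠ q ∧ i ≠ r := hi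
    -- A covered point `i` replaces `r`, with the sign that puts its lift into the old cone. The new
    -- cone is then contained in the old one.
    obtain ⟨B', hB', hiB'⟩ : ∃ B', (B' = {q} ∨ B' = {q, i}) ∧
        signedCoord ω B' i ∈ conicHull (signedCoord ω B) {p, q, r} := by
      rcases hmem with h | h
      · refine ⟨{q}, Or.inl rfl, ?_⟩
        rwa [signedCoord, if_neg (by simpa using hiq)]
      · refine ⟨{q, i}, Or.inr rfl, ?_⟩
        rwa [signedCoord, if_pos (by simp)]
    have hpB' : p ∉ B' := by rcases hB' with rfl | rfl <;> simp [hpq, hip.symm]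
    have hqB' : q ∈ B' := by rcases hB' with rfl | rfl <;> simp
    have hle := hmin ({p, q, i}, B') (Finset.mem_filter.2 ⟨Finset.mem_univ _, i, hip, hiq, rfl, hB'⟩)
    refine absurd hle (not_le.2 (Finset.card_lt_card ?_))
    have hconesub : conicHull (signedCoord ω B') {p, q, i} ⊆
        conicHull (signedCoord ω B) {p, q, r} := by
      refine conicHull_induction zero_mem_conicHull (fun _ hv _ hw => add_mem_conicHull hv hw)
        (fun _ ht _ hv => smul_mem_conicHull ht hv) ?_
      intro j hj
      simp only [Finset.mem_insert, Finset.mem_singleton] at hj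
      rcases hj with rfl | rfl | rfl
      · rw [hgp B' hpB', ← hgp B hpB]
        exact mem_conicHull_of_mem (by simp)
      · rw [hgq B' hqB', ← hgq B hqB]
        exact mem_conicHull_of_mem (by simp)
      · exact hiB'
    refine ⟨?_, fun hsub => ?_⟩
    · intro l hl
      obtain ⟨-, hl1, hl2⟩ := Finset.mem_filter.1 hl
      refine Finset.mem_filter.2 ⟨Finset.mem_univ _, ?_, hl2.imp (fun h => hconesub h)
        (fun h => hconesub h)⟩
      simp only [Finset.mem_insert, Finset.mem_singleton, not_or] at hl1 ⊢
      refine ⟨hl1.1, hl1.2.1, ?_⟩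
      -- The old third vertex is not covered by the new triangle: comparing coefficients in the
      -- basis, the lift of `i` would be proportional to that of the old vertex.
      rintro rfl
      obtain ⟨a, b, c, ha, hb, hc, hi'⟩ := mem_conicHull_triple hpq hrp.symm hrq.symm hiB'
      obtain ⟨s, hs, hs'⟩ : ∃ s : ℝ, s ≠ 0 ∧ s • signedCoord ω B l ∈
          conicHull (signedCoord ω B') {p, q, i} := by
        simp only at hl2
        rcases signedCoord_eq_or ω B l with h | h <;> rcases hl2 with h2 | h2
        · exact ⟨1, one_ne_zero, by rwa [one_smul, h]⟩
        · exact ⟨-1, by norm_num, by rwa [neg_one_smul, h]⟩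
        · exact ⟨-1, by norm_num, by rwa [neg_one_smul, h, neg_neg]⟩
        · exact ⟨1, by norm_num, by rwa [one_smul, h]⟩
      obtain ⟨a', b', c', ha', hb', hc', hl'⟩ := mem_conicHull_triple hpq hip.symm hiq.symm hs'
      rw [hgp B' hpB', ← hgp B hpB, hgq B' hqB', ← hgq B hqB, hi'] at hl'
      have h0 : (a' + c' * a) • signedCoord ω B p + (b' + c' * b) • signedCoord ω B q +
          (c' * c - s) • signedCoord ω B l = 0 := by
        rw [sub_smul, hl']
        simp only [add_smul, smul_add, mul_smul]
        abel
      obtain ⟨e1, e2, e3⟩ := hω.signedCoord_eq_zero_of_sum hpq hrp.symm hrq.symm h0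
      have hc'0 : c' ≠ 0 := by
        rintro rfl
        apply hs
        linarith
      have hca : c' * a = 0 := by
        have := mul_nonneg hc' ha
        linarith
      have hcb : c' * b = 0 := by
        have := mul_nonneg hc' hb
        linarith
      rw [(mul_eq_zero.1 hca).resolve_left hc'0, (mul_eq_zero.1 hcb).resolve_left hc'0] at hi'
      simp only [zero_smul, zero_add] at hi'
      obtain ⟨s1, hs1, hs1'⟩ := exists_signedCoord_eq ω B' i
      obtain ⟨s2, hs2, hs2'⟩ := exists_signedCoord_eq ω B l
      rw [hs1', hs2', smul_smul] at hi'
      exact homCoord_smul_ne hω hir hs1 hi'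
    · have := (Finset.mem_filter.1 (hsub hiS)).2.1
      simp at this

open Classical in
-- Send each ordered pair of distinct points to an empty triangle having both as vertices. The fibre
-- over a triangle `J` lies in `J ×ˢ J`, which has 9 elements.
theorem card_le_signedHoles (hω : GeneralPosition ω) (hn : 3 ≤ n) :
    n * n - n ≤ 9 * (Finset.univ.filter fun p : Finset (Fin n) × Finset (Fin n) =>
        IsNormalized p ∧ IsSignedHole ω p.1 p.2 ∧ p.1.card = 3 ∧ p.2.Nonempty).card := by
  have hex : ∀ x : Fin n × Fin n, ∃ y : Finset (Fin n) × Finset (Fin n), x.1 ≠ x.2 →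
      (x.1 ∈ y.1 ∧ x.2 ∈ y.1) ∧
      IsNormalized y ∧ IsSignedHole ω y.1 y.2 ∧ y.1.card = 3 ∧ y.2.Nonempty := by
    rintro ⟨p, q⟩
    by_cases hpq : p = q
    · exact ⟨(∅, ∅), fun h => absurd hpq h⟩
    obtain ⟨J, B, hp, hq, hBJ, hpB, hqB, hJ, hh⟩ := exists_isSignedHole_of_pair hω hn hpq
    by_cases hmin : ∀ b ∈ B, ∃ a ∈ J, a < b
    · exact ⟨(J, B), fun _ => ⟨⟨hp, hq⟩, ⟨hBJ, hJ.ge, hmin⟩, hh, hJ, ⟨q, hqB⟩⟩⟩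
    -- Normalization replaces `B` by `J \ B`, which is nonempty because it contains `p`.
    · push Not at hmin
      obtain ⟨b, hb, hle⟩ := hmin
      refine ⟨(J, J \ B), fun _ => ⟨⟨hp, hq⟩, ⟨Finset.sdiff_subset, hJ.ge, fun c hc => ⟨b, hBJ hb, ?_⟩⟩,
        hh.sdiff, hJ, ⟨p, Finset.mem_sdiff.2 ⟨hp, hpB⟩⟩⟩⟩
      have hc' := Finset.mem_sdiff.1 hc
      exact lt_of_le_of_ne (hle c hc'.1) (by rintro rfl; exact hc'.2 hb)
  choose F hF using hex
  have hcard : (Finset.univ : Finset (Fin n)).offDiag.card = n * n - n := by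
    rw [Finset.offDiag_card, Finset.card_univ, Fintype.card_fin]
  rw [← hcard]
  refine Finset.card_le_mul_card_image_of_maps_to (f := F) ?_ 9 ?_
  · rintro x hx
    exact Finset.mem_filter.2 ⟨Finset.mem_univ _, (hF x (Finset.mem_offDiag.1 hx).2.2).2⟩
  · intro y hy
    obtain ⟨-, -, -, h3, -⟩ := Finset.mem_filter.1 hy
    have hsub : (Finset.univ.offDiag.filter fun x => F x = y) ⊆ y.1 ×ˢ y.1 := by
      intro x hx
      obtain ⟨hx1, rfl⟩ := Finset.mem_filter.1 hx
      exact Finset.mem_product.2 (hF x (Finset.mem_offDiag.1 hx1).2.2).1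
    calc _ ≤ (y.1 ×ˢ y.1).card := Finset.card_le_card hsub
      _ = 9 := by rw [Finset.card_product, h3]

theorem le_numProj3Holes (hω : GeneralPosition ω) (hn : 3 ≤ n) :
    n * n - n ≤ 9 * numProj3Holes (Set.range ω) := by
  classical
  rw [numProj3Holes_eq hω]
  refine (card_le_signedHoles hω hn).trans (Nat.mul_le_mul_left 9 (Finset.card_le_card ?_))
  intro p hp
  simp only [Finset.mem_filter, Finset.mem_univ, true_and] at hp ⊢
  tauto

theorem le_numNonaffineProjHoles (hω : GeneralPosition ω) (hn : 3 ≤ n) :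
    n * n - n ≤ 9 * numNonaffineProjHoles (Set.range ω) := by
  classical
  rw [numNonaffineProjHoles_eq hω]
  refine (card_le_signedHoles hω hn).trans (Nat.mul_le_mul_left 9 (Finset.card_le_card ?_))
  intro p hp
  simp only [Finset.mem_filter, Finset.mem_univ, true_and] at hp ⊢
  tauto

end

/-! ### Oblique coordinates and areas of triangles -/

open MeasureTheory ENNReal in
-- Change of variables to the affine frame with origin `p` and axes `u`, `v`. Adapted frames turn
-- the plane integrals below into integrals over products.
theorem lintegral_frame (p u v : Plane) (h : u 0 * v 1 - u 1 * v 0 ≠ 0) (F : Plane → ENNReal) :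
    ∫⁻ z, F z = ENNReal.ofReal |u 0 * v 1 - u 1 * v 0| *
      ∫⁻ x : ℝ × ℝ, F (p + x.1 • u + x.2 • v) := by
  let M : Matrix (Fin 2) (Fin 2) ℝ := !![u 0, v 0; u 1, v 1]
  have hM : M.det = u 0 * v 1 - u 1 * v 0 := by
    rw [Matrix.det_fin_two_of]; ring
  have hdet : M.det ≠ 0 := by rwa [hM]
  have h1 : ∫⁻ z, F z = ∫⁻ x : Fin 2 → ℝ, F (p + WithLp.toLp 2 x) := by
    rw [← lintegral_add_left_eq_self _ p]
    exact ((PiLp.volume_preserving_toLp (Fin 2)).lintegral_comp_emb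
      (MeasurableEquiv.toLp 2 (Fin 2 → ℝ)).measurableEmbedding (fun x => F (p + x))).symm
  have hemb : MeasurableEmbedding (Matrix.toLin' M) := by
    have hinj : LinearMap.ker (Matrix.toLin' M) = ⊥ := by
      rw [LinearMap.ker_eq_bot]
      exact Matrix.mulVec_injective_of_det_ne_zero hdet
    exact (LinearMap.isClosedEmbedding_of_injective hinj).measurableEmbedding
  have h2 : ∫⁻ x : Fin 2 → ℝ, F (p + WithLp.toLp 2 x) = ENNReal.ofReal |M.det| *
      ∫⁻ x : Fin 2 → ℝ, F (p + WithLp.toLp 2 (Matrix.toLin' M x)) := by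
    have h3 := Real.map_matrix_volume_pi_eq_smul_volume_pi hdet
    have h4 : ∫⁻ x : Fin 2 → ℝ, F (p + WithLp.toLp 2 (Matrix.toLin' M x)) =
        ENNReal.ofReal |M.det⁻¹| * ∫⁻ x : Fin 2 → ℝ, F (p + WithLp.toLp 2 x) := by
      rw [← hemb.lintegral_map (fun x => F (p + WithLp.toLp 2 x)), h3, lintegral_smul_measure,
        smul_eq_mul]
    rw [h4, ← mul_assoc, ← ENNReal.ofReal_mul (abs_nonneg _), ← abs_mul, mul_inv_cancel₀ hdet]
    simp
  rw [h1, h2, hM]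
  congr 1
  rw [← (volume_preserving_finTwoArrow ℝ).lintegral_comp_emb
    (MeasurableEquiv.finTwoArrow).measurableEmbedding]
  refine lintegral_congr fun x => ?_
  congr 1
  ext i
  fin_cases i <;> simp [M, Matrix.toLin'_apply, dotProduct, Fin.sum_univ_two,
    MeasurableEquiv.finTwoArrow] <;> ring

/-- The open triangle with vertices `p`, `q`, `r` if these are in counterclockwise order, and the
empty set otherwise. -/
def openTriangle (p q r : Plane) : Set Plane :=
  {x | 0 < orient p q x ∧ 0 < orient q r x ∧ 0 < orient r p x}

theorem isOpen_openTriangle (p q r : Plane) : IsOpen (openTriangle p q r) := by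
  unfold openTriangle orient
  refine (isOpen_lt ?_ ?_).and ((isOpen_lt ?_ ?_).and (isOpen_lt ?_ ?_)) <;> fun_prop

theorem volume_unit_triangle : MeasureTheory.volume
    {x : ℝ × ℝ | 0 < x.1 ∧ 0 < x.2 ∧ x.1 + x.2 < 1} = ENNReal.ofReal (1 / 2) := by
  have : {x : ℝ × ℝ | 0 < x.1 ∧ 0 < x.2 ∧ x.1 + x.2 < 1} =
      regionBetween (fun _ => 0) (fun s => 1 - s) (Set.Ioo 0 1) := by
    ext x
    simp only [regionBetween, Set.mem_ofPred_eq, Set.mem_Ioo]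
    constructor
    · rintro ⟨h1, h2, h3⟩; exact ⟨⟨h1, by linarith⟩, h2, by linarith⟩
    · rintro ⟨⟨h1, h2⟩, h3, h4⟩; exact ⟨h1, h3, by linarith⟩
  rw [this, MeasureTheory.Measure.volume_eq_prod, volume_regionBetween_eq_integral]
  · congr 1
    rw [← MeasureTheory.integral_Ioc_eq_integral_Ioo, ← intervalIntegral.integral_of_le zero_le_one]
    have h : ∀ y : ℝ, ((fun s : ℝ => 1 - s) - fun _ : ℝ => (0 : ℝ)) y = 1 - y := fun y => by simp
    simp only [h]
    rw [intervalIntegral.integral_sub (by simp) (by simp)]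
    simp
    norm_num
  · exact (MeasureTheory.integrableOn_const (by simp))
  · exact (Continuous.integrableOn_Icc (by fun_prop)).mono_set Set.Ioo_subset_Icc_self
  · exact measurableSet_Ioo
  · intro x hx
    linarith [hx.2]

theorem orient_frame (p q r : Plane) (s t : ℝ) :
    orient p q (p + s • (q - p) + t • (r - p)) = t * orient p q r ∧
    orient q r (p + s • (q - p) + t • (r - p)) = (1 - s - t) * orient p q r ∧
    orient r p (p + s • (q - p) + t • (r - p)) = s * orient p q r := by
  refine ⟨?_, ?_, ?_⟩ <;> simp [orient] <;> ring

theorem lintegral_frame_orient (p q r : Plane) (h : 0 < orient p q r) (F : Plane → ENNReal) :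
    ∫⁻ z, F z = ENNReal.ofReal (orient p q r) *
      ∫⁻ x : ℝ × ℝ, F (p + x.1 • (q - p) + x.2 • (r - p)) := by
  have e : (q - p) 0 * (r - p) 1 - (q - p) 1 * (r - p) 0 = orient p q r := by simp [orient]
  rw [lintegral_frame p (q - p) (r - p) (by rw [e]; exact h.ne'), e, abs_of_pos h]

theorem volume_openTriangle {p q r : Plane} (h : 0 < orient p q r) :
    MeasureTheory.volume (openTriangle p q r) = ENNReal.ofReal (orient p q r / 2) := by
  rw [← MeasureTheory.lintegral_indicator_one (isOpen_openTriangle p q r).measurableSet,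
    lintegral_frame_orient p q r h]
  have : ∀ x : ℝ × ℝ, (openTriangle p q r).indicator (1 : Plane → ENNReal)
      (p + x.1 • (q - p) + x.2 • (r - p)) =
      {x : ℝ × ℝ | 0 < x.1 ∧ 0 < x.2 ∧ x.1 + x.2 < 1}.indicator 1 x := by
    intro x
    obtain ⟨h1, h2, h3⟩ := orient_frame p q r x.1 x.2
    have : p + x.1 • (q - p) + x.2 • (r - p) ∈ openTriangle p q r ↔
        x ∈ {x : ℝ × ℝ | 0 < x.1 ∧ 0 < x.2 ∧ x.1 + x.2 < 1} := by
      simp only [openTriangle, Set.mem_ofPred_eq, h1, h2, h3, mul_pos_iff_of_pos_right h]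
      constructor
      · rintro ⟨a, b, c⟩; exact ⟨c, a, by linarith⟩
      · rintro ⟨a, b, c⟩; exact ⟨b, by linarith, a⟩
    by_cases hx : x ∈ {x : ℝ × ℝ | 0 < x.1 ∧ 0 < x.2 ∧ x.1 + x.2 < 1}
    · rw [Set.indicator_of_mem hx, Set.indicator_of_mem (this.2 hx)]; rfl
    · rw [Set.indicator_of_notMem hx, Set.indicator_of_notMem (fun h => hx (this.1 h))]
  simp_rw [this]
  rw [MeasureTheory.lintegral_indicator_one, volume_unit_triangle, ← ENNReal.ofReal_mul h.le]
  · congr 1; ring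
  · refine IsOpen.measurableSet
      ((isOpen_lt ?_ ?_).and ((isOpen_lt ?_ ?_).and (isOpen_lt ?_ ?_))) <;> fun_prop

theorem openTriangle_subset {K : Set Plane} (hK : Convex ℝ K) {p q r : Plane} (hp : p ∈ K)
    (hq : q ∈ K) (hr : r ∈ K) : openTriangle p q r ⊆ K := by
  rintro x ⟨h1, h2, h3⟩
  have hD : orient p q r = orient p q x + orient q r x + orient r p x := by
    simp [orient]; ring
  have hpos : 0 < orient p q r := by rw [hD]; positivity
  have e : x = (orient q r x / orient p q r) • p + (orient r p x / orient p q r) • q +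
      (orient p q x / orient p q r) • r := by
    ext i
    simp only [PiLp.add_apply, PiLp.smul_apply, smul_eq_mul]
    field_simp
    fin_cases i <;> simp [orient] <;> ring
  rw [e]
  have := hK.sum_mem (t := Finset.univ) (w := ![orient q r x / orient p q r,
    orient r p x / orient p q r, orient p q x / orient p q r]) (z := ![p, q, r]) ?_ ?_ ?_
  · simpa [Fin.sum_univ_three] using this
  · intro i _; fin_cases i <;> simp <;> positivity
  · simp [Fin.sum_univ_three]
    rw [← add_div, ← add_div, div_eq_one_iff_eq hpos.ne', hD]; ring
  · intro i _; fin_cases i <;> simpa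

/-! ### Integrating out the remaining independent points -/

open MeasureTheory in
-- Given the points selected by `e`, the other `n - card ι` points are independent and identically
-- distributed, so the integral of the product of their weights is a power.
theorem lintegral_comp_embedding {Ω : Type*} [MeasurableSpace Ω] (μ : Measure Ω)
    [IsProbabilityMeasure μ] {ι : Type*} [Fintype ι] {n : ℕ} (e : ι ↪ Fin n)
    {F : (ι → Ω) → ENNReal} (hF : Measurable F) {h : (ι → Ω) → Ω → ENNReal}
    (hh : Measurable (Function.uncurry h)) [DecidablePred fun j => j ∈ Set.range e] :
    ∫⁻ ω : Fin n → Ω, F (ω ∘ e) * ∏ j ∈ Finset.univ.filter (fun j => j ∉ Set.range e), h (ω ∘ e) (ω j)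
      ∂(Measure.pi fun _ => μ) =
    ∫⁻ x : ι → Ω, F x * (∫⁻ y, h x y ∂μ) ^ (n - Fintype.card ι) ∂(Measure.pi fun _ => μ) := by
  classical
  obtain ⟨P, hP⟩ : ∃ P : Fin n → Prop, ∀ j, j ∈ Set.range e ↔ P j := ⟨_, fun _ => Iff.rfl⟩
  let σ : ι ≃ {j // P j} := (Equiv.ofInjective e e.injective).trans (Equiv.subtypeEquivRight hP)
  have h1 := measurePreserving_piEquivPiSubtypeProd (fun _ : Fin n => μ) P
  let Φ : (({j // P j} → Ω) × ({j // ¬ P j} → Ω)) → ENNReal := fun z =>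
    F (fun i => z.1 (σ i)) * ∏ j : {j // ¬ P j}, h (fun i => z.1 (σ i)) (z.2 j)
  have hm1 : Measurable fun z : ({j // P j} → Ω) => fun i => z (σ i) := by fun_prop
  have hΦ : Measurable Φ := by
    refine (hF.comp (hm1.comp measurable_fst)).mul (Finset.measurable_fun_prod _ fun j _ => ?_)
    exact hh.comp ((hm1.comp measurable_fst).prodMk (by fun_prop))
  have e1 : ∫⁻ ω : Fin n → Ω, F (ω ∘ e) * ∏ j ∈ Finset.univ.filter (fun j => j ∉ Set.range e),
      h (ω ∘ e) (ω j) ∂(Measure.pi fun _ => μ) = ∫⁻ z, Φ z ∂((Measure.pi fun _ => μ).prod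
        (Measure.pi fun _ => μ)) := by
    refine Eq.trans ?_ (h1.lintegral_comp_emb (MeasurableEquiv.measurableEmbedding _) Φ)
    refine lintegral_congr fun ω => ?_
    have e2 : ω ∘ e = fun i => ((MeasurableEquiv.piEquivPiSubtypeProd (fun _ => Ω) P) ω).1 (σ i) := by
      ext1 i; rfl
    simp only [Φ]
    rw [← e2]
    congr 1
    exact Finset.prod_subtype _ (fun j => by simp only [Finset.mem_filter, Finset.mem_univ, true_and, hP]) _
  have hprod : ∀ x : ι → Ω, ∫⁻ y : {j // ¬ P j} → Ω, ∏ j, h x (y j) ∂(Measure.pi fun _ => μ) =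
      (∫⁻ y, h x y ∂μ) ^ (n - Fintype.card ι) := by
    intro x
    have hx : Measurable (h x) := hh.comp (measurable_const.prodMk measurable_id)
    rw [ProbabilityTheory.lintegral_prod_eq_prod_lintegral_of_indepFun Finset.univ
      (fun j (y : {j // ¬ P j} → Ω) => h x (y j))]
    · have : ∀ j : {j // ¬ P j}, ∫⁻ y : {j // ¬ P j} → Ω, h x (y j) ∂(Measure.pi fun _ => μ) =
          ∫⁻ y, h x y ∂μ := fun j =>
        (measurePreserving_eval (fun _ : {j // ¬ P j} => μ) j).lintegral_comp hx
      simp only [this]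
      rw [Finset.prod_const, Finset.card_univ, Fintype.card_subtype_compl, Fintype.card_fin,
        ← Fintype.card_congr σ]
    · exact ProbabilityTheory.iIndepFun_pi (fun j => hx.aemeasurable)
    · intro j; fun_prop
  rw [e1, lintegral_prod _ hΦ.aemeasurable]
  have e3 : ∀ x : {j // P j} → Ω, ∫⁻ y, Φ (x, y) ∂(Measure.pi fun _ => μ) =
      F (fun i => x (σ i)) * (∫⁻ y, h (fun i => x (σ i)) y ∂μ) ^ (n - Fintype.card ι) := by
    intro x
    simp only [Φ]
    rw [lintegral_const_mul, hprod]
    refine Finset.measurable_fun_prod _ fun j _ => hh.comp (measurable_const.prodMk (by fun_prop))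
  simp_rw [e3]
  have h2 := measurePreserving_piCongrLeft (fun _ : ι => μ) σ.symm
  rw [← h2.lintegral_comp_emb (MeasurableEquiv.measurableEmbedding _)]
  refine lintegral_congr fun x => ?_
  have : (MeasurableEquiv.piCongrLeft (fun _ : ι => Ω) σ.symm) x = fun i => x (σ i) := by
    ext1 i
    have := Equiv.piCongrLeft_apply_apply (fun _ : ι => Ω) σ.symm x (σ i)
    rw [Equiv.symm_apply_apply] at this
    exact this
  rw [this]

/-! ### Almost sure general position and measurability -/

section
open MeasureTheory

theorem volume_line_eq_zero {p q : Plane} (h : p ≠ q) :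
    volume {x : Plane | orient p q x = 0} = 0 := by
  let u : Plane := q - p
  let v : Plane := !₂[-(u 1), u 0]
  have hdet : u 0 * v 1 - u 1 * v 0 ≠ 0 := by
    have e : u 0 * v 1 - u 1 * v 0 = u 0 ^ 2 + u 1 ^ 2 := by simp [v]; ring
    rw [e]
    intro h0
    have h1 : u 0 = 0 := by nlinarith [sq_nonneg (u 0), sq_nonneg (u 1)]
    have h2 : u 1 = 0 := by nlinarith [sq_nonneg (u 0), sq_nonneg (u 1)]
    apply h
    ext i
    fin_cases i
    · simp [u] at h1; simp; linarith
    · simp [u] at h2; simp; linarith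
  have hmeas : MeasurableSet {x : Plane | orient p q x = 0} := by
    refine (isClosed_eq ?_ ?_).measurableSet <;> (try unfold orient) <;> fun_prop
  rw [← lintegral_indicator_one hmeas, lintegral_frame p u v hdet]
  have : ∀ x : ℝ × ℝ, {x : Plane | orient p q x = 0}.indicator (1 : Plane → ENNReal)
      (p + x.1 • u + x.2 • v) = (Set.univ ×ˢ {0} : Set (ℝ × ℝ)).indicator 1 x := by
    intro x
    have e : orient p q (p + x.1 • u + x.2 • v) = x.2 * (u 0 * v 1 - u 1 * v 0) := by
      simp [orient, u]; ring
    have : p + x.1 • u + x.2 • v ∈ {x : Plane | orient p q x = 0} ↔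
        x ∈ (Set.univ ×ˢ {0} : Set (ℝ × ℝ)) := by
      simp only [Set.mem_ofPred_eq, e, Set.mem_prod, Set.mem_univ, true_and, Set.mem_singleton_iff]
      simp only [mul_eq_zero, hdet, or_false]
    by_cases hx : x ∈ (Set.univ ×ˢ {0} : Set (ℝ × ℝ))
    · rw [Set.indicator_of_mem hx, Set.indicator_of_mem (this.2 hx)]; rfl
    · rw [Set.indicator_of_notMem hx, Set.indicator_of_notMem (fun h => hx (this.1 h))]
  simp_rw [this]
  rw [lintegral_indicator_one (MeasurableSet.univ.prod (measurableSet_singleton 0)),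
    Measure.volume_eq_prod, Measure.prod_prod]
  simp

variable {μ : Measure Plane} [SigmaFinite μ]

/-- Fubini: the other points are fixed and the `k`-th one varies. -/
theorem ae_notMem_of_section_null {m : ℕ} (k : Fin (m + 1)) {S : Set (Plane × (Fin m → Plane))}
    (hS : MeasurableSet S) (h0 : ∀ y, μ {x | (x, y) ∈ S} = 0) :
    ∀ᵐ ω ∂(Measure.pi fun _ : Fin (m + 1) => μ), (ω k, fun i => ω (k.succAbove i)) ∉ S := by
  have h := measurePreserving_piFinSuccAbove (fun _ : Fin (m + 1) => μ) k
  have h1 : ∀ᵐ z ∂(μ.prod (Measure.pi fun _ : Fin m => μ)), z ∉ S := by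
    rw [ae_iff]
    simp only [not_not]
    change (μ.prod (Measure.pi fun _ : Fin m => μ)) S = 0
    rw [Measure.prod_apply_symm hS]
    have : ∀ y, μ ((fun x => (x, y)) ⁻¹' S) = 0 := h0
    simp [this]
  exact h.quasiMeasurePreserving.ae h1

theorem continuous_orient {X : Type*} [TopologicalSpace X] {a b c : X → Plane} (ha : Continuous a)
    (hb : Continuous b) (hc : Continuous c) : Continuous fun x => orient (a x) (b x) (c x) := by
  unfold orient
  fun_prop

theorem ae_generalPosition (hμ : μ ≪ volume) (n : ℕ) :
    ∀ᵐ ω ∂(Measure.pi fun _ : Fin n => μ), GeneralPosition ω := by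
  have h1 : ∀ i k : Fin n, i ≠ k → ∀ᵐ ω ∂(Measure.pi fun _ : Fin n => μ), ω i ≠ ω k := by
    intro i k hik
    obtain ⟨m, rfl⟩ : ∃ m, n = m + 1 := ⟨n - 1, by have := k.pos; omega⟩
    obtain ⟨i', rfl⟩ := Fin.exists_succAbove_eq hik
    filter_upwards [ae_notMem_of_section_null (μ := μ) k (S := {z | z.2 i' = z.1})
      (isClosed_eq (by fun_prop) (by fun_prop)).measurableSet
      (fun y => hμ (by simp [eq_comm]))] with ω hω
    exact hω
  -- The case `ω i = ω j` must be set aside here, because the section in the third point is then the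
  -- whole plane; it is excluded by `h1`.
  have h2 : ∀ i j k : Fin n, i ≠ j → i ≠ k → j ≠ k →
      ∀ᵐ ω ∂(Measure.pi fun _ : Fin n => μ), ω i = ω j ∨ orient (ω i) (ω j) (ω k) ≠ 0 := by
    intro i j k hij hik hjk
    obtain ⟨m, rfl⟩ : ∃ m, n = m + 1 := ⟨n - 1, by have := k.pos; omega⟩
    obtain ⟨i', rfl⟩ := Fin.exists_succAbove_eq hik
    obtain ⟨j', rfl⟩ := Fin.exists_succAbove_eq hjk
    filter_upwards [ae_notMem_of_section_null (μ := μ) k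
      (S := {z | orient (z.2 i') (z.2 j') z.1 = 0} ∩ {z | z.2 i' = z.2 j'}ᶜ)
      ((isClosed_eq (continuous_orient (by fun_prop) (by fun_prop) (by fun_prop))
        continuous_const).measurableSet.inter
        (isClosed_eq (by fun_prop) (by fun_prop)).measurableSet.compl) (fun y => by
        by_cases h : y i' = y j'
        · simp [h]
        · exact measure_mono_null (fun x hx => hx.1) (hμ (volume_line_eq_zero h)))] with ω hω
    by_contra hcon
    push Not at hcon
    exact hω ⟨hcon.2, hcon.1⟩
  have h1' := ae_all_iff.2 fun i => ae_all_iff.2 fun k => ae_all_iff.2 (h1 i k)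
  have h2' := ae_all_iff.2 fun i => ae_all_iff.2 fun j => ae_all_iff.2 fun k => ae_all_iff.2
    fun a => ae_all_iff.2 fun b => ae_all_iff.2 (h2 i j k a b)
  filter_upwards [h1', h2'] with ω hω1 hω2
  refine ⟨fun i j hij => ?_, fun i j k hij hik hjk => ?_⟩
  · by_contra h
    exact hω1 i j h hij
  · exact (hω2 i j k hij hik hjk).resolve_left (hω1 i j hij)

theorem continuous_homCoord : Continuous homCoord := by
  refine continuous_pi fun i => ?_
  fin_cases i <;> simp [homCoord] <;> fun_prop

theorem continuous_signedCoord {n : ℕ} (B : Finset (Fin n)) (j : Fin n) :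
    Continuous fun ω : Fin n → Plane => signedCoord ω B j := by
  unfold signedCoord
  split_ifs
  · exact (continuous_homCoord.comp (continuous_apply j)).neg
  · exact continuous_homCoord.comp (continuous_apply j)

/-- The coefficients are quantified existentially, so the set is the projection of a closed subset
of a finite-dimensional space. A closed set is σ-compact there, hence so is its image. -/
theorem measurableSet_mem_conicHull {n : ℕ} (J B : Finset (Fin n)) {v : (Fin n → Plane) → Fin 3 → ℝ}
    (hv : Continuous v) :
    MeasurableSet {ω : Fin n → Plane | v ω ∈ conicHull (signedCoord ω B) J} := by
  let T : Set ((Fin n → Plane) × (Fin n → ℝ)) :=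
    {z | ∀ j, 0 ≤ z.2 j} ∩ {z | v z.1 = ∑ j ∈ J, z.2 j • signedCoord z.1 B j}
  have hT : IsClosed T := by
    refine IsClosed.inter ?_ ?_
    · rw [Set.ofPred_forall]
      exact isClosed_iInter fun j => isClosed_le continuous_const (by fun_prop)
    · refine isClosed_eq (hv.comp continuous_fst) (continuous_finsetSum _ fun j _ => ?_)
      exact (by fun_prop : Continuous fun z : (Fin n → Plane) × (Fin n → ℝ) => z.2 j).smul
        ((continuous_signedCoord B j).comp continuous_fst)
  have himg : {ω : Fin n → Plane | v ω ∈ conicHull (signedCoord ω B) J} = Prod.fst '' T := by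
    ext ω
    constructor
    · rintro ⟨c, hc, h⟩; exact ⟨(ω, c), ⟨hc, h⟩, rfl⟩
    · rintro ⟨⟨_, c⟩, ⟨hc, h⟩, rfl⟩; exact ⟨c, hc, h⟩
  rw [himg]
  obtain ⟨C, hC, hCT⟩ := (isSigmaCompact_univ.of_isClosed_subset hT (Set.subset_univ T)).image
    continuous_fst
  rw [← hCT]
  exact MeasurableSet.iUnion fun i => (hC i).isClosed.measurableSet

theorem measurableSet_isSignedHole {n : ℕ} (J B : Finset (Fin n)) :
    MeasurableSet {ω : Fin n → Plane | IsSignedHole ω J B} := by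
  refine MeasurableSet.inter (s₁ := {ω | ∃ f : (Fin 3 → ℝ) →ₗ[ℝ] ℝ, ∀ j ∈ J, 0 < f (signedCoord ω B j)})
    (s₂ := {ω | ∀ i, homCoord (ω i) ∉ conicHull (signedCoord ω B) (J.erase i) ∧
      -homCoord (ω i) ∉ conicHull (signedCoord ω B) (J.erase i)}) ?_ ?_
  · apply IsOpen.measurableSet
    rw [Set.ofPred_exists]
    refine isOpen_iUnion fun f => ?_
    have : {ω : Fin n → Plane | ∀ j ∈ J, 0 < f (signedCoord ω B j)} =
        ⋂ j ∈ J, {ω | 0 < f (signedCoord ω B j)} := by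
      ext ω; simp
    rw [this]
    refine isOpen_biInter_finset fun j _ => isOpen_lt continuous_const ?_
    exact f.continuous_of_finiteDimensional.comp (continuous_signedCoord B j)
  · rw [Set.ofPred_forall]
    refine MeasurableSet.iInter fun i => ?_
    have hc : Continuous fun ω : Fin n → Plane => homCoord (ω i) :=
      continuous_homCoord.comp (continuous_apply i)
    exact (measurableSet_mem_conicHull _ _ hc).compl.inter
      (measurableSet_mem_conicHull _ _ hc.neg).compl

open Classical in
theorem measurable_card_signedHoles {n : ℕ} (P : Finset (Fin n) × Finset (Fin n) → Prop) :
    Measurable fun ω : Fin n → Plane => (Finset.univ.filter fun p : Finset (Fin n) × Finset (Fin n) =>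
        IsNormalized p ∧ IsSignedHole ω p.1 p.2 ∧ P p).card := by
  have : (fun ω : Fin n → Plane => (Finset.univ.filter fun p : Finset (Fin n) × Finset (Fin n) =>
        IsNormalized p ∧ IsSignedHole ω p.1 p.2 ∧ P p).card) = fun ω =>
      ∑ p : Finset (Fin n) × Finset (Fin n), if IsNormalized p ∧ IsSignedHole ω p.1 p.2 ∧ P p then 1
        else 0 := by
    ext ω
    rw [Finset.card_filter]
  rw [this]
  refine Finset.measurable_fun_sum _ fun p _ => Measurable.ite ?_ measurable_const measurable_const
  by_cases h : IsNormalized p ∧ P p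
  · simpa [h.1, h.2] using measurableSet_isSignedHole p.1 p.2
  · have : {ω : Fin n → Plane | IsNormalized p ∧ IsSignedHole ω p.1 p.2 ∧ P p} = ∅ := by
      ext ω; simp only [Set.mem_ofPred_eq, Set.mem_empty_iff_false, iff_false]; tauto
    rw [this]
    exact MeasurableSet.empty

theorem integrable_natCast_of_ae_eq {Ω : Type*} [MeasurableSpace Ω] {ν : Measure Ω}
    [IsFiniteMeasure ν] {f g : Ω → ℕ} (hfg : f =ᵐ[ν] g) (hg : Measurable g) {M : ℕ}
    (hM : ∀ x, g x ≤ M) : Integrable (fun x => (f x : ℝ)) ν := by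
  have h1 : Integrable (fun x => (g x : ℝ)) ν :=
    Integrable.of_bound (measurable_from_top.comp hg).aestronglyMeasurable (M : ℝ)
      (Filter.Eventually.of_forall fun x => by simpa using hM x)
  exact h1.congr (hfg.mono fun x hx => by simp [hx])

end

/-! ### Exponential integrals and sums over selections of points -/

section
open MeasureTheory

theorem lintegral_exp_neg_mul_Ioi {κ : ℝ} (hκ : 0 < κ) :
    ∫⁻ t in Set.Ioi (0 : ℝ), ENNReal.ofReal (Real.exp (-(κ * t))) = ENNReal.ofReal (1 / κ) := by
  have h := integral_exp_mul_Ioi (a := -κ) (by linarith) 0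
  have hi := integrableOn_exp_mul_Ioi (a := -κ) (by linarith) 0
  rw [← ofReal_integral_eq_lintegral_ofReal]
  · congr 1
    simp only [← neg_mul]
    rw [h]; simp
  · simp only [← neg_mul]
    exact hi
  · exact Filter.Eventually.of_forall fun x => (Real.exp_pos _).le

theorem lintegral_exp_neg_mul_abs {κ : ℝ} (hκ : 0 < κ) :
    ∫⁻ t : ℝ, ENNReal.ofReal (Real.exp (-(κ * |t|))) = ENNReal.ofReal (2 / κ) := by
  have h1 := lintegral_exp_neg_mul_Ioi hκ
  rw [← lintegral_add_compl _ (measurableSet_Ioi (a := (0 : ℝ)))]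
  have h2 : ∫⁻ t in Set.Ioi (0 : ℝ), ENNReal.ofReal (Real.exp (-(κ * |t|))) =
      ENNReal.ofReal (1 / κ) := by
    rw [← h1]
    exact setLIntegral_congr_fun measurableSet_Ioi fun t ht => by
      simp only [abs_of_pos (Set.mem_Ioi.1 ht)]
  have h3 : ∫⁻ t in (Set.Ioi (0 : ℝ))ᶜ, ENNReal.ofReal (Real.exp (-(κ * |t|))) =
      ENNReal.ofReal (1 / κ) := by
    have h4 := (Measure.measurePreserving_neg (volume : Measure ℝ)).setLIntegral_comp_preimage_emb
      (MeasurableEquiv.neg ℝ).measurableEmbedding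
      (fun t => ENNReal.ofReal (Real.exp (-(κ * |t|)))) (Set.Ioi 0)
    rw [← h2, Set.compl_Ioi, ← restrict_Iio_eq_restrict_Iic, ← h4]
    simp
  rw [h2, h3, ← ENNReal.ofReal_add (by positivity) (by positivity)]
  congr 1; ring

/-- The factor `exp m` pays for the `m` selected points that are missing from the exponent. -/
theorem one_sub_pow_le_exp {u : ℝ} (h1 : u ≤ 1) (n m : ℕ) :
    ENNReal.ofReal (1 - u) ^ (n - m) ≤ ENNReal.ofReal (Real.exp m * Real.exp (-(n * u))) := by
  rw [← ENNReal.ofReal_pow (by linarith), ← Real.exp_add]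
  apply ENNReal.ofReal_le_ofReal
  rcases le_total m n with h | h
  · calc (1 - u) ^ (n - m) ≤ (Real.exp (-u)) ^ (n - m) :=
          pow_le_pow_left₀ (by linarith) (by linarith [Real.add_one_le_exp (-u)]) _
      _ = Real.exp (((n - m : ℕ) : ℝ) * (-u)) := by rw [← Real.exp_nat_mul]
      _ ≤ _ := by
          apply Real.exp_le_exp.2
          rw [Nat.cast_sub h]
          have : (m : ℝ) * u ≤ m := mul_le_of_le_one_right (by positivity) h1
          linarith
  -- Here `n ≤ m`, the truncated exponent is 0, and the bound holds because `n * u ≤ m`.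
  · rw [Nat.sub_eq_zero_of_le h, pow_zero]
    apply Real.one_le_exp
    have : (n : ℝ) * u ≤ n := mul_le_of_le_one_right (by positivity) h1
    have : (n : ℝ) ≤ m := by exact_mod_cast h
    linarith

/-- Only this direction of Tonelli is needed, and it requires no measurability of `G`. -/
theorem lintegral_pi_succ_le {Ω : Type*} [MeasurableSpace Ω] (μ : Measure Ω) [SigmaFinite μ] (m : ℕ)
    (G : (Fin (m + 1) → Ω) → ENNReal) :
    ∫⁻ x, G x ∂(Measure.pi fun _ => μ) ≤
      ∫⁻ a, ∫⁻ x : Fin m → Ω, G (Fin.cons a x) ∂(Measure.pi fun _ => μ) ∂μ := by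
  have h := measurePreserving_piFinSuccAbove (fun _ : Fin (m + 1) => μ) 0
  have e : ∫⁻ x, G x ∂(Measure.pi fun _ => μ) =
      ∫⁻ z : Ω × (Fin m → Ω), G (Fin.cons z.1 z.2) ∂(μ.prod (Measure.pi fun _ => μ)) := by
    refine Eq.trans ?_ (h.lintegral_comp_emb (MeasurableEquiv.measurableEmbedding _)
      (fun z : Ω × (Fin m → Ω) => G (Fin.cons z.1 z.2)))
    refine lintegral_congr fun x => ?_
    congr 1
    exact (Fin.cons_self_tail x).symm
  rw [e]
  exact lintegral_prod_le _

theorem lintegral_pi_zero {Ω : Type*} [MeasurableSpace Ω] (μ : Measure Ω) [SigmaFinite μ]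
    (G : (Fin 0 → Ω) → ENNReal) : ∫⁻ x, G x ∂(Measure.pi fun _ => μ) = G Fin.elim0 := by
  rw [Measure.pi_of_empty (fun _ : Fin 0 => μ) Fin.elim0, lintegral_dirac]

theorem ae_pi_mem {K : Set Plane} (hK : MeasurableSet K) {ι : Type*} [Fintype ι]
    [IsProbabilityMeasure (volume.restrict K)] :
    ∀ᵐ x ∂(Measure.pi fun _ : ι => volume.restrict K), ∀ i, x i ∈ K :=
  ae_all_iff.2 fun i => (measurePreserving_eval (fun _ : ι => volume.restrict K) i).quasiMeasurePreserving.ae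
    (ae_restrict_mem hK)

theorem dist_sq_eq (p q : Plane) : dist p q ^ 2 = (p 0 - q 0) ^ 2 + (p 1 - q 1) ^ 2 := by
  rw [EuclideanSpace.dist_eq, Real.sq_sqrt (by positivity), Fin.sum_univ_two]
  simp [Real.dist_eq, sq_abs]

/-- For fixed `p`, `q`, the integral of `exp (-c |orient p q r|)` over the points `r` for which
`p q` is the longest edge of the triangle `p q r` is of order `1 / c`. -/
theorem lintegral_longest_edge_le {c : ℝ} (hc : 0 < c) (p q : Plane) :
    ∫⁻ r : Plane in {r | dist r p ≤ dist p q}, ENNReal.ofReal (Real.exp (-(c * |orient p q r|))) ≤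
      ENNReal.ofReal (4 / c) := by
  have hmeas : MeasurableSet {r : Plane | dist r p ≤ dist p q} :=
    (isClosed_le (by fun_prop) (by fun_prop)).measurableSet
  by_cases hpq : p = q
  · subst hpq
    have : {r : Plane | dist r p ≤ dist p p} = {p} := by ext r; simp
    rw [this]
    simp
  rw [← lintegral_indicator hmeas]
  let u : Plane := q - p
  let v : Plane := !₂[-(u 1), u 0]
  set L := u 0 ^ 2 + u 1 ^ 2 with hL
  have hdet : u 0 * v 1 - u 1 * v 0 = L := by simp [v, hL]; ring
  have hLd : L = dist p q ^ 2 := by rw [dist_sq_eq]; simp [hL, u]; ring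
  have hLpos : 0 < L := by rw [hLd]; have := dist_pos.2 hpq; positivity
  rw [lintegral_frame p u v (by rw [hdet]; exact hLpos.ne'), hdet, abs_of_pos hLpos]
  -- In the orthogonal frame `u = q - p`, `v`, both of squared length `L`, the disc condition forces
  -- `|x.1| ≤ 1` and the doubled area is `x.2 * L`. The Jacobian `L` cancels against the decay rate
  -- `c * L`, leaving `2 * 2 / c`.
  have hle : ∀ x : ℝ × ℝ, {r : Plane | dist r p ≤ dist p q}.indicator
      (fun r => ENNReal.ofReal (Real.exp (-(c * |orient p q r|)))) (p + x.1 • u + x.2 • v) ≤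
      (Set.Icc (-1 : ℝ) 1).indicator 1 x.1 * ENNReal.ofReal (Real.exp (-(c * L * |x.2|))) := by
    intro x
    have e : orient p q (p + x.1 • u + x.2 • v) = x.2 * L := by
      simp [orient, u, v, hL]; ring
    by_cases hx : p + x.1 • u + x.2 • v ∈ {r : Plane | dist r p ≤ dist p q}
    · rw [Set.indicator_of_mem hx, e, abs_mul, abs_of_pos hLpos]
      have hx' : dist (p + x.1 • u + x.2 • v) p ^ 2 ≤ L := by
        rw [hLd]
        exact pow_le_pow_left₀ dist_nonneg hx 2
      rw [dist_sq_eq] at hx'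
      simp [v] at hx'
      have h1 : (x.1 ^ 2 + x.2 ^ 2) * L ≤ L := by
        calc _ = (x.1 * u 0 + -(x.2 * u 1)) ^ 2 + (x.1 * u 1 + x.2 * u 0) ^ 2 := by
              rw [hL]; ring
          _ ≤ L := by convert hx' using 1; ring
      have h2 : x.1 ^ 2 ≤ 1 := by
        have : x.1 ^ 2 + x.2 ^ 2 ≤ 1 := by
          by_contra hcon
          push Not at hcon
          nlinarith
        nlinarith [sq_nonneg x.2]
      have h3 : x.1 ∈ Set.Icc (-1 : ℝ) 1 := by
        have := abs_le_of_sq_le_sq' (a := x.1) (b := 1) (by simpa using h2) zero_le_one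
        exact ⟨this.1, this.2⟩
      rw [Set.indicator_of_mem h3, Pi.one_apply, one_mul]
      apply le_of_eq
      congr 3
      ring
    · rw [Set.indicator_of_notMem hx]
      exact zero_le
  refine (mul_le_mul_right (lintegral_mono hle) _).trans ?_
  rw [Measure.volume_eq_prod, lintegral_prod_mul (f := (Set.Icc (-1 : ℝ) 1).indicator 1)
    (g := fun t => ENNReal.ofReal (Real.exp (-(c * L * |t|))))
    (measurable_one.indicator measurableSet_Icc).aemeasurable (by fun_prop),
    lintegral_indicator_one measurableSet_Icc, lintegral_exp_neg_mul_abs (by positivity),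
    Real.volume_Icc, ← ENNReal.ofReal_mul (by norm_num), ← ENNReal.ofReal_mul hLpos.le]
  apply ENNReal.ofReal_le_ofReal
  apply le_of_eq
  field_simp
  norm_num

open Classical in
-- First-moment formula: all selections of labelled points contribute equally, and there are
-- `n.descFactorial (card ι)` of them.
theorem lintegral_sum_embedding {Ω : Type*} [MeasurableSpace Ω] (μ : Measure Ω)
    [IsProbabilityMeasure μ] {ι : Type*} [Fintype ι] (n : ℕ)
    {F : (ι → Ω) → ENNReal} (hF : Measurable F) {h : (ι → Ω) → Ω → ENNReal}
    (hh : Measurable (Function.uncurry h)) :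
    ∫⁻ ω : Fin n → Ω, ∑ e : ι ↪ Fin n,
      F (ω ∘ e) * ∏ j ∈ Finset.univ.filter (fun j => j ∉ Set.range e), h (ω ∘ e) (ω j)
      ∂(Measure.pi fun _ => μ) = (n.descFactorial (Fintype.card ι) : ENNReal) *
    ∫⁻ x : ι → Ω, F x * (∫⁻ y, h x y ∂μ) ^ (n - Fintype.card ι) ∂(Measure.pi fun _ => μ) := by
  rw [lintegral_finsetSum]
  · rw [Finset.sum_congr rfl fun e _ => lintegral_comp_embedding μ e hF hh, Finset.sum_const,
      Finset.card_univ, Fintype.card_embedding_eq, nsmul_eq_mul, Fintype.card_fin]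
  · intro e _
    have hc : Measurable fun ω : Fin n → Ω => ω ∘ e :=
      measurable_pi_lambda _ fun i => measurable_pi_apply _
    exact (hF.comp hc).mul (Finset.measurable_fun_prod _ fun j _ =>
      hh.comp (hc.prodMk (measurable_pi_apply j)))

end

/-! ### Empty regions of a hole and counting of affine triangles -/

/-- The points that lie in the angle `b a b'` beyond the segment `b b'`. -/
def beyond (a b b' : Plane) : Set Plane :=
  {x | 0 < orient a b x ∧ orient a b' x < 0 ∧ orient b b' x < 0}

section
variable {n : ℕ} {ω : Fin n → Plane} {J B : Finset (Fin n)}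

theorem mem_conicHull_of_smul_eq {ι : Type*} {g : ι → Fin 3 → ℝ} {J : Finset ι} {i j k : ι}
    (hi : i ∈ J) (hj : j ∈ J) (hk : k ∈ J) {D α β γ : ℝ} (hD : 0 < D) (hα : 0 ≤ α) (hβ : 0 ≤ β)
    (hγ : 0 ≤ γ) {v : Fin 3 → ℝ} (h : D • v = α • g i + β • g j + γ • g k) : v ∈ conicHull g J := by
  have : D • v ∈ conicHull g J := by
    rw [h]
    exact add_mem_conicHull (add_mem_conicHull (smul_mem_conicHull hα (mem_conicHull_of_mem hi))
      (smul_mem_conicHull hβ (mem_conicHull_of_mem hj))) (smul_mem_conicHull hγ (mem_conicHull_of_mem hk))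
  have h2 := smul_mem_conicHull (inv_nonneg.2 hD.le) this
  rwa [smul_smul, inv_mul_cancel₀ hD.ne', one_smul] at h2

/-- Three vertices of equal sign span their ordinary affine triangle inside the hole. -/
theorem IsSignedHole.notMem_openTriangle (h : IsSignedHole ω J B) {i j k : Fin n} (hi : i ∈ J)
    (hj : j ∈ J) (hk : k ∈ J) (hij : i ∈ B ↔ j ∈ B) (hik : i ∈ B ↔ k ∈ B) (l : Fin n) :
    ω l ∉ openTriangle (ω i) (ω j) (ω k) := by
  rintro ⟨h1, h2, h3⟩
  have hli : l ≠ i := by rintro rfl; simp [orient] at h1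
  have hlj : l ≠ j := by rintro rfl; simp [orient] at h2
  have hlk : l ≠ k := by rintro rfl; simp [orient] at h3
  have hi' : i ∈ J.erase l := Finset.mem_erase.2 ⟨hli.symm, hi⟩
  have hj' : j ∈ J.erase l := Finset.mem_erase.2 ⟨hlj.symm, hj⟩
  have hk' : k ∈ J.erase l := Finset.mem_erase.2 ⟨hlk.symm, hk⟩
  have hD : 0 < orient (ω i) (ω j) (ω k) := by
    have : orient (ω i) (ω j) (ω k) = orient (ω i) (ω j) (ω l) + orient (ω j) (ω k) (ω l) +
      orient (ω k) (ω i) (ω l) := by unfold orient; ring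
    rw [this]; positivity
  have e := orient_smul_homCoord (ω i) (ω j) (ω k) (ω l)
  have e1 : orient (ω l) (ω j) (ω k) = orient (ω j) (ω k) (ω l) := by unfold orient; ring
  have e2 : orient (ω i) (ω l) (ω k) = orient (ω k) (ω i) (ω l) := by unfold orient; ring
  rw [e1, e2] at e
  by_cases hB : i ∈ B
  · refine (h.2 l).2 (mem_conicHull_of_smul_eq hi' hj' hk' hD h2.le h3.le h1.le ?_)
    simp only [signedCoord, if_pos hB, if_pos (hij.1 hB), if_pos (hik.1 hB), smul_neg]
    rw [e]; abel
  · refine (h.2 l).1 (mem_conicHull_of_smul_eq hi' hj' hk' hD h2.le h3.le h1.le ?_)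
    simp only [signedCoord, if_neg hB, if_neg (mt hij.2 hB), if_neg (mt hik.2 hB)]
    exact e

/-- When the sign of `i` is opposite to that of `j` and `k`, their projective triangle contains the
points whose barycentric coordinate at `i` is negative and whose other two are positive, that is,
the region beyond `j k` seen from `i`. -/
theorem IsSignedHole.notMem_beyond (h : IsSignedHole ω J B) {i j k : Fin n} (hi : i ∈ J)
    (hj : j ∈ J) (hk : k ∈ J) (hij : i ∈ B ↔ j ∉ B) (hik : i ∈ B ↔ k ∉ B)
    (hD : 0 < orient (ω i) (ω j) (ω k)) (l : Fin n) : ω l ∉ beyond (ω i) (ω j) (ω k) := by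
  rintro ⟨h1, h2, h3⟩
  have hli : l ≠ i := by rintro rfl; simp [orient] at h1
  have hlj : l ≠ j := by rintro rfl; simp [orient] at h3
  have hlk : l ≠ k := by
    rintro rfl; simp only [orient] at h2; linarith [mul_comm (ω l 0 - ω i 0) (ω l 1 - ω i 1)]
  have hi' : i ∈ J.erase l := Finset.mem_erase.2 ⟨hli.symm, hi⟩
  have hj' : j ∈ J.erase l := Finset.mem_erase.2 ⟨hlj.symm, hj⟩
  have hk' : k ∈ J.erase l := Finset.mem_erase.2 ⟨hlk.symm, hk⟩
  have e := orient_smul_homCoord (ω i) (ω j) (ω k) (ω l)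
  have e1 : orient (ω l) (ω j) (ω k) = orient (ω j) (ω k) (ω l) := by unfold orient; ring
  have e2 : orient (ω i) (ω l) (ω k) = -orient (ω i) (ω k) (ω l) := by unfold orient; ring
  rw [e1, e2] at e
  have h2' := neg_pos.2 h2
  have h3' := neg_pos.2 h3
  by_cases hB : i ∈ B
  · refine (h.2 l).1 (mem_conicHull_of_smul_eq hi' hj' hk' hD h3'.le h2'.le h1.le ?_)
    simp only [signedCoord, if_pos hB, if_neg (hij.1 hB), if_neg (hik.1 hB), smul_neg]
    rw [e]; module
  · have hjB : j ∈ B := by tauto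
    have hkB : k ∈ B := by tauto
    refine (h.2 l).2 (mem_conicHull_of_smul_eq hi' hj' hk' hD h3'.le h2'.le h1.le ?_)
    simp only [signedCoord, if_neg hB, if_pos hjB, if_pos hkB, smul_neg]
    rw [e]; module

/-- The triangle spanned by three points, whatever their orientation. -/
def triangleRegion (x : Fin 3 → Plane) : Set Plane :=
  openTriangle (x 0) (x 1) (x 2) ∪ openTriangle (x 1) (x 0) (x 2)

/-- The first two of three points span the longest edge of their triangle. -/
def LongestEdge (x : Fin 3 → Plane) : Prop :=
  dist (x 2) (x 0) ≤ dist (x 0) (x 1) ∧ dist (x 2) (x 1) ≤ dist (x 0) (x 1)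

theorem exists_longestEdge (hJ : J.card = 3) :
    ∃ e : Fin 3 ↪ Fin n, Finset.univ.map e = J ∧ LongestEdge (ω ∘ e) := by
  obtain ⟨i, j, k, hij, hik, hjk, rfl⟩ := Finset.card_eq_three.1 hJ
  have mk : ∀ a b c : Fin n, a ≠ b → a ≠ c → b ≠ c → ({a, b, c} : Finset (Fin n)) = {i, j, k} →
      dist (ω c) (ω a) ≤ dist (ω a) (ω b) → dist (ω c) (ω b) ≤ dist (ω a) (ω b) →
      ∃ e : Fin 3 ↪ Fin n, Finset.univ.map e = {i, j, k} ∧ LongestEdge (ω ∘ e) := by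
    intro a b c hab hac hbc h h1 h2
    refine ⟨⟨![a, b, c], ?_⟩, ?_, by simpa [LongestEdge] using ⟨h1, h2⟩⟩
    · intro x y hxy
      fin_cases x <;> fin_cases y <;> simp_all
    · rw [← h]
      ext x
      simp only [Finset.mem_map, Finset.mem_univ, true_and, Fin.exists_fin_succ, Finset.mem_insert,
        Finset.mem_singleton]
      change (a = x ∨ b = x ∨ c = x ∨ _) ↔ _
      simp [eq_comm]
  have d1 := dist_comm (ω i) (ω j)
  have d2 := dist_comm (ω i) (ω k)
  have d3 := dist_comm (ω j) (ω k)
  rcases le_total (dist (ω i) (ω j)) (dist (ω i) (ω k)) with h1 | h1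
  · rcases le_total (dist (ω i) (ω k)) (dist (ω j) (ω k)) with h2 | h2
    · refine mk j k i hjk hij.symm hik.symm ?_ (by linarith) (by linarith)
      ext x; simp; tauto
    · refine mk i k j hik hij hjk.symm ?_ (by linarith) (by linarith)
      ext x; simp; tauto
  · rcases le_total (dist (ω i) (ω j)) (dist (ω j) (ω k)) with h2 | h2
    · refine mk j k i hjk hij.symm hik.symm ?_ (by linarith) (by linarith)
      ext x; simp; tauto
    · exact mk i j k hij hik hjk rfl (by linarith) (by linarith)

open Classical in
-- Each empty triangle is listed by an embedding with its longest edge first. Emptiness becomes a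
-- product of indicators over the other points, the form required by `lintegral_sum_embedding`.
theorem card_affine_le (ω : Fin n → Plane) :
    ((Finset.univ.filter fun p : Finset (Fin n) × Finset (Fin n) =>
      IsNormalized p ∧ IsSignedHole ω p.1 p.2 ∧ (p.1.card = 3 ∧ p.2 = ∅)).card : ENNReal) ≤
    ∑ e : Fin 3 ↪ Fin n, {x | LongestEdge x}.indicator 1 (ω ∘ e) *
      ∏ j ∈ Finset.univ.filter (fun j => j ∉ Set.range e),
        (triangleRegion (ω ∘ e))ᶜ.indicator 1 (ω j) := by
  let S : Finset (Fin 3 ↪ Fin n) := Finset.univ.filter fun e => LongestEdge (ω ∘ e) ∧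
    ∀ l, ω l ∉ triangleRegion (ω ∘ e)
  have hle : (Finset.univ.filter fun p : Finset (Fin n) × Finset (Fin n) =>
      IsNormalized p ∧ IsSignedHole ω p.1 p.2 ∧ (p.1.card = 3 ∧ p.2 = ∅)).card ≤ S.card := by
    refine (Finset.card_le_card (t := S.image fun e => (Finset.univ.map e, ∅)) ?_).trans
      Finset.card_image_le
    rintro ⟨J, B⟩ hp
    obtain ⟨-, -, hh, hJ, rfl⟩ := Finset.mem_filter.1 hp
    obtain ⟨e, rfl, he⟩ := exists_longestEdge (ω := ω) hJ
    refine Finset.mem_image.2 ⟨e, Finset.mem_filter.2 ⟨Finset.mem_univ _, he, fun l => ?_⟩, rfl⟩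
    have hm : ∀ a, e a ∈ Finset.univ.map e := fun a => Finset.mem_map_of_mem _ (Finset.mem_univ a)
    rintro (h | h)
    · exact hh.notMem_openTriangle (hm 0) (hm 1) (hm 2) (by simp) (by simp) l h
    · exact hh.notMem_openTriangle (hm 1) (hm 0) (hm 2) (by simp) (by simp) l h
  calc _ ≤ (S.card : ENNReal) := by exact_mod_cast hle
    _ = ∑ e ∈ S, 1 := by simp
    _ ≤ ∑ e ∈ S, {x | LongestEdge x}.indicator 1 (ω ∘ e) *
      ∏ j ∈ Finset.univ.filter (fun j => j ∉ Set.range e),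
        (triangleRegion (ω ∘ e))ᶜ.indicator 1 (ω j) := by
        refine Finset.sum_le_sum fun e he => ?_
        obtain ⟨-, h1, h2⟩ := Finset.mem_filter.1 he
        rw [Set.indicator_of_mem (show ω ∘ e ∈ {x | LongestEdge x} from h1), Finset.prod_eq_one]
        · simp
        · intro j _
          rw [Set.indicator_of_mem (h2 j)]; rfl
    _ ≤ _ := Finset.sum_le_univ_sum_of_nonneg fun e => zero_le

end

/-! ### Expected number of empty affine triangles -/

section
open MeasureTheory

theorem measurableSet_uncurry_openTriangle {X : Type*} [TopologicalSpace X] [MeasurableSpace X]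
    [OpensMeasurableSpace X] {a b c d : X → Plane} (ha : Continuous a) (hb : Continuous b)
    (hc : Continuous c) (hd : Continuous d) :
    MeasurableSet {z : X | d z ∈ openTriangle (a z) (b z) (c z)} := by
  refine IsOpen.measurableSet ((isOpen_lt continuous_const (continuous_orient ?_ ?_ ?_)).and
    ((isOpen_lt continuous_const (continuous_orient ?_ ?_ ?_)).and
      (isOpen_lt continuous_const (continuous_orient ?_ ?_ ?_)))) <;> assumption

theorem ofReal_abs_orient_le_volume {K : Set Plane} (hK : Convex ℝ K) {x : Fin 3 → Plane}
    (hx : ∀ i, x i ∈ K) :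
    ENNReal.ofReal (|orient (x 0) (x 1) (x 2)| / 2) ≤ (volume.restrict K) (triangleRegion x) := by
  rcases lt_trichotomy (orient (x 0) (x 1) (x 2)) 0 with h | h | h
  · have h' : 0 < orient (x 1) (x 0) (x 2) := by rw [orient_swap]; linarith
    rw [abs_of_neg h, ← orient_swap, ← volume_openTriangle h',
      ← Measure.restrict_eq_self _ (openTriangle_subset hK (hx 1) (hx 0) (hx 2))]
    exact measure_mono Set.subset_union_right
  · simp [h]
  · rw [abs_of_pos h, ← volume_openTriangle h,
      ← Measure.restrict_eq_self _ (openTriangle_subset hK (hx 0) (hx 1) (hx 2))]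
    exact measure_mono Set.subset_union_left

/-- The expected number of empty triangles among `n` uniform points is at most quadratic. -/
theorem exists_lintegral_affine_le {K : Set Plane} (hKm : MeasurableSet K) (hK : Convex ℝ K)
    (hK1 : volume K = 1) : ∃ C : ℝ, 0 ≤ C ∧ ∀ n : ℕ, ∫⁻ ω,
      (∑ e : Fin 3 ↪ Fin n, {x | LongestEdge x}.indicator 1 (ω ∘ e) *
      ∏ j ∈ Finset.univ.filter (fun j => j ∉ Set.range e),
        (triangleRegion (ω ∘ e))ᶜ.indicator 1 (ω j) : ENNReal) ∂(uniformPoints K n) ≤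
      ENNReal.ofReal (C * n ^ 2) := by
  classical
  have : IsProbabilityMeasure (volume.restrict K) := ⟨by simp [hK1]⟩
  -- The factor `exp 3` accounts for the three selected points; `8 / n` is the bound `4 / c` of
  -- `lintegral_longest_edge_le` at the rate `c = n / 2`.
  refine ⟨Real.exp 3 * 8, by positivity, fun n => ?_⟩
  have hF : Measurable ({x : Fin 3 → Plane | LongestEdge x}.indicator (1 : (Fin 3 → Plane) → ENNReal)) := by
    exact measurable_one.indicator (MeasurableSet.inter
      (isClosed_le (f := fun x : Fin 3 → Plane => dist (x 2) (x 0))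
        (g := fun x => dist (x 0) (x 1)) (by fun_prop) (by fun_prop)).measurableSet
      (isClosed_le (f := fun x : Fin 3 → Plane => dist (x 2) (x 1))
        (g := fun x => dist (x 0) (x 1)) (by fun_prop) (by fun_prop)).measurableSet)
  have hh : Measurable (Function.uncurry fun (x : Fin 3 → Plane) (y : Plane) =>
      (triangleRegion x)ᶜ.indicator (1 : Plane → ENNReal) y) := by
    have : (Function.uncurry fun (x : Fin 3 → Plane) (y : Plane) =>
      (triangleRegion x)ᶜ.indicator (1 : Plane → ENNReal) y) =
        {z : (Fin 3 → Plane) × Plane | z.2 ∈ triangleRegion z.1}ᶜ.indicator 1 := by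
      ext z; simp [Function.uncurry, Set.indicator]
    rw [this]
    refine measurable_one.indicator (MeasurableSet.compl (MeasurableSet.union
      (measurableSet_uncurry_openTriangle ?_ ?_ ?_ ?_)
      (measurableSet_uncurry_openTriangle ?_ ?_ ?_ ?_))) <;> fun_prop
  rcases Nat.eq_zero_or_pos n with rfl | hn
  · have : IsEmpty (Fin 3 ↪ Fin 0) := ⟨fun e => (e 0).elim0⟩
    simp only [Finset.univ_eq_empty, Finset.sum_empty, lintegral_zero]
    exact zero_le
  have hnpos : (0 : ℝ) < n := by exact_mod_cast hn
  unfold uniformPoints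
  rw [lintegral_sum_embedding (volume.restrict K) n hF hh]
  have hone : ∫⁻ x, {x : Fin 3 → Plane | LongestEdge x}.indicator (1 : (Fin 3 → Plane) → ENNReal) x *
      (∫⁻ y, (triangleRegion x)ᶜ.indicator 1 y ∂(volume.restrict K)) ^ (n - Fintype.card (Fin 3))
      ∂(Measure.pi fun _ => volume.restrict K) ≤
      ENNReal.ofReal (Real.exp 3 * (8 / n)) := by
    have hbound : ∀ᵐ x ∂(Measure.pi fun _ : Fin 3 => volume.restrict K),
        {x : Fin 3 → Plane | LongestEdge x}.indicator (1 : (Fin 3 → Plane) → ENNReal) x *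
          (∫⁻ y, (triangleRegion x)ᶜ.indicator 1 y ∂(volume.restrict K)) ^ (n - Fintype.card (Fin 3)) ≤
        ENNReal.ofReal (Real.exp 3) * {x : Fin 3 → Plane | dist (x 2) (x 0) ≤ dist (x 0) (x 1)}.indicator
          (fun x => ENNReal.ofReal (Real.exp (-((n / 2 : ℝ) * |orient (x 0) (x 1) (x 2)|)))) x := by
      filter_upwards [ae_pi_mem hKm] with x hx
      by_cases hL : LongestEdge x
      · rw [Set.indicator_of_mem (show x ∈ {x | LongestEdge x} from hL),
          Set.indicator_of_mem (show x ∈ {x : Fin 3 → Plane | dist (x 2) (x 0) ≤ dist (x 0) (x 1)} from hL.1),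
          Pi.one_apply, one_mul]
        have hmeas : MeasurableSet (triangleRegion x) :=
          (isOpen_openTriangle _ _ _).measurableSet.union (isOpen_openTriangle _ _ _).measurableSet
        rw [lintegral_indicator_one hmeas.compl, prob_compl_eq_one_sub hmeas]
        have h1 := ofReal_abs_orient_le_volume hK hx
        have h2 : |orient (x 0) (x 1) (x 2)| / 2 ≤ 1 := by
          rw [← ENNReal.ofReal_le_one]
          exact h1.trans prob_le_one
        calc _ ≤ ENNReal.ofReal (1 - |orient (x 0) (x 1) (x 2)| / 2) ^ (n - 3) := by
              rw [Fintype.card_fin, ENNReal.ofReal_sub _ (by positivity), ENNReal.ofReal_one]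
              exact pow_le_pow_left₀ zero_le (tsub_le_tsub_left h1 1) _
          _ ≤ _ := one_sub_pow_le_exp h2 n 3
          _ = _ := by
              rw [ENNReal.ofReal_mul (Real.exp_pos _).le]
              congr 3
              ring
      · rw [Set.indicator_of_notMem (show x ∉ {x | LongestEdge x} from hL), zero_mul]
        exact zero_le
    refine (lintegral_mono_ae hbound).trans ?_
    rw [lintegral_const_mul' _ _ ENNReal.ofReal_ne_top, ENNReal.ofReal_mul (Real.exp_pos _).le]
    refine mul_le_mul_right ?_ _
    -- The first two points integrate over a probability measure, and the third one yields `8 / n`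
    -- uniformly in them.
    refine (lintegral_pi_succ_le _ _ _).trans ?_
    calc _ ≤ ∫⁻ a, ENNReal.ofReal (8 / n) ∂(volume.restrict K) := by
          refine lintegral_mono fun a => (lintegral_pi_succ_le _ _ _).trans ?_
          calc _ ≤ ∫⁻ b, ENNReal.ofReal (8 / n) ∂(volume.restrict K) := by
                refine lintegral_mono fun b => (lintegral_pi_succ_le _ _ _).trans ?_
                simp only [lintegral_pi_zero]
                refine (lintegral_mono' Measure.restrict_le_self le_rfl).trans ?_
                have h8 : (8 / n : ℝ) = 4 / (n / 2) := by field_simp; norm_num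
                rw [h8]
                refine le_trans (le_of_eq ?_) (lintegral_longest_edge_le (by positivity) a b)
                rw [← lintegral_indicator (isClosed_le (by fun_prop) (by fun_prop)).measurableSet]
                refine lintegral_congr fun c => ?_
                simp only [Set.indicator]
                rfl
            _ = _ := by simp
      _ = _ := by simp
  refine (mul_le_mul_right hone _).trans ?_
  calc _ ≤ ((n ^ 3 : ℕ) : ENNReal) * ENNReal.ofReal (Real.exp 3 * (8 / n)) := by
        refine mul_le_mul_left ?_ _
        rw [Fintype.card_fin]
        exact_mod_cast Nat.descFactorial_le_pow n 3
    _ = _ := by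
        rw [← ENNReal.ofReal_natCast, ← ENNReal.ofReal_mul (by positivity)]
        congr 1
        push_cast
        field_simp

end

/-! ### Combinatorial description of non-affine holes -/

/-- The position of up to three further vertices `x` on one side of an edge `a b` of a projective
polygon: the last vertex of the side, the one furthest from the line joining it to `b`, and the one
furthest from the resulting polygonal line. -/
def SideGood : (τ : ℕ) → Plane → Plane → (Fin τ → Plane) → Prop
  | 0, _, _, _ => True
  | 1, a, b, x => 0 < orient a b (x 0)
  | 2, a, b, x => x 1 ∈ openTriangle a b (x 0)
  | 3, a, b, x => x 1 ∈ openTriangle a b (x 0) ∧ x 2 ∈ openTriangle a b (x 0) ∧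
      orient b (x 0) (x 2) ≤ orient b (x 0) (x 1) ∧
      (0 < orient b (x 1) (x 2) ∨ 0 < orient (x 1) (x 0) (x 2))
  | _ + 4, _, _, _ => False

/-- A region covered by the polygon with the given vertices. -/
def sideEmpty : (τ : ℕ) → Plane → Plane → (Fin τ → Plane) → Set Plane
  | 0, _, _, _ => ∅
  | 1, a, b, x => beyond a b (x 0)
  | 2, a, b, x => beyond a b (x 0) ∪ openTriangle b (x 0) (x 1)
  | 3, a, b, x => beyond a b (x 0) ∪ openTriangle b (x 0) (x 1) ∪
      (openTriangle b (x 1) (x 2) ∪ openTriangle (x 1) (x 0) (x 2))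
  | _ + 4, _, _, _ => ∅

/-- The left one of the two regions that contain the remaining vertices. -/
def restLeft (a b b' v : Plane) (e : ℝ) : Set Plane :=
  {x | 0 ≤ orient a b x ∧ 0 ≤ orient b v x ∧ orient b b' x ≤ orient b b' v ∧ orient b v x ≤ e}

/-- The right one of the two regions that contain the remaining vertices. -/
def restRight (a b b' v : Plane) (e : ℝ) : Set Plane :=
  {x | 0 ≤ orient b' a x ∧ 0 ≤ orient v b' x ∧ orient b b' x ≤ orient b b' v ∧ orient v b' x ≤ e}

/-- A region that contains all the vertices of the side which are not among the given ones. -/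
def sideRest : (τ : ℕ) → Plane → Plane → (Fin τ → Plane) → Set Plane
  | 3, a, b, x =>
      restLeft a b (x 0) (x 1) (max (orient b (x 1) (x 2)) (orient (x 1) (x 0) (x 2))) ∪
      restRight a b (x 0) (x 1) (max (orient b (x 1) (x 2)) (orient (x 1) (x 0) (x 2)))
  | _, _, _, _ => ∅

section
variable {n : ℕ} {ω : Fin n → Plane} {J B : Finset (Fin n)}

/-- The quotient `X s / orient` is the cotangent of the angle `b a s`, which lies between 0 and `π`.
Minimizing it maximizes the angle. -/
theorem exists_last_in_angle (hω : GeneralPosition ω) {a b : Fin n} {S : Finset (Fin n)}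
    (haS : a ∉ S) (hS : ∀ s ∈ S, 0 < orient (ω a) (ω b) (ω s)) (hne : S.Nonempty) :
    ∃ b' ∈ S, ∀ s ∈ S, s ≠ b' → orient (ω a) (ω b') (ω s) < 0 := by
  let X : Fin n → ℝ := fun s =>
    (ω b 0 - ω a 0) * (ω s 0 - ω a 0) + (ω b 1 - ω a 1) * (ω s 1 - ω a 1)
  obtain ⟨b', hb', hmin⟩ := Finset.exists_min_image S (fun s => X s / orient (ω a) (ω b) (ω s)) hne
  refine ⟨b', hb', fun s hs hsb => ?_⟩
  have h1 := hS s hs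
  have h2 := hS b' hb'
  have h3 := hmin s hs
  rw [div_le_div_iff₀ h2 h1] at h3
  have hab : 0 < (ω b 0 - ω a 0) ^ 2 + (ω b 1 - ω a 1) ^ 2 := by
    by_contra hcon
    have e0 : ω b 0 - ω a 0 = 0 := by nlinarith [sq_nonneg (ω b 0 - ω a 0), sq_nonneg (ω b 1 - ω a 1)]
    have e1 : ω b 1 - ω a 1 = 0 := by nlinarith [sq_nonneg (ω b 0 - ω a 0), sq_nonneg (ω b 1 - ω a 1)]
    simp [orient, e0, e1] at h1
  have h4 : ((ω b 0 - ω a 0) ^ 2 + (ω b 1 - ω a 1) ^ 2) * orient (ω a) (ω b') (ω s) ≤ 0 := by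
    have : ((ω b 0 - ω a 0) ^ 2 + (ω b 1 - ω a 1) ^ 2) * orient (ω a) (ω b') (ω s) =
        X b' * orient (ω a) (ω b) (ω s) - X s * orient (ω a) (ω b) (ω b') := by
      simp only [X, orient]; ring
    rw [this]; linarith
  have h5 : orient (ω a) (ω b') (ω s) ≤ 0 := by
    by_contra hcon
    push Not at hcon
    have := mul_pos hab hcon
    linarith
  refine lt_of_le_of_ne h5 (hω.2 _ _ _ ?_ ?_ hsb.symm)
  · rintro rfl; exact haS hb'
  · rintro rfl; exact haS hs

/-- The structure of the vertices of a projective polygon on one side of an edge `a b`. -/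
theorem exists_side (hω : GeneralPosition ω) (hh : IsSignedHole ω J B) {a b : Fin n} (ha : a ∈ J)
    {S : Finset (Fin n)} (hS : ∀ s ∈ S, s ∈ J ∧ (a ∈ B ↔ s ∉ B)) (hb : b ∈ S)
    (hor : ∀ s ∈ S, s ≠ b → 0 < orient (ω a) (ω b) (ω s)) :
    ∃ τ : Fin 4, ∃ e : Fin τ → Fin n, Function.Injective e ∧ (∀ i, e i ∈ S ∧ e i ≠ b) ∧
      SideGood τ (ω a) (ω b) (ω ∘ e) ∧ (∀ l, ω l ∉ sideEmpty τ (ω a) (ω b) (ω ∘ e)) ∧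
      ∀ s ∈ S, s ≠ b → s ∉ Set.range e → ω s ∈ sideRest τ (ω a) (ω b) (ω ∘ e) := by
  have haS : a ∉ S := fun h => by have := (hS a h).2; tauto
  have hab : a ≠ b := by rintro rfl; exact haS hb
  have hne : ∀ s ∈ S, a ≠ s := by rintro s hs rfl; exact haS hs
  rcases (S.erase b).eq_empty_or_nonempty with h0 | h0
  · refine ⟨0, Fin.elim0, fun i => i.elim0, fun i => i.elim0, trivial, fun l => id, ?_⟩
    intro s hs hsb
    have : s ∈ S.erase b := Finset.mem_erase.2 ⟨hsb, hs⟩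
    rw [h0] at this
    simp at this
  obtain ⟨b', hb', hlast⟩ := exists_last_in_angle hω (a := a) (b := b) (S := S.erase b)
    (fun h => haS (Finset.mem_of_mem_erase h))
    (fun s hs => hor s (Finset.mem_of_mem_erase hs) (Finset.ne_of_mem_erase hs)) h0
  obtain ⟨hb'b, hb'S⟩ := Finset.mem_erase.1 hb'
  have hD := hor b' hb'S hb'b
  have hbeyond := hh.notMem_beyond ha (hS b hb).1 (hS b' hb'S).1 (hS b hb).2 (hS b' hb'S).2 hD
  have htri : ∀ s ∈ S, ∀ t ∈ S, ∀ u ∈ S, ∀ l, ω l ∉ openTriangle (ω s) (ω t) (ω u) := by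
    intro s hs t ht u hu
    have e1 := (hS s hs).2
    have e2 := (hS t ht).2
    have e3 := (hS u hu).2
    exact hh.notMem_openTriangle (hS s hs).1 (hS t ht).1 (hS u hu).1 (by tauto) (by tauto)
  set Q := (S.erase b).erase b' with hQ
  have hQmem : ∀ s, s ∈ Q ↔ s ≠ b' ∧ s ≠ b ∧ s ∈ S := fun s => by simp [hQ]
  -- Every other vertex lies in the angle `b a b'`, and it cannot lie beyond `b b'` because that
  -- region is empty.
  have hQtri : ∀ s ∈ Q, ω s ∈ openTriangle (ω a) (ω b) (ω b') := by
    intro s hs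
    obtain ⟨h1, h2, h3⟩ := (hQmem s).1 hs
    have e1 := hor s h3 h2
    have e2 := hlast s (Finset.mem_erase.2 ⟨h2, h3⟩) h1
    refine ⟨e1, ?_, by rw [orient_swap]; linarith⟩
    by_contra hcon
    have e3 : orient (ω b) (ω b') (ω s) ≠ 0 := hω.2 _ _ _ hb'b.symm h2.symm h1.symm
    exact hbeyond s ⟨e1, e2, lt_of_le_of_ne (not_lt.1 hcon) e3⟩
  rcases Q.eq_empty_or_nonempty with hQ0 | hQ0
  · refine ⟨1, fun _ => b', fun i j _ => Subsingleton.elim (α := Fin 1) i j, fun _ => ⟨hb'S, hb'b⟩,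
      hD, hbeyond, ?_⟩
    intro s hs hsb hsr
    have : s ∈ Q := (hQmem s).2 ⟨fun h => hsr ⟨(0 : Fin 1), h.symm⟩, hsb, hs⟩
    rw [hQ0] at this
    simp at this
  obtain ⟨v, hv, hvmax⟩ := Finset.exists_max_image Q (fun s => orient (ω b) (ω b') (ω s)) hQ0
  obtain ⟨hvb', hvb, hvS⟩ := (hQmem v).1 hv
  rcases (Q.erase v).eq_empty_or_nonempty with hQ1 | hQ1
  · refine ⟨2, ![b', v], ?_, ?_, hQtri v hv, ?_, ?_⟩
    · intro i j hij
      change Fin 2 at i j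
      fin_cases i <;> fin_cases j <;> simp_all [eq_comm]
    · intro i
      change Fin 2 at i
      fin_cases i
      · exact ⟨hb'S, hb'b⟩
      · exact ⟨hvS, hvb⟩
    · rintro l (hl | hl)
      · exact hbeyond l hl
      · exact htri b hb b' hb'S v hvS l hl
    · intro s hs hsb hsr
      have : s ∈ Q.erase v := Finset.mem_erase.2 ⟨fun h => hsr ⟨(1 : Fin 2), h.symm⟩,
        (hQmem s).2 ⟨fun h => hsr ⟨(0 : Fin 2), h.symm⟩, hsb, hs⟩⟩
      rw [hQ1] at this
      simp at this
  obtain ⟨w, hw, hwmax⟩ := Finset.exists_max_image (Q.erase v)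
    (fun s => max (orient (ω b) (ω v) (ω s)) (orient (ω v) (ω b') (ω s))) hQ1
  obtain ⟨hwv, hwQ⟩ := Finset.mem_erase.1 hw
  obtain ⟨hwb', hwb, hwS⟩ := (hQmem w).1 hwQ
  -- A vertex on the inner side of both `b v` and `v b'` would lie in the triangle `b b' v`, which
  -- is empty.
  have hside : ∀ s ∈ Q.erase v, 0 < orient (ω b) (ω v) (ω s) ∨ 0 < orient (ω v) (ω b') (ω s) := by
    intro s hs
    obtain ⟨hsv, hsQ⟩ := Finset.mem_erase.1 hs
    obtain ⟨hsb', hsb, hsS⟩ := (hQmem s).1 hsQ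
    by_contra hcon
    push Not at hcon
    have e1 : orient (ω b) (ω v) (ω s) ≠ 0 := hω.2 _ _ _ hvb.symm hsb.symm hsv.symm
    have e2 : orient (ω v) (ω b') (ω s) ≠ 0 := hω.2 _ _ _ hvb' hsv.symm hsb'.symm
    refine htri b hb b' hb'S v hvS s ⟨(hQtri s hsQ).2.1, ?_, ?_⟩
    · rw [orient_swap]
      exact neg_pos.2 (lt_of_le_of_ne hcon.2 e2)
    · rw [orient_swap]
      exact neg_pos.2 (lt_of_le_of_ne hcon.1 e1)
  refine ⟨3, ![b', v, w], ?_, ?_, ⟨hQtri v hv, hQtri w hwQ, hvmax w hwQ, hside w hw⟩, ?_, ?_⟩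
  · intro i j hij
    change Fin 3 at i j
    fin_cases i <;> fin_cases j <;> simp_all [eq_comm]
  · intro i
    change Fin 3 at i
    fin_cases i
    · exact ⟨hb'S, hb'b⟩
    · exact ⟨hvS, hvb⟩
    · exact ⟨hwS, hwb⟩
  · rintro l ((hl | hl) | (hl | hl))
    · exact hbeyond l hl
    · exact htri b hb b' hb'S v hvS l hl
    · exact htri b hb v hvS w hwS l hl
    · exact htri v hvS b' hb'S w hwS l hl
  · intro s hs hsb hsr
    have hsQ : s ∈ Q := (hQmem s).2 ⟨fun h => hsr ⟨(0 : Fin 3), h.symm⟩, hsb, hs⟩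
    have hsv : s ∈ Q.erase v := Finset.mem_erase.2 ⟨fun h => hsr ⟨(1 : Fin 3), h.symm⟩, hsQ⟩
    have h1 := hwmax s hsv
    have h2 := hvmax s hsQ
    have h3 := hQtri s hsQ
    rcases hside s hsv with h | h
    · exact Or.inl ⟨h3.1.le, h.le, h2, (le_max_left _ _).trans h1⟩
    · exact Or.inr ⟨h3.2.2.le, h.le, h2, (le_max_right _ _).trans h1⟩

/-- A projective polygon whose vertices lie on both sides of a line has an edge `a b` crossing the
line at infinity. -/
theorem exists_tangent (hω : GeneralPosition ω) {A B : Finset (Fin n)} (hA : A.Nonempty)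
    (hB : B.Nonempty) {f : (Fin 3 → ℝ) →ₗ[ℝ] ℝ} (hfA : ∀ j ∈ A, 0 < f (homCoord (ω j)))
    (hfB : ∀ j ∈ B, f (homCoord (ω j)) < 0) : ∃ a ∈ A, ∃ b ∈ B,
      (∀ s ∈ B, s ≠ b → 0 < orient (ω a) (ω b) (ω s)) ∧
      ∀ s ∈ A, s ≠ a → 0 < orient (ω b) (ω a) (ω s) := by
  set α := f ![1, 0, 0] with hα
  set β := f ![0, 1, 0] with hβ
  have hf : ∀ p q : Plane, f (homCoord p) - f (homCoord q) = α * (p 0 - q 0) + β * (p 1 - q 1) := by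
    intro p q
    rw [← map_sub]
    have : homCoord p - homCoord q = (p 0 - q 0) • ![1, 0, 0] + (p 1 - q 1) • ![0, 1, 0] := by
      ext i; fin_cases i <;> simp [homCoord]
    rw [this, map_add, map_smul, map_smul, smul_eq_mul, smul_eq_mul]
    ring
  -- Up to scale and translation, `f` and `g` are orthogonal coordinates, and `m` is the slope of
  -- the line through a point of `A` and a point of `B`. The minimal slope is attained on an inner
  -- common tangent.
  let g : Plane → ℝ := fun p => -β * p 0 + α * p 1
  let m : Fin n × Fin n → ℝ := fun x =>
    (g (ω x.1) - g (ω x.2)) / (f (homCoord (ω x.1)) - f (homCoord (ω x.2)))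
  obtain ⟨⟨a, b⟩, hab, hmin⟩ := Finset.exists_min_image (A ×ˢ B) m (hA.product hB)
  obtain ⟨ha, hb⟩ := Finset.mem_product.1 hab
  simp only at ha hb
  have hpos : ∀ s ∈ A, ∀ t ∈ B, 0 < f (homCoord (ω s)) - f (homCoord (ω t)) := by
    intro s hs t ht
    have := hfA s hs
    have := hfB t ht
    linarith
  have hN : 0 < α ^ 2 + β ^ 2 := by
    by_contra hcon
    have e0 : α = 0 := by nlinarith [sq_nonneg α, sq_nonneg β]
    have e1 : β = 0 := by nlinarith [sq_nonneg α, sq_nonneg β]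
    have := hpos a ha b hb
    rw [hf, e0, e1] at this
    simp at this
  have hneq : ∀ s ∈ A, ∀ t ∈ B, s ≠ t := by
    rintro s hs t ht rfl
    have := hpos s hs s ht
    linarith
  refine ⟨a, ha, b, hb, fun s hs hsb => ?_, fun s hs hsa => ?_⟩
  · have h1 := hmin (a, s) (Finset.mem_product.2 ⟨ha, hs⟩)
    simp only [m] at h1
    rw [div_le_div_iff₀ (hpos a ha b hb) (hpos a ha s hs), hf, hf] at h1
    have h2 : 0 ≤ (α ^ 2 + β ^ 2) * orient (ω a) (ω b) (ω s) := by
      simp only [g, orient] at h1 ⊢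
      linarith
    have h3 : 0 ≤ orient (ω a) (ω b) (ω s) := nonneg_of_mul_nonneg_right h2 hN
    exact lt_of_le_of_ne h3 (hω.2 _ _ _ (hneq a ha b hb) (hneq a ha s hs) hsb.symm).symm
  · have h1 := hmin (s, b) (Finset.mem_product.2 ⟨hs, hb⟩)
    simp only [m] at h1
    rw [div_le_div_iff₀ (hpos a ha b hb) (hpos s hs b hb), hf, hf] at h1
    have h2 : 0 ≤ (α ^ 2 + β ^ 2) * orient (ω b) (ω a) (ω s) := by
      simp only [g, orient] at h1 ⊢
      linarith
    have h3 : 0 ≤ orient (ω b) (ω a) (ω s) := nonneg_of_mul_nonneg_right h2 hN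
    exact lt_of_le_of_ne h3 (hω.2 _ _ _ (hneq a ha b hb).symm (hneq s hs b hb).symm hsa.symm).symm

end

/-- The points of a polygon that are used to count: the endpoints `z (inl 0)` and `z (inl 1)` of an
edge crossing the line at infinity, and up to three further vertices on each side of that line. -/
abbrev EdgeConfig (τ σ : ℕ) : Type := Fin 2 ⊕ (Fin τ ⊕ Fin σ) → Plane

section
variable {τ σ : ℕ}

def SidesGood (z : EdgeConfig τ σ) : Prop :=
  SideGood τ (z (.inl 0)) (z (.inl 1)) (fun i => z (.inr (.inl i))) ∧
    SideGood σ (z (.inl 1)) (z (.inl 0)) (fun i => z (.inr (.inr i)))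

def sidesEmpty (z : EdgeConfig τ σ) : Set Plane :=
  sideEmpty τ (z (.inl 0)) (z (.inl 1)) (fun i => z (.inr (.inl i))) ∪
    sideEmpty σ (z (.inl 1)) (z (.inl 0)) (fun i => z (.inr (.inr i)))

def sidesRest (z : EdgeConfig τ σ) : Set Plane :=
  sideRest τ (z (.inl 0)) (z (.inl 1)) (fun i => z (.inr (.inl i))) ∪
    sideRest σ (z (.inl 1)) (z (.inl 0)) (fun i => z (.inr (.inr i)))

/-- The number of ways in which a further point at `y` can be added to a polygon. -/
noncomputable def restWeight (z : EdgeConfig τ σ) (y : Plane) : ENNReal :=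
  (sidesEmpty z)ᶜ.indicator (fun y => 1 + (sidesRest z).indicator 1 y) y

end

section
variable {n : ℕ} {ω : Fin n → Plane}

/-- The polygon with vertices `J`, of which those in `B` are seen through infinity, is described by
the configuration `e`. -/
structure IsDescribedBy {τ σ : ℕ} (ω : Fin n → Plane) (p : Finset (Fin n) × Finset (Fin n))
    (e : Fin 2 ⊕ (Fin τ ⊕ Fin σ) ↪ Fin n) : Prop where
  subset : ∀ i, e i ∈ p.1
  mem_iff : ∀ j, j ∈ p.2 ↔ j ∈ p.1 ∧
    (j = e (.inl 1) ∨ 0 < orient (ω (e (.inl 0))) (ω (e (.inl 1))) (ω j))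
  good : SidesGood (ω ∘ e)
  empty : ∀ l, ω l ∉ sidesEmpty (ω ∘ e)
  rest : ∀ j ∈ p.1, j ∉ Set.range e → ω j ∈ sidesRest (ω ∘ e)

/-- The tangent edge `a b` is treated from both ends: `exists_side` is applied to the negative
vertices seen from `a` and to the positive ones seen from `b`. -/
theorem exists_isDescribedBy (hω : GeneralPosition ω) {p : Finset (Fin n) × Finset (Fin n)}
    (hp : IsNormalized p) (hh : IsSignedHole ω p.1 p.2) (hB : p.2.Nonempty) :
    ∃ τ σ : Fin 4, ∃ e : Fin 2 ⊕ (Fin τ ⊕ Fin σ) ↪ Fin n, IsDescribedBy ω p e := by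
  obtain ⟨J, B⟩ := p
  simp only at hh hB
  have hBJ : B ⊆ J := hp.1
  obtain ⟨f, hf⟩ := hh.1
  -- By normalization the least index of `J` is not in `B`.
  have hA : (J \ B).Nonempty := by
    obtain ⟨b, hb⟩ := hB
    obtain ⟨a, -, -⟩ := hp.2.2 b hb
    have hJ : J.Nonempty := ⟨b, hBJ hb⟩
    refine ⟨J.min' hJ, Finset.mem_sdiff.2 ⟨Finset.min'_mem _ _, fun h => ?_⟩⟩
    obtain ⟨a, ha, hlt⟩ := hp.2.2 _ h
    exact absurd (Finset.min'_le J a ha) (not_le.2 hlt)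
  obtain ⟨a, ha, b, hb, hsB, hsA⟩ := exists_tangent hω (f := f) hA hB
    (fun j hj => by
      obtain ⟨h1, h2⟩ := Finset.mem_sdiff.1 hj
      simpa [signedCoord, h2] using hf j h1)
    (fun j hj => by simpa [signedCoord, hj] using hf j (hBJ hj))
  obtain ⟨haJ, haB⟩ := Finset.mem_sdiff.1 ha
  obtain ⟨τ, eB, heB, hmB, hgB, hEB, hRB⟩ := exists_side hω hh haJ (b := b) (S := B)
    (fun s hs => ⟨hBJ hs, by tauto⟩) hb hsB
  obtain ⟨σ, eA, heA, hmA, hgA, hEA, hRA⟩ := exists_side hω hh (hBJ hb) (b := a) (S := J \ B)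
    (fun s hs => by have := Finset.mem_sdiff.1 hs; tauto) ha hsA
  have hmA' : ∀ i, (eA i ∈ J ∧ eA i ∉ B) ∧ eA i ≠ a := fun i => by simpa using hmA i
  have hab : a ≠ b := by rintro rfl; exact haB hb
  have hinj : Function.Injective (Sum.elim ![a, b] (Sum.elim eB eA)) := by
    refine Function.Injective.sumElim ?_ (heB.sumElim heA ?_) ?_
    · intro i j hij
      fin_cases i <;> fin_cases j <;> simp_all [eq_comm]
    · intro i j hij
      exact (hmA' j).1.2 (hij ▸ (hmB i).1)
    · rintro i (j | j) hij
      · fin_cases i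
        · exact haB ((show a = eB j from hij) ▸ (hmB j).1)
        · exact (hmB j).2 (show b = eB j from hij).symm
      · fin_cases i
        · exact (hmA' j).2 (show a = eA j from hij).symm
        · exact (hmA' j).1.2 ((show b = eA j from hij) ▸ hb)
  refine ⟨τ, σ, ⟨_, hinj⟩, ?_, fun j => ?_, ⟨hgB, hgA⟩, fun l => ?_, fun j hj hjr => ?_⟩
  · rintro (i | i | i)
    · fin_cases i
      · exact haJ
      · exact hBJ hb
    · exact hBJ (hmB i).1
    · exact (hmA' i).1.1
  · change j ∈ B ↔ j ∈ J ∧ (j = b ∨ 0 < orient (ω a) (ω b) (ω j))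
    constructor
    · intro hj
      refine ⟨hBJ hj, ?_⟩
      by_cases hjb : j = b
      · exact Or.inl hjb
      · exact Or.inr (hsB j hj hjb)
    · rintro ⟨hj, rfl | h⟩
      · exact hb
      · by_contra hjB
        by_cases hja : j = a
        · subst hja
          simp [orient] at h
        · have h1 := hsA j (Finset.mem_sdiff.2 ⟨hj, hjB⟩) hja
          rw [orient_swap] at h1
          linarith
  · rintro (h | h)
    · exact hEB l h
    · exact hEA l h
  · have hja : j ≠ a := fun h => hjr ⟨.inl 0, h.symm⟩
    have hjb : j ≠ b := fun h => hjr ⟨.inl 1, h.symm⟩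
    by_cases hjB : j ∈ B
    · refine Or.inl (hRB j hjB hjb ?_)
      rintro ⟨i, rfl⟩
      exact hjr ⟨.inr (.inl i), rfl⟩
    · refine Or.inr (hRA j (Finset.mem_sdiff.2 ⟨hj, hjB⟩) hja ?_)
      rintro ⟨i, rfl⟩
      exact hjr ⟨.inr (.inr i), rfl⟩

open Classical in
-- Given `e`, the vertex set is determined by its unlisted members, all of which lie in `sidesRest`,
-- and the sign set is then determined by `mem_iff`. This leaves at most `2 ^ T.card` pairs, which
-- is the product of the weights, since no point lies in `sidesEmpty`.
theorem card_isDescribedBy_le {τ σ : ℕ} (ω : Fin n → Plane)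
    (e : Fin 2 ⊕ (Fin τ ⊕ Fin σ) ↪ Fin n) :
    ((Finset.univ.filter fun p => IsDescribedBy ω p e).card : ENNReal) ≤
      {z : EdgeConfig τ σ | SidesGood z}.indicator 1 (ω ∘ e) *
        ∏ j ∈ Finset.univ.filter (fun j => j ∉ Set.range e), restWeight (ω ∘ e) (ω j) := by
  rcases (Finset.univ.filter fun p => IsDescribedBy ω p e).eq_empty_or_nonempty with h0 | ⟨p, hp⟩
  · rw [h0]
    simp
  have hp := (Finset.mem_filter.1 hp).2
  rw [Set.indicator_of_mem (show ω ∘ e ∈ {z : EdgeConfig τ σ | SidesGood z} from hp.good),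
    Pi.one_apply, one_mul]
  set T := (Finset.univ.filter (fun j => j ∉ Set.range e)).filter
    (fun j => ω j ∈ sidesRest (ω ∘ e)) with hT
  have hprod : ∏ j ∈ Finset.univ.filter (fun j => j ∉ Set.range e), restWeight (ω ∘ e) (ω j) =
      2 ^ T.card := by
    rw [← Finset.prod_const, hT, Finset.prod_filter _ (s := Finset.univ.filter (fun j => j ∉ Set.range e))]
    refine Finset.prod_congr rfl fun j _ => ?_
    rw [restWeight, Set.indicator_of_mem (hp.empty j)]
    by_cases hj : ω j ∈ sidesRest (ω ∘ e)
    · rw [if_pos hj, Set.indicator_of_mem hj, Pi.one_apply, one_add_one_eq_two]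
    · rw [if_neg hj, Set.indicator_of_notMem hj, add_zero]
  rw [hprod]
  have hcard : (Finset.univ.filter fun p => IsDescribedBy ω p e).card ≤ T.powerset.card := by
    refine Finset.card_le_card_of_injOn (fun p => p.1.filter fun j => j ∉ Set.range e) ?_ ?_
    · intro q hq
      have hq := (Finset.mem_filter.1 hq).2
      refine Finset.mem_powerset.2 fun j hj => ?_
      obtain ⟨h1, h2⟩ := Finset.mem_filter.1 hj
      exact Finset.mem_filter.2 ⟨Finset.mem_filter.2 ⟨Finset.mem_univ _, h2⟩, hq.rest j h1 h2⟩
    · intro q hq r hr hqr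
      have hq := (Finset.mem_filter.1 hq).2
      have hr := (Finset.mem_filter.1 hr).2
      have h1 : q.1 = r.1 := by
        ext j
        by_cases hj : j ∈ Set.range e
        · obtain ⟨i, rfl⟩ := hj
          exact iff_of_true (hq.subset i) (hr.subset i)
        · have := Finset.ext_iff.1 hqr j
          simpa only [Finset.mem_filter, hj, not_false_eq_true, and_true] using this
      refine Prod.ext h1 ?_
      ext j
      rw [hq.mem_iff, hr.mem_iff, h1]
  rw [Finset.card_powerset] at hcard
  exact_mod_cast hcard

open Classical in
theorem card_nonaffine_le (hω : GeneralPosition ω) :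
    ((Finset.univ.filter fun p : Finset (Fin n) × Finset (Fin n) =>
      IsNormalized p ∧ IsSignedHole ω p.1 p.2 ∧ p.2.Nonempty).card : ENNReal) ≤
    ∑ τ : Fin 4, ∑ σ : Fin 4, ∑ e : Fin 2 ⊕ (Fin τ ⊕ Fin σ) ↪ Fin n,
      {z : EdgeConfig τ σ | SidesGood z}.indicator 1 (ω ∘ e) *
        ∏ j ∈ Finset.univ.filter (fun j => j ∉ Set.range e), restWeight (ω ∘ e) (ω j) := by
  calc _ ≤ (((Finset.univ : Finset (Fin 4)).biUnion fun τ => Finset.univ.biUnion fun σ : Fin 4 =>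
        Finset.univ.biUnion fun e : Fin 2 ⊕ (Fin τ ⊕ Fin σ) ↪ Fin n =>
          Finset.univ.filter fun p => IsDescribedBy ω p e).card : ENNReal) := by
        refine Nat.cast_le.2 (Finset.card_le_card fun p hp => ?_)
        obtain ⟨-, h1, h2, h3⟩ := Finset.mem_filter.1 hp
        obtain ⟨τ, σ, e, he⟩ := exists_isDescribedBy hω h1 h2 h3
        simp only [Finset.mem_biUnion, Finset.mem_univ, true_and, Finset.mem_filter]
        exact ⟨τ, σ, e, he⟩
    _ ≤ ∑ τ : Fin 4, ∑ σ : Fin 4, ∑ e : Fin 2 ⊕ (Fin τ ⊕ Fin σ) ↪ Fin n,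
          ((Finset.univ.filter fun p => IsDescribedBy ω p e).card : ENNReal) := by
        refine le_trans (Nat.cast_le.2 (Finset.card_biUnion_le.trans (Finset.sum_le_sum fun τ _ =>
          Finset.card_biUnion_le.trans (Finset.sum_le_sum fun σ _ => Finset.card_biUnion_le)))) ?_
        push_cast
        exact le_rfl
    _ ≤ _ := Finset.sum_le_sum fun τ _ => Finset.sum_le_sum fun σ _ =>
        Finset.sum_le_sum fun e _ => card_isDescribedBy_le ω e

end

/-! ### Half strips and areas of the remaining regions -/

section
open MeasureTheory

/-- The half-infinite strip over the segment `p q` in direction `c - p`. -/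
def halfStrip (p q c : Plane) : Set Plane :=
  {x | 0 ≤ orient p q x ∧ 0 ≤ orient c p x ∧ orient c p x ≤ orient p q c}

theorem continuous_orient_right (p q : Plane) : Continuous fun x => orient p q x :=
  continuous_orient continuous_const continuous_const continuous_id

theorem isClosed_halfStrip (p q c : Plane) : IsClosed (halfStrip p q c) :=
  (isClosed_le continuous_const (continuous_orient_right _ _)).inter
    ((isClosed_le continuous_const (continuous_orient_right _ _)).inter
      (isClosed_le (continuous_orient_right _ _) continuous_const))

theorem openTriangle_subset_halfStrip (p q c : Plane) : openTriangle p q c ⊆ halfStrip p q c := by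
  rintro x ⟨h1, h2, h3⟩
  have : orient p q c = orient p q x + orient q c x + orient c p x := by unfold orient; ring
  exact ⟨h1.le, h3.le, by linarith⟩

/-- In the frame with axes `q - p` and `c - p` the half strip is `[0, 1] × [0, ∞)`, and `orient p q`
is proportional to the second coordinate. -/
theorem setLIntegral_halfStrip {p q c : Plane} (h : 0 < orient p q c) {f : ℝ → ENNReal}
    (hf : Measurable f) : ∫⁻ x in halfStrip p q c, f (orient p q x) =
      ENNReal.ofReal (orient p q c) * ∫⁻ t in Set.Ici (0 : ℝ), f (t * orient p q c) := by
  rw [← lintegral_indicator (isClosed_halfStrip p q c).measurableSet, lintegral_frame_orient p q c h]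
  congr 1
  have : ∀ x : ℝ × ℝ, (halfStrip p q c).indicator (fun x => f (orient p q x))
      (p + x.1 • (q - p) + x.2 • (c - p)) =
      (Set.Icc (0 : ℝ) 1).indicator 1 x.1 *
        (Set.Ici (0 : ℝ)).indicator (fun t => f (t * orient p q c)) x.2 := by
    intro x
    obtain ⟨e1, e2, e3⟩ := orient_frame p q c x.1 x.2
    have hmem : p + x.1 • (q - p) + x.2 • (c - p) ∈ halfStrip p q c ↔
        x.1 ∈ Set.Icc (0 : ℝ) 1 ∧ x.2 ∈ Set.Ici (0 : ℝ) := by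
      simp only [halfStrip, Set.mem_ofPred_eq, e1, e3, Set.mem_Icc, Set.mem_Ici]
      rw [mul_nonneg_iff_of_pos_right h, mul_nonneg_iff_of_pos_right h, mul_le_iff_le_one_left h]
      tauto
    by_cases h1 : x.1 ∈ Set.Icc (0 : ℝ) 1
    · by_cases h2 : x.2 ∈ Set.Ici (0 : ℝ)
      · rw [Set.indicator_of_mem (hmem.2 ⟨h1, h2⟩), Set.indicator_of_mem h1,
          Set.indicator_of_mem h2, Pi.one_apply, one_mul, e1]
      · rw [Set.indicator_of_notMem (fun h' => h2 (hmem.1 h').2), Set.indicator_of_notMem h2,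
          mul_zero]
    · rw [Set.indicator_of_notMem (fun h' => h1 (hmem.1 h').1), Set.indicator_of_notMem h1, zero_mul]
  rw [lintegral_congr this, Measure.volume_eq_prod, lintegral_prod_mul
    (g := (Set.Ici (0 : ℝ)).indicator fun t => f (t * orient p q c))
    (measurable_one.indicator measurableSet_Icc).aemeasurable
    ((hf.comp (measurable_id.mul_const _)).indicator measurableSet_Ici).aemeasurable,
    lintegral_indicator_one measurableSet_Icc, lintegral_indicator measurableSet_Ici]
  simp

/-- The Jacobian cancels against the growth of `orient p q`, so the value depends neither on the
base nor on the direction of the strip. This is how a vertex contributes `1 / κ` uniformly. -/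
theorem setLIntegral_halfStrip_exp {p q c : Plane} (h : 0 < orient p q c) {κ : ℝ} (hκ : 0 < κ) :
    ∫⁻ x in halfStrip p q c, ENNReal.ofReal (Real.exp (-(κ * orient p q x))) =
      ENNReal.ofReal (1 / κ) := by
  rw [setLIntegral_halfStrip h (f := fun t => ENNReal.ofReal (Real.exp (-(κ * t)))) (by fun_prop),
    ← restrict_Ioi_eq_restrict_Ici]
  have := lintegral_exp_neg_mul_Ioi (mul_pos hκ h)
  rw [show (fun t => ENNReal.ofReal (Real.exp (-(κ * (t * orient p q c))))) =
    fun t => ENNReal.ofReal (Real.exp (-(κ * orient p q c * t))) by ext t; congr 3; ring, this,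
    ← ENNReal.ofReal_mul h.le]
  congr 1
  field_simp

theorem volume_strip {p q c : Plane} (h : 0 < orient p q c) (e : ℝ) :
    volume (halfStrip p q c ∩ {x | orient p q x ≤ e}) = ENNReal.ofReal e := by
  have hm : MeasurableSet {x | orient p q x ≤ e} :=
    (isClosed_le (continuous_orient_right _ _) continuous_const).measurableSet
  rw [Set.inter_comm, ← Measure.restrict_apply hm, ← lintegral_indicator_one hm]
  have h1 := setLIntegral_halfStrip h (f := (Set.Iic e).indicator 1)
    (measurable_one.indicator measurableSet_Iic)
  refine (lintegral_congr fun x => ?_).trans (h1.trans ?_)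
  · simp [Set.indicator]
  · have : (fun t => (Set.Iic e).indicator (1 : ℝ → ENNReal) (t * orient p q c)) =
        (Set.Iic (e / orient p q c)).indicator 1 := by
      ext t
      simp only [Set.indicator, Set.mem_Iic, le_div_iff₀ h]
      rfl
    rw [this, lintegral_indicator_one measurableSet_Iic, Measure.restrict_apply measurableSet_Iic,
      Set.inter_comm, Set.Ici_inter_Iic, Real.volume_Icc, sub_zero, ← ENNReal.ofReal_mul h.le]
    congr 1
    field_simp

theorem isOpen_beyond (a b b' : Plane) : IsOpen (beyond a b b') :=
  (isOpen_lt continuous_const (continuous_orient_right _ _)).and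
    ((isOpen_lt (continuous_orient_right _ _) continuous_const).and
      (isOpen_lt (continuous_orient_right _ _) continuous_const))

theorem isClosed_restLeft (a b b' v : Plane) (e : ℝ) : IsClosed (restLeft a b b' v e) :=
  (isClosed_le continuous_const (continuous_orient_right _ _)).inter
    ((isClosed_le continuous_const (continuous_orient_right _ _)).inter
      ((isClosed_le (continuous_orient_right _ _) continuous_const).inter
        (isClosed_le (continuous_orient_right _ _) continuous_const)))

theorem isClosed_restRight (a b b' v : Plane) (e : ℝ) : IsClosed (restRight a b b' v e) :=
  (isClosed_le continuous_const (continuous_orient_right _ _)).inter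
    ((isClosed_le continuous_const (continuous_orient_right _ _)).inter
      ((isClosed_le (continuous_orient_right _ _) continuous_const).inter
        (isClosed_le (continuous_orient_right _ _) continuous_const)))


theorem orient_pos_of_mem_openTriangle {a b b' v : Plane} (hv : v ∈ openTriangle a b b') :
    0 < orient a b b' := by
  obtain ⟨h1, h2, h3⟩ := hv
  have : orient a b b' = orient a b v + orient b b' v + orient b' a v := by unfold orient; ring
  rw [this]; positivity

/-- On the outer side of `b v`, the distance to `b b'` relative to the distance to `a b` is at least
what it is at `v`. Being no further from `b b'` than `v` therefore implies being no further from `a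
b`. -/
theorem orient_le_of_mem_restLeft {a b b' v x : Plane} {e : ℝ} (hv : v ∈ openTriangle a b b')
    (hx : x ∈ restLeft a b b' v e) : 0 ≤ orient b b' x ∧ orient a b x ≤ orient a b v := by
  have hD := orient_pos_of_mem_openTriangle hv
  obtain ⟨h1, h2, h3⟩ := hv
  obtain ⟨g1, g2, g3, -⟩ := hx
  have e1 : orient a b b' * orient b v x =
      orient a b v * orient b b' x - orient b b' v * orient a b x := by unfold orient; ring
  have e2 : 0 ≤ orient a b v * orient b b' x - orient b b' v * orient a b x := by
    rw [← e1]; positivity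
  have e3 := mul_nonneg h2.le g1
  constructor
  · exact nonneg_of_mul_nonneg_right (a := orient a b v) (by linarith) h1
  · have := mul_le_mul_of_nonneg_left g3 h1.le
    exact le_of_mul_le_mul_left (a := orient b b' v) (by linarith) h2

theorem orient_le_of_mem_restRight {a b b' v x : Plane} {e : ℝ} (hv : v ∈ openTriangle a b b')
    (hx : x ∈ restRight a b b' v e) : 0 ≤ orient b b' x ∧ orient b' a x ≤ orient b' a v := by
  have hD := orient_pos_of_mem_openTriangle hv
  obtain ⟨h1, h2, h3⟩ := hv
  obtain ⟨g1, g2, g3, -⟩ := hx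
  have e1 : orient a b b' * orient v b' x =
      orient b' a v * orient b b' x - orient b b' v * orient b' a x := by unfold orient; ring
  have e2 : 0 ≤ orient b' a v * orient b b' x - orient b b' v * orient b' a x := by
    rw [← e1]; positivity
  have e3 := mul_nonneg h2.le g1
  constructor
  · exact nonneg_of_mul_nonneg_right (a := orient b' a v) (by linarith) h3
  · have := mul_le_mul_of_nonneg_left g3 h3.le
    exact le_of_mul_le_mul_left (a := orient b b' v) (by linarith) h2

theorem restLeft_subset {a b b' v : Plane} {e : ℝ} (hv : v ∈ openTriangle a b b') :
    restLeft a b b' v e ⊆ halfStrip b v a ∩ {x | orient b v x ≤ e} := by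
  intro x hx
  obtain ⟨-, h⟩ := orient_le_of_mem_restLeft hv hx
  obtain ⟨g1, g2, g3, g4⟩ := hx
  refine ⟨⟨g2, g1, ?_⟩, g4⟩
  have : orient b v a = orient a b v := by unfold orient; ring
  rwa [this]

/-- The point `v + a - b'` is chosen so that the half strip over `v b'` has its sides parallel to
`b' a`. -/
theorem orient_add_sub (a b' v x : Plane) :
    orient (v + a - b') v x = orient b' a v - orient b' a x := by
  simp [orient]; ring

theorem orient_add_sub' (a b' v : Plane) : orient v b' (v + a - b') = orient b' a v := by
  simp [orient]; ring

theorem restRight_subset {a b b' v : Plane} {e : ℝ} (hv : v ∈ openTriangle a b b') :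
    restRight a b b' v e ⊆ halfStrip v b' (v + a - b') ∩ {x | orient v b' x ≤ e} := by
  intro x hx
  obtain ⟨-, h⟩ := orient_le_of_mem_restRight hv hx
  obtain ⟨g1, g2, g3, g4⟩ := hx
  refine ⟨⟨g2, ?_, ?_⟩, g4⟩
  · rw [orient_add_sub]; linarith
  · rw [orient_add_sub, orient_add_sub']; linarith

theorem volume_restLeft_le {a b b' v : Plane} {e : ℝ} (hv : v ∈ openTriangle a b b') :
    volume (restLeft a b b' v e) ≤ ENNReal.ofReal e := by
  have h : 0 < orient b v a := by
    have : orient b v a = orient a b v := by unfold orient; ring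
    rw [this]; exact hv.1
  rw [← volume_strip h e]
  exact measure_mono (restLeft_subset hv)

theorem volume_restRight_le {a b b' v : Plane} {e : ℝ} (hv : v ∈ openTriangle a b b') :
    volume (restRight a b b' v e) ≤ ENNReal.ofReal e := by
  have h : 0 < orient v b' (v + a - b') := by
    rw [orient_add_sub']; exact hv.2.2
  rw [← volume_strip h e]
  exact measure_mono (restRight_subset hv)

/-- Both regions and the triangle `b b' v` lie in a strip over `b b'` of area `orient b b' v`. The
triangle is disjoint from the regions and takes half of this area. -/
theorem volume_rest_le {a b b' v : Plane} {e : ℝ} (hv : v ∈ openTriangle a b b') :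
    volume (restLeft a b b' v e ∪ restRight a b b' v e) ≤ ENNReal.ofReal (orient b b' v / 2) := by
  have hD := orient_pos_of_mem_openTriangle hv
  have hD' : 0 < orient b b' a := by
    have : orient b b' a = orient a b b' := by unfold orient; ring
    rwa [this]
  have hmeas := (isOpen_openTriangle b b' v).measurableSet
  have hdisj : Disjoint (restLeft a b b' v e ∪ restRight a b b' v e) (openTriangle b b' v) := by
    rw [Set.disjoint_left]
    rintro x (hx | hx) ⟨-, h2, h3⟩
    · have := hx.2.1
      rw [orient_swap] at h3
      linarith
    · have := hx.2.1
      rw [orient_swap] at h2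
      linarith
  have hsub : (restLeft a b b' v e ∪ restRight a b b' v e) ∪ openTriangle b b' v ⊆
      halfStrip b b' a ∩ {x | orient b b' x ≤ orient b b' v} := by
    have hsum : ∀ x, orient b b' a = orient a b x + orient b b' x + orient b' a x := by
      intro x; unfold orient; ring
    have hv' := hsum v
    obtain ⟨v1, v2, v3⟩ := hv
    rintro x ((hx | hx) | hx)
    · obtain ⟨h1, h2⟩ := orient_le_of_mem_restLeft ⟨v1, v2, v3⟩ hx
      exact ⟨⟨h1, hx.1, by linarith⟩, hx.2.2.1⟩
    · obtain ⟨h1, h2⟩ := orient_le_of_mem_restRight ⟨v1, v2, v3⟩ hx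
      obtain ⟨g1, g2, g3, -⟩ := hx
      have := hsum x
      exact ⟨⟨h1, by linarith, by linarith⟩, g3⟩
    · obtain ⟨h1, h2, h3⟩ := hx
      have ht : orient b b' v = orient b b' x + orient b' v x + orient v b x := by
        unfold orient; ring
      have e1 : orient b b' v * orient a b x =
          orient b b' x * orient a b v + orient v b x * orient a b b' := by unfold orient; ring
      have e2 : orient b b' v * orient b' a x =
          orient b b' x * orient b' a v + orient b' v x * orient a b b' := by unfold orient; ring
      have e3 : 0 ≤ orient a b x := nonneg_of_mul_nonneg_right (by rw [e1]; positivity) v2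
      have e4 : 0 ≤ orient b' a x := nonneg_of_mul_nonneg_right (by rw [e2]; positivity) v2
      have := hsum x
      exact ⟨⟨h1.le, e3, by linarith⟩, by simp only [Set.mem_ofPred_eq]; linarith⟩
  have h1 := measure_mono (μ := volume) hsub
  rw [measure_union hdisj hmeas, volume_strip hD', volume_openTriangle hv.2.1] at h1
  have h2 : ENNReal.ofReal (orient b b' v) =
      ENNReal.ofReal (orient b b' v / 2) + ENNReal.ofReal (orient b b' v / 2) := by
    have := hv.2.1
    rw [← ENNReal.ofReal_add (by linarith) (by linarith)]
    congr 1; ring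
  rw [h2] at h1
  exact (ENNReal.add_le_add_iff_right ENNReal.ofReal_ne_top).1 h1

theorem measurableSet_sideEmpty (τ : ℕ) (a b : Plane) (x : Fin τ → Plane) :
    MeasurableSet (sideEmpty τ a b x) := by
  have h1 := fun p q r => (isOpen_beyond p q r).measurableSet
  have h2 := fun p q r => (isOpen_openTriangle p q r).measurableSet
  match τ with
  | 0 => exact .empty
  | 1 => exact h1 _ _ _
  | 2 => exact (h1 _ _ _).union (h2 _ _ _)
  | 3 => exact ((h1 _ _ _).union (h2 _ _ _)).union ((h2 _ _ _).union (h2 _ _ _))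
  | _ + 4 => exact .empty

theorem measurableSet_sideRest (τ : ℕ) (a b : Plane) (x : Fin τ → Plane) :
    MeasurableSet (sideRest τ a b x) := by
  match τ with
  | 0 | 1 | 2 => exact .empty
  | 3 => exact MeasurableSet.union (isClosed_restLeft _ _ _ _ _).measurableSet
             (isClosed_restRight _ _ _ _ _).measurableSet
  | _ + 4 => exact .empty

/-- An affine function that is nonnegative at the vertices and positive at one of them is positive
inside the triangle, where all barycentric weights are positive. -/
theorem orient_pos_of_mem_openTriangle_of_le {p q a b c y : Plane} (hy : y ∈ openTriangle a b c)
    (ha : 0 ≤ orient p q a) (hb : 0 ≤ orient p q b) (hc : 0 < orient p q c) : 0 < orient p q y := by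
  have hD := orient_pos_of_mem_openTriangle hy
  obtain ⟨h1, h2, h3⟩ := hy
  have e : orient a b c * orient p q y = orient b c y * orient p q a + orient c a y * orient p q b +
      orient a b y * orient p q c := by unfold orient; ring
  exact pos_of_mul_pos_right (by rw [e]; positivity) hD.le

theorem orient_self_left (a b : Plane) : orient a b a = 0 := by simp [orient]

theorem orient_self_right (a b : Plane) : orient a b b = 0 := by simp [orient, mul_comm]

/-- This separates the empty regions of the two sides by the line `a b`, so that their areas add up.
-/
theorem sideEmpty_subset {τ : ℕ} {a b : Plane} {x : Fin τ → Plane} (hx : SideGood τ a b x) :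
    sideEmpty τ a b x ⊆ {y | 0 < orient a b y} := by
  have hb := (orient_self_right a b).ge
  match τ with
  | 0 => exact Set.empty_subset _
  | 1 => exact fun y hy => hy.1
  | 2 =>
    rintro y (hy | hy)
    · exact hy.1
    · exact orient_pos_of_mem_openTriangle_of_le hy hb (orient_pos_of_mem_openTriangle hx).le hx.1
  | 3 =>
    obtain ⟨h1, h2, h3, h4⟩ := hx
    have h0 := orient_pos_of_mem_openTriangle h1
    rintro y ((hy | hy) | (hy | hy))
    · exact hy.1
    · exact orient_pos_of_mem_openTriangle_of_le hy hb h0.le h1.1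
    · exact orient_pos_of_mem_openTriangle_of_le hy hb h1.1.le h2.1
    · exact orient_pos_of_mem_openTriangle_of_le hy h1.1.le h0.le h2.1
  | _ + 4 => exact Set.empty_subset _

end

/-! ### Comparison of the empty and the remaining regions -/

section
open MeasureTheory

theorem orient_div_two_le_measureReal {K : Set Plane} (hK : Convex ℝ K) {p q r : Plane} (hp : p ∈ K) (hq : q ∈ K)
    (hr : r ∈ K) : orient p q r / 2 ≤ (volume.restrict K).real (openTriangle p q r) := by
  rcases le_or_gt (orient p q r) 0 with h | h
  · exact (by linarith : orient p q r / 2 ≤ 0).trans measureReal_nonneg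
  · rw [Measure.real, Measure.restrict_eq_self _ (openTriangle_subset hK hp hq hr),
      volume_openTriangle h, ENNReal.toReal_ofReal (by linarith)]

variable {K : Set Plane} [IsProbabilityMeasure (volume.restrict K)] {a b : Plane}

theorem le_measureReal_sideEmpty_two (hK : Convex ℝ K) {x : Fin 2 → Plane} (hb : b ∈ K)
    (hx : ∀ i, x i ∈ K) :
    (volume.restrict K).real (beyond a b (x 0)) + orient b (x 0) (x 1) / 2 ≤
      (volume.restrict K).real (sideEmpty 2 a b x) := by
  have hd : Disjoint (beyond a b (x 0)) (openTriangle b (x 0) (x 1)) := by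
    rw [Set.disjoint_left]
    exact fun y h1 h2 => lt_asymm h1.2.2 h2.1
  change _ ≤ (volume.restrict K).real (_ ∪ _)
  rw [measureReal_union hd (isOpen_openTriangle _ _ _).measurableSet]
  have := orient_div_two_le_measureReal hK hb (hx 0) (hx 1)
  linarith

/-- The three pieces are disjoint: one lies past `b b'`, the triangle `b b' v` on the other side of
it, and the triangles at `w` outside `b v` or `v b'`. Of the last two, keeping the larger one
suffices. -/
theorem le_measureReal_sideEmpty_three (hK : Convex ℝ K) {x : Fin 3 → Plane} (hb : b ∈ K)
    (hx : ∀ i, x i ∈ K) (hg : SideGood 3 a b x) :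
    (volume.restrict K).real (beyond a b (x 0)) + orient b (x 0) (x 1) / 2 +
      max (orient b (x 1) (x 2)) (orient (x 1) (x 0) (x 2)) / 2 ≤
      (volume.restrict K).real (sideEmpty 3 a b x) := by
  obtain ⟨h1, h2, -, -⟩ := hg
  have hm := (isOpen_openTriangle b (x 1) (x 2)).measurableSet
  have hm' := (isOpen_openTriangle (x 1) (x 0) (x 2)).measurableSet
  have hs := orient_self_left b (x 0)
  have hs' := orient_self_right b (x 0)
  have hd : Disjoint (beyond a b (x 0) ∪ openTriangle b (x 0) (x 1))
      (openTriangle b (x 1) (x 2) ∪ openTriangle (x 1) (x 0) (x 2)) := by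
    rw [Set.disjoint_left]
    rintro y (hy | hy) (hz | hz)
    · exact lt_asymm hy.2.2
        (orient_pos_of_mem_openTriangle_of_le hz hs.ge h1.2.1.le h2.2.1)
    · exact lt_asymm hy.2.2
        (orient_pos_of_mem_openTriangle_of_le hz h1.2.1.le hs'.ge h2.2.1)
    · have e1 := hy.2.2
      have e2 := hz.1
      rw [orient_swap] at e1
      linarith
    · have e1 := hy.2.1
      have e2 := hz.1
      rw [orient_swap] at e1
      linarith
  have e := le_measureReal_sideEmpty_two (a := a) hK hb (x := ![x 0, x 1])
    (fun i => by fin_cases i <;> exact hx _)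
  change _ ≤ (volume.restrict K).real ((_ ∪ _) ∪ (_ ∪ _))
  rw [measureReal_union hd (hm.union hm')]
  have e1 := orient_div_two_le_measureReal hK hb (hx 1) (hx 2)
  have e2 := orient_div_two_le_measureReal hK (hx 1) (hx 0) (hx 2)
  have e3 : (volume.restrict K).real (openTriangle b (x 1) (x 2)) ≤ (volume.restrict K).real
    (openTriangle b (x 1) (x 2) ∪ openTriangle (x 1) (x 0) (x 2)) :=
    measureReal_mono Set.subset_union_left
  have e4 : (volume.restrict K).real (openTriangle (x 1) (x 0) (x 2)) ≤ (volume.restrict K).real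
    (openTriangle b (x 1) (x 2) ∪ openTriangle (x 1) (x 0) (x 2)) :=
    measureReal_mono Set.subset_union_right
  have e5 : (volume.restrict K).real (beyond a b (x 0)) + orient b (x 0) (x 1) / 2 ≤
    (volume.restrict K).real (beyond a b (x 0) ∪ openTriangle b (x 0) (x 1)) := e
  rcases max_choice (orient b (x 1) (x 2)) (orient (x 1) (x 0) (x 2)) with h | h <;> rw [h] <;>
    linarith

/-- For three vertices put `D = orient b (x 0) (x 1)` and let `e` be the maximum of the other two
orientations. The rest has area at most `2 * e`, from two strips, and at most `D / 2`, while the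
empty region has area at least `(D + e) / 2`. Weighting the two bounds by `1/5` and `4/5` gives
exactly `4/5 * (D + e) / 2`. A factor below 1 is what the argument needs. -/
theorem measureReal_sideRest_le (hK : Convex ℝ K) {τ : ℕ} {x : Fin τ → Plane} (hb : b ∈ K)
    (hx : ∀ i, x i ∈ K) (hg : SideGood τ a b x) :
    (volume.restrict K).real (sideRest τ a b x) ≤
      4 / 5 * (volume.restrict K).real (sideEmpty τ a b x) := by
  match τ with
  | 0 | 1 | 2 | _ + 4 =>
    change (volume.restrict K).real ∅ ≤ _
    rw [measureReal_empty]
    positivity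
  | 3 =>
    have h := le_measureReal_sideEmpty_three hK hb hx hg
    obtain ⟨h1, h2, -, h4⟩ := hg
    set e := max (orient b (x 1) (x 2)) (orient (x 1) (x 0) (x 2)) with he
    have he0 : 0 < e := lt_max_iff.2 h4
    have hD := h1.2.1
    have r1 : (volume.restrict K).real (sideRest 3 a b x) ≤ 2 * e := by
      refine ENNReal.toReal_le_of_le_ofReal (by positivity) ?_
      refine (Measure.restrict_apply_le _ _).trans ((measure_union_le _ _).trans ?_)
      refine (add_le_add (volume_restLeft_le h1) (volume_restRight_le h1)).trans ?_
      rw [← ENNReal.ofReal_add he0.le he0.le, two_mul]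
    have r2 : (volume.restrict K).real (sideRest 3 a b x) ≤ orient b (x 0) (x 1) / 2 :=
      ENNReal.toReal_le_of_le_ofReal (by positivity)
        ((Measure.restrict_apply_le _ _).trans (volume_rest_le h1))
    have := measureReal_nonneg (μ := volume.restrict K) (s := beyond a b (x 0))
    linarith

variable {τ σ : ℕ}

/-- The mean weight is at most `1 - |E| + |R|` with `|R| ≤ 4/5 * |E|`, and the empty regions of the
two sides are disjoint. -/
theorem lintegral_restWeight_le (hK : Convex ℝ K) {z : EdgeConfig τ σ} (hz : ∀ i, z i ∈ K)
    (hg : SidesGood z) : ∫⁻ y, restWeight z y ∂(volume.restrict K) ≤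
      ENNReal.ofReal (1 - ((volume.restrict K).real
        (sideEmpty τ (z (.inl 0)) (z (.inl 1)) (fun i => z (.inr (.inl i)))) +
        (volume.restrict K).real
        (sideEmpty σ (z (.inl 1)) (z (.inl 0)) (fun i => z (.inr (.inr i))))) / 5) := by
  set μ := volume.restrict K
  have m1 := measurableSet_sideEmpty τ (z (.inl 0)) (z (.inl 1)) (fun i => z (.inr (.inl i)))
  have m2 := measurableSet_sideEmpty σ (z (.inl 1)) (z (.inl 0)) (fun i => z (.inr (.inr i)))
  have m3 := measurableSet_sideRest τ (z (.inl 0)) (z (.inl 1)) (fun i => z (.inr (.inl i)))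
  have m4 := measurableSet_sideRest σ (z (.inl 1)) (z (.inl 0)) (fun i => z (.inr (.inr i)))
  have hd : Disjoint (sideEmpty τ (z (.inl 0)) (z (.inl 1)) (fun i => z (.inr (.inl i))))
      (sideEmpty σ (z (.inl 1)) (z (.inl 0)) (fun i => z (.inr (.inr i)))) := by
    rw [Set.disjoint_left]
    intro y h1 h2
    have e1 := sideEmpty_subset hg.1 h1
    have e2 := sideEmpty_subset hg.2 h2
    simp only [Set.mem_ofPred_eq] at e1 e2
    rw [orient_swap] at e2
    linarith
  have hE : μ.real (sidesEmpty z) = _ := measureReal_union hd m2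
  have hR : μ.real (sidesRest z) ≤ _ := measureReal_union_le _ _
  have r1 := measureReal_sideRest_le hK (hz _) (fun i => hz _) hg.1
  have r2 := measureReal_sideRest_le hK (hz _) (fun i => hz _) hg.2
  have mE : MeasurableSet (sidesEmpty z) := m1.union m2
  have mR : MeasurableSet (sidesRest z) := m3.union m4
  have hone : μ.real (sidesEmpty z)ᶜ = 1 - μ.real (sidesEmpty z) := probReal_compl_eq_one_sub mE
  calc _ ≤ ∫⁻ y, ((sidesEmpty z)ᶜ.indicator 1 y + (sidesRest z).indicator 1 y) ∂μ := by
        refine lintegral_mono fun y => ?_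
        unfold restWeight
        by_cases hy : y ∈ (sidesEmpty z)ᶜ
        · rw [Set.indicator_of_mem hy, Set.indicator_of_mem hy]; rfl
        · rw [Set.indicator_of_notMem hy]; exact zero_le
    _ = μ (sidesEmpty z)ᶜ + μ (sidesRest z) := by
        rw [lintegral_add_left (measurable_one.indicator mE.compl),
          lintegral_indicator_one mE.compl, lintegral_indicator_one mR]
    _ = ENNReal.ofReal (μ.real (sidesEmpty z)ᶜ + μ.real (sidesRest z)) := by
        rw [ENNReal.ofReal_add measureReal_nonneg measureReal_nonneg]
        simp [Measure.real]
    _ ≤ _ := by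
        refine ENNReal.ofReal_le_ofReal ?_
        rw [hone, hE]
        linarith
end

/-! ### The region beyond the first vertex -/

section
open MeasureTheory
variable {K : Set Plane} [IsProbabilityMeasure (volume.restrict K)] {a b b' : Plane}

/-- The triangle with vertices `b`, `b + t • (b - a)` and `b'` lies in the region and has area `t *
orient a b b' / 2`. -/
theorem mul_orient_le_measureReal_beyond (hK : Convex ℝ K) (hb : b ∈ K) (hb' : b' ∈ K)
    (hD : 0 < orient a b b') {t : ℝ} (ht : 0 ≤ t) (h : b + t • (b - a) ∈ K) :
    t * orient a b b' / 2 ≤ (volume.restrict K).real (beyond a b b') := by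
  rcases ht.eq_or_lt with rfl | ht
  · simp [measureReal_nonneg]
  set q := b + t • (b - a) with hq
  have e : orient b q b' = t * orient a b b' := by simp [hq, orient]; ring
  rw [← e]
  refine (orient_div_two_le_measureReal hK hb h hb').trans (measureReal_mono fun y hy => ?_)
  have e1 : orient a b q = 0 := by simp [hq, orient]; ring
  have e2 : orient b' a b = orient a b b' := by unfold orient; ring
  have e3 : orient b' a q = (1 + t) * orient a b b' := by simp [hq, orient]; ring
  have e4 : orient b' b q = t * orient a b b' := by simp [hq, orient]; ring
  obtain ⟨h1, h2, h3⟩ := hy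
  refine ⟨?_, ?_, ?_⟩
  · exact orient_pos_of_mem_openTriangle_of_le ⟨h1, h2, h3⟩ (orient_self_right a b).ge e1.ge hD
  · rw [orient_swap, neg_lt_zero]
    refine orient_pos_of_mem_openTriangle_of_le (c := b) ⟨h2, h3, h1⟩ ?_
      (orient_self_left b' a).ge (by rwa [e2])
    rw [e3]; positivity
  · rw [orient_swap, neg_lt_zero]
    refine orient_pos_of_mem_openTriangle_of_le (c := q) ⟨h3, h1, h2⟩
      (orient_self_left b' b).ge (orient_self_right b' b).ge ?_
    rw [e4]; positivity

/-- The same area is available when the extension starts at `b'`, parallel to `a b`. -/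
theorem mul_orient_le_measureReal_beyond' (hK : Convex ℝ K) (hb : b ∈ K) (hb' : b' ∈ K)
    (hD : 0 < orient a b b') {t : ℝ} (ht : 0 ≤ t) (h : b' + t • (b - a) ∈ K) :
    t * orient a b b' / 2 ≤ (volume.restrict K).real (beyond a b b') := by
  rcases ht.eq_or_lt with rfl | ht
  · simp [measureReal_nonneg]
  set q := b' + t • (b - a) with hq
  have e : orient b q b' = t * orient a b b' := by simp [hq, orient]; ring
  rw [← e]
  refine (orient_div_two_le_measureReal hK hb h hb').trans (measureReal_mono fun y hy => ?_)
  have e1 : orient a b q = orient a b b' := by simp [hq, orient]; ring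
  have e2 : orient b' a b = orient a b b' := by unfold orient; ring
  have e3 : orient b' a q = t * orient a b b' := by simp [hq, orient]; ring
  have e4 : orient b' b q = t * orient a b b' := by simp [hq, orient]; ring
  obtain ⟨h1, h2, h3⟩ := hy
  refine ⟨?_, ?_, ?_⟩
  · exact orient_pos_of_mem_openTriangle_of_le ⟨h1, h2, h3⟩ (orient_self_right a b).ge
      (by rw [e1]; exact hD.le) hD
  · rw [orient_swap, neg_lt_zero]
    refine orient_pos_of_mem_openTriangle_of_le (c := b) ⟨h2, h3, h1⟩ ?_
      (orient_self_left b' a).ge (by rwa [e2])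
    rw [e3]; positivity
  · rw [orient_swap, neg_lt_zero]
    refine orient_pos_of_mem_openTriangle_of_le (c := q) ⟨h3, h1, h2⟩
      (orient_self_left b' b).ge (orient_self_right b' b).ge ?_
    rw [e4]; positivity

/-- The average of the two bounds dominates the geometric mean. Used alone in the integration over
`b'`, the bound with `s` would lead to the weight `1 / dist(b, Kᶜ)` and the one with `t` to an
integral of `1 / t`, both logarithmically divergent; the square roots make both integrable. -/
theorem sqrt_mul_orient_le_measureReal_beyond (hK : Convex ℝ K) (hb : b ∈ K) (hb' : b' ∈ K)
    (hD : 0 < orient a b b') {s t : ℝ} (hs : 0 ≤ s) (ht : 0 ≤ t) (h : b + s • (b - a) ∈ K)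
    (h' : b' + t • (b - a) ∈ K) :
    √s * √t * orient a b b' / 2 ≤ (volume.restrict K).real (beyond a b b') := by
  have h1 := mul_orient_le_measureReal_beyond hK hb hb' hD hs h
  have h2 := mul_orient_le_measureReal_beyond' hK hb hb' hD ht h'
  have h3 : √s * √t ≤ (s + t) / 2 := by
    have := sq_nonneg (√s - √t)
    have := Real.sq_sqrt hs
    have := Real.sq_sqrt ht
    linarith
  have := mul_le_mul_of_nonneg_right h3 hD.le
  linarith

theorem lintegral_one_div_sqrt {R : ℝ} (hR : 0 ≤ R) :
    ∫⁻ x in Set.Ioc 0 R, ENNReal.ofReal (1 / √x) = ENNReal.ofReal (2 * √R) := by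
  have h := integral_rpow (a := 0) (b := R) (r := -(1 / 2)) (Or.inl (by norm_num))
  have hi := intervalIntegral.intervalIntegrable_rpow' (a := 0) (b := R) (r := -(1 / 2))
    (by norm_num)
  rw [intervalIntegrable_iff_integrableOn_Ioc_of_le hR] at hi
  rw [intervalIntegral.integral_of_le hR] at h
  have e : ∀ x ∈ Set.Ioc 0 R, ENNReal.ofReal (1 / √x) = ENNReal.ofReal (x ^ (-(1 / 2) : ℝ)) := by
    intro x hx
    rw [Real.rpow_neg hx.1.le, ← Real.sqrt_eq_rpow, one_div]
  rw [setLIntegral_congr_fun measurableSet_Ioc e, ← ofReal_integral_eq_lintegral_ofReal hi, h,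
    Real.sqrt_eq_rpow]
  · congr 1
    rw [Real.zero_rpow (by norm_num)]
    norm_num
    ring
  · filter_upwards [ae_restrict_mem measurableSet_Ioc] with x hx
    exact Real.rpow_nonneg hx.1.le _

theorem lintegral_Ioi_Ioc_exp {k R : ℝ} (hk : 0 < k) (hR : 0 ≤ R) :
    ∫⁻ t in Set.Ioi (0 : ℝ), ∫⁻ s in Set.Ioc 0 R, ENNReal.ofReal (Real.exp (-(k * √s * t))) =
      ENNReal.ofReal (2 * √R / k) := by
  rw [lintegral_lintegral_swap (by fun_prop)]
  have e : ∀ s ∈ Set.Ioc 0 R, ∫⁻ t in Set.Ioi (0 : ℝ), ENNReal.ofReal (Real.exp (-(k * √s * t))) =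
      ENNReal.ofReal (1 / k) * ENNReal.ofReal (1 / √s) := by
    intro s hs
    have := Real.sqrt_pos.2 hs.1
    rw [lintegral_exp_neg_mul_Ioi (by positivity), ← ENNReal.ofReal_mul (by positivity)]
    congr 1
    field_simp
  rw [setLIntegral_congr_fun measurableSet_Ioc e, lintegral_const_mul' _ _ ENNReal.ofReal_ne_top,
    lintegral_one_div_sqrt hR, ← ENNReal.ofReal_mul (by positivity)]
  congr 1
  ring

/-- The integral over one vertex `b'` of the exponential weight of the region beyond `b b'`. -/
theorem lintegral_beyond_le (hKc : IsCompact K) (hK : Convex ℝ K) {M : ℝ} (hM : ∀ p ∈ K, ∀ q ∈ K, dist p q ≤ M)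
    (hb : b ∈ K) (hδ : 0 < Metric.infDist b Kᶜ) {κ : ℝ} (hκ : 0 < κ) :
    ∫⁻ b' in K ∩ {b' | 0 < orient a b b'},
      ENNReal.ofReal (Real.exp (-(κ * (volume.restrict K).real (beyond a b b')))) ≤
      ENNReal.ofReal (8 * √M / (κ * √(Metric.infDist b Kᶜ))) := by
  set δ := Metric.infDist b Kᶜ with hδd
  by_cases hab : a = b
  · subst hab
    have : {b' | 0 < orient a a b'} = (∅ : Set Plane) := by ext x; simp [orient]
    rw [this]
    simp
  have hM0 : 0 ≤ M := dist_nonneg.trans (hM b hb b hb)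
  have hm : MeasurableSet (K ∩ {b' | 0 < orient a b b'}) :=
    hKc.measurableSet.inter (isOpen_lt continuous_const (continuous_orient_right _ _)).measurableSet
  rw [← lintegral_indicator hm]
  let u : Plane := b - a
  let v : Plane := !₂[-(u 1), u 0]
  set ℓ := dist a b with hℓ
  have hℓ0 : 0 < ℓ := dist_pos.2 hab
  have hL : u 0 ^ 2 + u 1 ^ 2 = ℓ ^ 2 := by rw [hℓ, dist_sq_eq]; simp [u]; ring
  have hdet : v 0 * u 1 - v 1 * u 0 = -ℓ ^ 2 := by rw [← hL]; simp [v]; ring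
  have hnorm : ‖u‖ = ℓ := by rw [hℓ, dist_comm, dist_eq_norm]
  rw [lintegral_frame b v u (by rw [hdet]; exact neg_ne_zero.2 (by positivity)), hdet, abs_neg,
    abs_of_pos (by positivity)]
  -- Half of the distance to the complement, in units of `ℓ`, so that `b + s₀ • (b - a)` stays in a
  -- ball inside `K`.
  set s₀ := δ / (2 * ℓ) with hs₀
  have hs₀pos : 0 < s₀ := by positivity
  have hs₀K : b + s₀ • (b - a) ∈ K := by
    refine Metric.ball_infDist_compl_subset (x := b) ?_
    rw [Metric.mem_ball, dist_eq_norm, add_sub_cancel_left, norm_smul, Real.norm_of_nonneg hs₀pos.le]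
    change s₀ * ‖u‖ < δ
    rw [hnorm, hs₀]
    field_simp
    linarith
  set k := κ * √s₀ * ℓ ^ 2 / 2 with hk
  have hk0 : 0 < k := by have := Real.sqrt_pos.2 hs₀pos; positivity
  -- For fixed height `t` above the line `a b`, the variable `s` runs along a chord of `K` parallel
  -- to `a b`, of parameter length at most `M / ℓ`.
  have key : ∀ t : ℝ, ∫⁻ s : ℝ, (K ∩ {b' | 0 < orient a b b'}).indicator (fun b' =>
      ENNReal.ofReal (Real.exp (-(κ * (volume.restrict K).real (beyond a b b')))))
      (b + t • v + s • u) ≤ (Set.Ioi (0 : ℝ)).indicator (fun t =>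
        ∫⁻ s in Set.Ioc 0 (M / ℓ), ENNReal.ofReal (Real.exp (-(k * √s * t)))) t := by
    intro t
    have hor : ∀ s : ℝ, orient a b (b + t • v + s • u) = t * ℓ ^ 2 := by
      intro s; rw [← hL]; simp [orient, v, u]; ring
    by_cases ht : t ∈ Set.Ioi (0 : ℝ)
    swap
    · rw [Set.indicator_of_notMem ht]
      refine le_of_eq (lintegral_eq_zero_of_ae_eq_zero (Filter.Eventually.of_forall fun s => ?_))
      refine Set.indicator_of_notMem (fun h => ht ?_) _
      have h2 : 0 < orient a b (b + t • v + s • u) := h.2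
      rw [hor] at h2
      exact pos_of_mul_pos_left h2 (by positivity)
    rw [Set.indicator_of_mem ht, restrict_Ioc_eq_restrict_Icc,
      ← lintegral_indicator measurableSet_Icc]
    rcases ({s : ℝ | b + t • v + s • u ∈ K}).eq_empty_or_nonempty with h0 | h0
    · refine (le_of_eq (lintegral_eq_zero_of_ae_eq_zero (Filter.Eventually.of_forall fun s => ?_))).trans
        zero_le
      refine Set.indicator_of_notMem (fun h => ?_) _
      exact (Set.eq_empty_iff_forall_notMem.1 h0 s) h.1
    have hlen : ∀ s s' : ℝ, b + t • v + s • u ∈ K → b + t • v + s' • u ∈ K → |s - s'| ≤ M / ℓ := by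
      intro s s' h h'
      have := hM _ h _ h'
      rw [dist_add_left, dist_eq_norm, ← sub_smul, norm_smul, hnorm] at this
      rwa [le_div_iff₀ hℓ0]
    have hclosed : IsClosed {s : ℝ | b + t • v + s • u ∈ K} :=
      hKc.isClosed.preimage (by fun_prop)
    have hbdd : BddAbove {s : ℝ | b + t • v + s • u ∈ K} := by
      obtain ⟨s₁, hs₁⟩ := h0
      refine ⟨s₁ + M / ℓ, fun s hs => ?_⟩
      have := (le_abs_self _).trans (hlen s s₁ hs hs₁)
      linarith
    -- The far end of the chord: from parameter `s` one can continue by `β - s` inside `K`. The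
    -- integral is then rewritten in the variable `β - s`.
    set β := sSup {s : ℝ | b + t • v + s • u ∈ K}
    have hβ : b + t • v + β • u ∈ K := hclosed.csSup_mem h0 hbdd
    rw [← lintegral_sub_left_eq_self ((Set.Icc 0 (M / ℓ)).indicator fun s =>
      ENNReal.ofReal (Real.exp (-(k * √s * t)))) β]
    refine lintegral_mono fun s => ?_
    by_cases hs : b + t • v + s • u ∈ K ∩ {b' | 0 < orient a b b'}
    · have h1 : 0 ≤ β - s := sub_nonneg.2 (le_csSup hbdd hs.1)
      have h2 : β - s ∈ Set.Icc 0 (M / ℓ) := ⟨h1, (le_abs_self _).trans (hlen β s hβ hs.1)⟩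
      rw [Set.indicator_of_mem hs, Set.indicator_of_mem h2]
      refine ENNReal.ofReal_le_ofReal (Real.exp_le_exp.2 (neg_le_neg ?_))
      have h3 := sqrt_mul_orient_le_measureReal_beyond hK hb hs.1 hs.2 hs₀pos.le h1 hs₀K (by
        convert hβ using 1
        change b + t • v + s • u + (β - s) • u = _
        module)
      rw [hor] at h3
      calc k * √(β - s) * t = κ * (√s₀ * √(β - s) * (t * ℓ ^ 2) / 2) := by rw [hk]; ring
        _ ≤ _ := mul_le_mul_of_nonneg_left h3 hκ.le
    · rw [Set.indicator_of_notMem hs]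
      exact zero_le
  rw [Measure.volume_eq_prod]
  refine (mul_le_mul_right ((lintegral_prod_le _).trans (lintegral_mono key)) _).trans ?_
  rw [lintegral_indicator measurableSet_Ioi, lintegral_Ioi_Ioc_exp hk0 (by positivity),
    ← ENNReal.ofReal_mul (by positivity)]
  refine ENNReal.ofReal_le_ofReal ?_
  have hsδ := Real.sqrt_pos.2 hδ
  have hsℓ := Real.sqrt_pos.2 hℓ0
  have hs2 : √s₀ = √δ / (√2 * √ℓ) := by
    rw [hs₀, Real.sqrt_div hδ.le, Real.sqrt_mul (by norm_num)]
  rw [hk, hs2, Real.sqrt_div hM0]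
  have h2 : √2 ≤ 2 := by
    rw [Real.sqrt_le_left (by norm_num)]; norm_num
  have hs2' : 0 < √(2 : ℝ) := by positivity
  -- All powers of `ℓ` cancel, so the bound does not depend on the distance from `a` to `b`.
  have : ℓ ^ 2 * (2 * (√M / √ℓ) / (κ * (√δ / (√2 * √ℓ)) * ℓ ^ 2 / 2)) =
      4 * √2 * √M / (κ * √δ) := by
    field_simp
    ring
  rw [this]
  refine div_le_div_of_nonneg_right ?_ (by positivity)
  nlinarith [Real.sqrt_nonneg M]

end

/-! ### Integrability of the boundary weight -/

section
open MeasureTheory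
variable {K : Set Plane}

/-- Shrink `K` by the factor `1 - s / r` about the centre of a ball of radius `r` in `K`. By
convexity the image keeps distance at least `s` from the complement, so the boundary layer has area
at most `1 - (1 - s / r) ^ 2 ≤ 2 * s / r`. -/
theorem exists_measure_infDist_lt_le (hKc : IsCompact K) (hK : Convex ℝ K) (hK1 : volume K = 1) :
    ∃ C : ℝ, 0 < C ∧ ∀ s : ℝ, 0 < s →
      (volume.restrict K) {b | Metric.infDist b Kᶜ < s} ≤ ENNReal.ofReal (C * s) := by
  have : IsProbabilityMeasure (volume.restrict K) := ⟨by simp [hK1]⟩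
  have hint : (interior K).Nonempty := by
    by_contra hcon
    rw [Set.not_nonempty_iff_eq_empty] at hcon
    -- A convex set has null frontier, so unit area forces an interior point.
    have h0 := hK.addHaar_frontier volume
    rw [frontier, hcon, Set.sdiff_empty, hKc.isClosed.closure_eq, hK1] at h0
    exact one_ne_zero h0
  obtain ⟨o, ho⟩ := hint
  obtain ⟨r, hr, hball⟩ := Metric.isOpen_iff.1 isOpen_interior o ho
  have hball' : Metric.ball o r ⊆ K := hball.trans interior_subset
  have hKne : (Kᶜ).Nonempty := by
    rw [Set.nonempty_compl]
    rintro rfl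
    exact noncompact_univ Plane hKc
  refine ⟨2 / r, by positivity, fun s hs => ?_⟩
  rcases le_or_gt r s with hrs | hrs
  · refine prob_le_one.trans ?_
    rw [ENNReal.one_le_ofReal, div_mul_eq_mul_div, le_div_iff₀ hr]
    linarith
  set t := s / r with ht
  have ht0 : 0 < t := by positivity
  have ht1 : t < 1 := (div_lt_one hr).2 hrs
  set K' := AffineMap.homothety o (1 - t) '' K with hK'
  have hK'sub : K' ⊆ {b | s ≤ Metric.infDist b Kᶜ} := by
    rintro _ ⟨k, hk, rfl⟩
    refine (Metric.le_infDist hKne).2 fun y hy => ?_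
    by_contra hcon
    push Not at hcon
    refine hy ?_
    set p := AffineMap.homothety o (1 - t) k with hp
    -- A point `y` closer than `s` to the shrunken point `p` is the convex combination, with weights
    -- `1 - t` and `t`, of `k` and this point of the ball.
    have hq : o + t⁻¹ • (y - p) ∈ K := by
      refine hball' ?_
      rw [Metric.mem_ball, dist_eq_norm, add_sub_cancel_left, norm_smul,
        Real.norm_of_nonneg (inv_nonneg.2 ht0.le), ← dist_eq_norm, dist_comm, inv_mul_lt_iff₀ ht0]
      rwa [ht, div_mul_cancel₀ _ hr.ne']
    have := hK hk hq (by linarith : 0 ≤ 1 - t) ht0.le (by ring)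
    convert this using 1
    rw [smul_add, smul_smul, mul_inv_cancel₀ ht0.ne', one_smul, hp, AffineMap.homothety_apply,
      vsub_eq_sub, vadd_eq_add]
    module
  have hK'K : K' ⊆ K := by
    rintro _ ⟨k, hk, rfl⟩
    have := hK hk (hball' (Metric.mem_ball_self hr)) (by linarith : 0 ≤ 1 - t) ht0.le (by ring)
    convert this using 1
    rw [AffineMap.homothety_apply, vsub_eq_sub, vadd_eq_add]
    module
  have hK'm : MeasurableSet K' :=
    (hKc.image (AffineMap.homothety_continuous o (1 - t))).measurableSet
  have hvol : (volume.restrict K).real K' = (1 - t) ^ 2 := by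
    rw [Measure.real, Measure.restrict_eq_self _ hK'K, hK', Measure.addHaar_image_homothety, hK1]
    simp [sq_nonneg]
  calc (volume.restrict K) {b | Metric.infDist b Kᶜ < s} ≤ (volume.restrict K) K'ᶜ :=
        measure_mono fun b hb hb' =>
          not_lt_of_ge (show s ≤ Metric.infDist b Kᶜ from hK'sub hb') hb
    _ = ENNReal.ofReal (1 - (1 - t) ^ 2) := by
        rw [← hvol, ← probReal_compl_eq_one_sub hK'm, ofReal_measureReal]
    _ ≤ _ := by
        refine ENNReal.ofReal_le_ofReal ?_
        have : 2 / r * s = 2 * t := by rw [ht]; ring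
        rw [this]
        nlinarith [sq_nonneg t]

theorem ae_infDist_pos (hKc : IsCompact K) (hK : Convex ℝ K) (hK1 : volume K = 1) :
    ∀ᵐ b ∂(volume.restrict K), 0 < Metric.infDist b Kᶜ := by
  obtain ⟨C, hC, h⟩ := exists_measure_infDist_lt_le hKc hK hK1
  rw [ae_iff]
  refine le_antisymm (le_of_forall_pos_le_add fun ε hε => ?_) zero_le
  rw [zero_add]
  rcases eq_or_ne ε ⊤ with rfl | hε'
  · exact le_top
  have hε0 := ENNReal.toReal_pos hε.ne' hε'
  have := h (ε.toReal / C) (by positivity)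
  rw [mul_div_cancel₀ _ hC.ne', ENNReal.ofReal_toReal hε'] at this
  refine le_trans (measure_mono fun b hb => ?_) this
  exact lt_of_le_of_lt (not_lt.1 hb) (by positivity)

theorem measurable_infDist_weight (K : Set Plane) :
    Measurable fun b : Plane => 1 / √(Metric.infDist b Kᶜ) := by
  have : Measurable fun b : Plane => Metric.infDist b Kᶜ := by fun_prop
  exact measurable_const.div this.sqrt

/-- Layer-cake formula: the weight exceeds `t` only on a boundary layer of width `1 / t ^ 2`, whose
area is `O(t ^ (-2))`. -/
theorem lintegral_infDist_weight_lt_top (hKc : IsCompact K) (hK : Convex ℝ K)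
    (hK1 : volume K = 1) :
    ∫⁻ b, ENNReal.ofReal (1 / √(Metric.infDist b Kᶜ)) ∂(volume.restrict K) < ⊤ := by
  have : IsProbabilityMeasure (volume.restrict K) := ⟨by simp [hK1]⟩
  obtain ⟨C, hC, h⟩ := exists_measure_infDist_lt_le hKc hK hK1
  rw [lintegral_eq_lintegral_meas_lt _ (Filter.Eventually.of_forall fun b => by positivity)
    (measurable_infDist_weight K).aemeasurable]
  have hle : ∀ t ∈ Set.Ioi (0 : ℝ),
      (volume.restrict K) {b | t < 1 / √(Metric.infDist b Kᶜ)} ≤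
      (Set.Ioc (0 : ℝ) 1).indicator 1 t +
        (Set.Ioi (1 : ℝ)).indicator (fun t => ENNReal.ofReal (C * t ^ (-2 : ℝ))) t := by
    intro t ht
    have ht : 0 < t := ht
    rcases le_or_gt t 1 with h1 | h1
    · rw [Set.indicator_of_mem (show t ∈ Set.Ioc (0 : ℝ) 1 from ⟨ht, h1⟩)]
      exact prob_le_one.trans le_self_add
    · rw [Set.indicator_of_mem (show t ∈ Set.Ioi (1 : ℝ) from h1)]
      refine le_trans ?_ le_add_self
      have e : t ^ (-2 : ℝ) = 1 / t ^ 2 := by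
        rw [Real.rpow_neg ht.le, one_div]; norm_cast
      rw [e]
      refine le_trans (measure_mono fun b hb => ?_) (h (1 / t ^ 2) (by positivity))
      have hb : t < 1 / √(Metric.infDist b Kᶜ) := hb
      -- Since `1 / √0` evaluates to 0, a point where the weight exceeds `t > 0` is at positive
      -- distance from the complement.
      have hs : 0 < √(Metric.infDist b Kᶜ) := by
        by_contra hcon
        rw [le_antisymm (not_lt.1 hcon) (Real.sqrt_nonneg _), div_zero] at hb
        linarith
      have hd := Real.sqrt_pos.1 hs
      rw [lt_div_iff₀ hs] at hb
      change Metric.infDist b Kᶜ < 1 / t ^ 2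
      rw [lt_div_iff₀ (by positivity)]
      have h2 : (t * √(Metric.infDist b Kᶜ)) ^ 2 < 1 := by
        rw [sq_lt_one_iff_abs_lt_one, abs_of_pos (by positivity)]
        exact hb
      rw [mul_pow, Real.sq_sqrt hd.le] at h2
      linarith
  refine lt_of_le_of_lt (setLIntegral_mono' measurableSet_Ioi hle) ?_
  refine lt_of_le_of_lt (setLIntegral_le_lintegral _ _) ?_
  rw [lintegral_add_left (measurable_one.indicator measurableSet_Ioc),
    lintegral_indicator_one measurableSet_Ioc, lintegral_indicator measurableSet_Ioi]
  refine ENNReal.add_lt_top.2 ⟨by simp, ?_⟩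
  have hi : IntegrableOn (fun t : ℝ => C * t ^ (-2 : ℝ)) (Set.Ioi 1) :=
    (integrableOn_Ioi_rpow_of_lt (by norm_num) one_pos).const_mul C
  exact hi.lintegral_lt_top

end

/-! ### Integrating out the vertices of one side -/

section
open MeasureTheory
variable {K : Set Plane} {a b : Plane}

/-- The exponential weight of the empty region on one side of an edge. -/
noncomputable def sideWeight (K : Set Plane) (κ : ℝ) (τ : ℕ) (a b : Plane) (x : Fin τ → Plane) :
    ENNReal :=
  {x | SideGood τ a b x}.indicator (fun x => ENNReal.ofReal
    (Real.exp (-(κ * (volume.restrict K).real (sideEmpty τ a b x))))) x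

/-- The exponential weight of the first vertex. -/
noncomputable def beyondWeight (K : Set Plane) (κ : ℝ) (a b b' : Plane) : ENNReal :=
  {b' | 0 < orient a b b'}.indicator (fun b' => ENNReal.ofReal
    (Real.exp (-(κ * (volume.restrict K).real (beyond a b b'))))) b'

/-- The exponential weight of a vertex `x` in the strip over `p q`. -/
noncomputable def stripWeight (κ : ℝ) (p q c x : Plane) : ENNReal :=
  (halfStrip p q c).indicator (fun x => ENNReal.ofReal (Real.exp (-(κ * orient p q x)))) x

theorem lintegral_stripWeight_le {p q c : Plane} (h : 0 < orient p q c) {κ : ℝ} (hκ : 0 < κ) :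
    ∫⁻ x, stripWeight κ p q c x ∂(volume.restrict K) ≤ ENNReal.ofReal (1 / κ) := by
  refine (lintegral_mono' Measure.restrict_le_self le_rfl).trans ?_
  unfold stripWeight
  rw [lintegral_indicator (isClosed_halfStrip p q c).measurableSet,
    setLIntegral_halfStrip_exp h hκ]

theorem beyondWeight_ne_top (κ : ℝ) (a b b' : Plane) : beyondWeight K κ a b b' ≠ ⊤ := by
  unfold beyondWeight Set.indicator
  split_ifs <;> simp

theorem stripWeight_ne_top (κ : ℝ) (p q c x : Plane) : stripWeight κ p q c x ≠ ⊤ := by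
  unfold stripWeight Set.indicator
  split_ifs <;> simp

theorem lintegral_beyondWeight_le [IsProbabilityMeasure (volume.restrict K)] (hKc : IsCompact K)
    (hK : Convex ℝ K) {M : ℝ} (hM : ∀ p ∈ K, ∀ q ∈ K, dist p q ≤ M)
    (hb : b ∈ K) (hδ : 0 < Metric.infDist b Kᶜ) {κ : ℝ} (hκ : 0 < κ) :
    ∫⁻ b', beyondWeight K κ a b b' ∂(volume.restrict K) ≤
      ENNReal.ofReal (8 * √M / (κ * √(Metric.infDist b Kᶜ))) := by
  refine le_trans (le_of_eq ?_) (lintegral_beyond_le (a := a) hKc hK hM hb hδ hκ)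
  have hm : MeasurableSet {b' | 0 < orient a b b'} :=
    (isOpen_lt continuous_const (continuous_orient_right _ _)).measurableSet
  unfold beyondWeight
  rw [lintegral_indicator hm, Measure.restrict_restrict hm, Set.inter_comm]

theorem sideWeight_two_le [IsProbabilityMeasure (volume.restrict K)] (hK : Convex ℝ K) {κ : ℝ}
    (hκ : 0 < κ) {x : Fin 2 → Plane} (hb : b ∈ K) (hx : ∀ i, x i ∈ K) :
    sideWeight K κ 2 a b x ≤ beyondWeight K κ a b (x 0) * stripWeight (κ / 2) b (x 0) a (x 1) := by
  by_cases hg : SideGood 2 a b x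
  swap
  · rw [sideWeight, Set.indicator_of_notMem (by exact hg)]
    exact zero_le
  have h := le_measureReal_sideEmpty_two (a := a) hK hb hx
  have h0 := orient_pos_of_mem_openTriangle hg
  have h1 : x 1 ∈ halfStrip b (x 0) a := openTriangle_subset_halfStrip _ _ _ ⟨hg.2.1, hg.2.2, hg.1⟩
  rw [sideWeight, Set.indicator_of_mem (by exact hg), beyondWeight,
    Set.indicator_of_mem (by exact h0), stripWeight, Set.indicator_of_mem h1,
    ← ENNReal.ofReal_mul (Real.exp_pos _).le, ← Real.exp_add]
  refine ENNReal.ofReal_le_ofReal (Real.exp_le_exp.2 ?_)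
  have := mul_le_mul_of_nonneg_left h hκ.le
  linarith

/-- The exponential splits along the three pieces of the empty region. The last vertex lies in the
half strip over `b v` or over `v b'`, and the sum covers both cases. The triangle indicator is kept
because it makes both strips positively oriented. -/
theorem sideWeight_three_le [IsProbabilityMeasure (volume.restrict K)] (hK : Convex ℝ K) {κ : ℝ}
    (hκ : 0 < κ) {x : Fin 3 → Plane} (hb : b ∈ K) (hx : ∀ i, x i ∈ K) :
    sideWeight K κ 3 a b x ≤
      (beyondWeight K κ a b (x 0) * (openTriangle a b (x 0)).indicator 1 (x 1) *
        stripWeight (κ / 2) b (x 0) a (x 1)) *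
        (stripWeight (κ / 2) b (x 1) a (x 2) +
          stripWeight (κ / 2) (x 1) (x 0) (x 1 + a - x 0) (x 2)) := by
  by_cases hg : SideGood 3 a b x
  swap
  · rw [sideWeight, Set.indicator_of_notMem (by exact hg)]
    exact zero_le
  have h := le_measureReal_sideEmpty_three hK hb hx hg
  rw [sideWeight, Set.indicator_of_mem (by exact hg)]
  obtain ⟨g1, g2, g3, g4⟩ := hg
  have h0 := orient_pos_of_mem_openTriangle g1
  have h1 : x 1 ∈ halfStrip b (x 0) a := openTriangle_subset_halfStrip _ _ _ ⟨g1.2.1, g1.2.2, g1.1⟩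
  rw [beyondWeight, Set.indicator_of_mem (by exact h0), Set.indicator_of_mem g1, Pi.one_apply,
    mul_one, stripWeight, Set.indicator_of_mem h1]
  have key : ∀ e : ℝ, e ≤ max (orient b (x 1) (x 2)) (orient (x 1) (x 0) (x 2)) →
      ENNReal.ofReal (Real.exp (-(κ * (volume.restrict K).real (sideEmpty 3 a b x)))) ≤
      ENNReal.ofReal (Real.exp (-(κ * (volume.restrict K).real (beyond a b (x 0))))) *
        ENNReal.ofReal (Real.exp (-(κ / 2 * orient b (x 0) (x 1)))) *
        ENNReal.ofReal (Real.exp (-(κ / 2 * e))) := by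
    intro e he
    rw [← ENNReal.ofReal_mul (Real.exp_pos _).le, ← Real.exp_add,
      ← ENNReal.ofReal_mul (Real.exp_pos _).le, ← Real.exp_add]
    refine ENNReal.ofReal_le_ofReal (Real.exp_le_exp.2 ?_)
    have := mul_le_mul_of_nonneg_left h hκ.le
    have := mul_le_mul_of_nonneg_left he hκ.le
    linarith
  rcases g4 with g4 | g4
  · have hm := (restLeft_subset (e := orient b (x 1) (x 2)) g1 ⟨g2.1.le, g4.le, g3, le_rfl⟩).1
    refine (key _ (le_max_left _ _)).trans (mul_le_mul_right ?_ _)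
    refine le_trans (le_of_eq ?_) le_self_add
    rw [stripWeight, Set.indicator_of_mem hm]
  · have hm := (restRight_subset (e := orient (x 1) (x 0) (x 2)) g1 ⟨g2.2.2.le, g4.le, g3, le_rfl⟩).1
    refine (key _ (le_max_right _ _)).trans (mul_le_mul_right ?_ _)
    refine le_trans (le_of_eq ?_) le_add_self
    rw [stripWeight, Set.indicator_of_mem hm]

theorem lintegral_beyondWeight_mul_stripWeight_le [IsProbabilityMeasure (volume.restrict K)]
    {κ : ℝ} (hκ : 0 < κ) (b' : Plane) :
    ∫⁻ v, beyondWeight K κ a b b' * stripWeight (κ / 2) b b' a v ∂(volume.restrict K) ≤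
      beyondWeight K κ a b b' * ENNReal.ofReal (2 / κ) := by
  rw [lintegral_const_mul' _ _ (beyondWeight_ne_top _ _ _ _)]
  by_cases h : 0 < orient a b b'
  · refine mul_le_mul_right ((lintegral_stripWeight_le ?_ (by positivity)).trans_eq ?_) _
    · have : orient b b' a = orient a b b' := by unfold orient; ring
      rwa [this]
    · congr 1; field_simp
  · rw [beyondWeight, Set.indicator_of_notMem (by exact h)]
    simp

/-- The vertices are integrated out from the last to the first: `w` gives `4 / κ` from two strips,
`v` gives `2 / κ`, and `b'` gives `1 / κ` times the boundary weight. The summand 1 takes care of `τ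
= 0`. -/
theorem lintegral_sideWeight_le [IsProbabilityMeasure (volume.restrict K)] (hKc : IsCompact K)
    (hK : Convex ℝ K) {M : ℝ} (hM : ∀ p ∈ K, ∀ q ∈ K, dist p q ≤ M) {τ : ℕ} (hτ : τ < 4)
    (hb : b ∈ K) (hδ : 0 < Metric.infDist b Kᶜ) {κ : ℝ} (hκ : 0 < κ) :
    ∫⁻ x, sideWeight K κ τ a b x ∂(Measure.pi fun _ => volume.restrict K) ≤
      ENNReal.ofReal (8 / κ ^ τ) * ENNReal.ofReal (1 + 8 * √M / √(Metric.infDist b Kᶜ)) := by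
  have hM0 : 0 ≤ M := dist_nonneg.trans (hM b hb b hb)
  have hB := lintegral_beyondWeight_le (a := a) hKc hK hM hb hδ hκ
  have hmem := ae_pi_mem (ι := Fin τ) hKc.measurableSet
  set δ := Metric.infDist b Kᶜ
  have hsδ := Real.sqrt_pos.2 hδ
  rw [← ENNReal.ofReal_mul (by positivity)]
  have hle : 8 * √M / √δ ≤ 1 + 8 * √M / √δ := by linarith
  interval_cases τ
  · rw [lintegral_pi_zero]
    unfold sideWeight
    refine (Set.indicator_le_self _ _ _).trans (ENNReal.ofReal_le_ofReal ?_)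
    have : (volume.restrict K).real (sideEmpty 0 a b Fin.elim0) = 0 := measureReal_empty
    rw [this]
    have : 0 ≤ 8 * √M / √δ := by positivity
    simp only [mul_zero, neg_zero, Real.exp_zero, pow_zero]
    linarith
  · refine (lintegral_pi_succ_le _ _ _).trans ?_
    simp only [lintegral_pi_zero]
    refine hB.trans (ENNReal.ofReal_le_ofReal ?_)
    rw [pow_one]
    calc 8 * √M / (κ * √δ) = 1 / κ * (8 * √M / √δ) := by field_simp
      _ ≤ 8 / κ * (1 + 8 * √M / √δ) := by gcongr; norm_num
  · calc _ ≤ ∫⁻ x : Fin 2 → Plane, beyondWeight K κ a b (x 0) *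
          stripWeight (κ / 2) b (x 0) a (x 1) ∂(Measure.pi fun _ => volume.restrict K) :=
          lintegral_mono_ae (hmem.mono fun x hx => sideWeight_two_le hK hκ hb hx)
      _ ≤ ∫⁻ b', ∫⁻ v, beyondWeight K κ a b b' * stripWeight (κ / 2) b b' a v
          ∂(volume.restrict K) ∂(volume.restrict K) := by
          refine (lintegral_pi_succ_le _ _ _).trans (lintegral_mono fun b' => ?_)
          refine (lintegral_pi_succ_le _ _ _).trans (lintegral_mono fun v => ?_)
          rw [lintegral_pi_zero]
          exact le_rfl
      _ ≤ ∫⁻ b', beyondWeight K κ a b b' * ENNReal.ofReal (2 / κ) ∂(volume.restrict K) :=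
          lintegral_mono fun b' => lintegral_beyondWeight_mul_stripWeight_le hκ b'
      _ ≤ ENNReal.ofReal (8 * √M / (κ * √δ)) * ENNReal.ofReal (2 / κ) := by
          rw [lintegral_mul_const' _ _ ENNReal.ofReal_ne_top]
          exact mul_le_mul_left hB _
      _ ≤ _ := by
          rw [← ENNReal.ofReal_mul (by positivity)]
          refine ENNReal.ofReal_le_ofReal ?_
          calc 8 * √M / (κ * √δ) * (2 / κ) = 2 / κ ^ 2 * (8 * √M / √δ) := by field_simp
            _ ≤ 8 / κ ^ 2 * (1 + 8 * √M / √δ) := by gcongr; norm_num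
  · calc _ ≤ ∫⁻ x : Fin 3 → Plane, (beyondWeight K κ a b (x 0) *
          (openTriangle a b (x 0)).indicator 1 (x 1) * stripWeight (κ / 2) b (x 0) a (x 1)) *
          (stripWeight (κ / 2) b (x 1) a (x 2) +
            stripWeight (κ / 2) (x 1) (x 0) (x 1 + a - x 0) (x 2))
          ∂(Measure.pi fun _ => volume.restrict K) :=
          lintegral_mono_ae (hmem.mono fun x hx => sideWeight_three_le hK hκ hb hx)
      _ ≤ ∫⁻ b', ∫⁻ v, ∫⁻ w, (beyondWeight K κ a b b' * (openTriangle a b b').indicator 1 v *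
          stripWeight (κ / 2) b b' a v) *
          (stripWeight (κ / 2) b v a w + stripWeight (κ / 2) v b' (v + a - b') w)
          ∂(volume.restrict K) ∂(volume.restrict K) ∂(volume.restrict K) := by
          refine (lintegral_pi_succ_le _ _ _).trans (lintegral_mono fun b' => ?_)
          refine (lintegral_pi_succ_le _ _ _).trans (lintegral_mono fun v => ?_)
          refine (lintegral_pi_succ_le _ _ _).trans (lintegral_mono fun w => ?_)
          rw [lintegral_pi_zero]
          exact le_rfl
      _ ≤ ∫⁻ b', ∫⁻ v, (beyondWeight K κ a b b' * stripWeight (κ / 2) b b' a v) *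
          ENNReal.ofReal (4 / κ) ∂(volume.restrict K) ∂(volume.restrict K) := by
          refine lintegral_mono fun b' => lintegral_mono fun v => ?_
          by_cases hv : v ∈ openTriangle a b b'
          · simp only [Set.indicator_of_mem hv, Pi.one_apply, mul_one]
            rw [lintegral_const_mul' _ _ (ENNReal.mul_ne_top (beyondWeight_ne_top _ _ _ _)
              (stripWeight_ne_top _ _ _ _ _))]
            refine mul_le_mul_right ?_ _
            have hmeas : Measurable fun w => stripWeight (κ / 2) b v a w := by
              unfold stripWeight
              refine Measurable.indicator ?_ (isClosed_halfStrip _ _ _).measurableSet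
              exact (((continuous_orient_right b v).const_smul (κ / 2)).neg.rexp).measurable.ennreal_ofReal
            rw [lintegral_add_left hmeas]
            refine (add_le_add (lintegral_stripWeight_le ?_ (by positivity))
              (lintegral_stripWeight_le ?_ (by positivity))).trans_eq ?_
            · have : orient b v a = orient a b v := by unfold orient; ring
              rw [this]; exact hv.1
            · rw [orient_add_sub']; exact hv.2.2
            · rw [← ENNReal.ofReal_add (by positivity) (by positivity)]
              congr 1; field_simp; norm_num
          · simp [Set.indicator_of_notMem hv]
      _ ≤ ∫⁻ b', (beyondWeight K κ a b b' * ENNReal.ofReal (2 / κ)) * ENNReal.ofReal (4 / κ)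
          ∂(volume.restrict K) := by
          refine lintegral_mono fun b' => ?_
          simp only
          rw [lintegral_mul_const' _ _ ENNReal.ofReal_ne_top]
          exact mul_le_mul_left (lintegral_beyondWeight_mul_stripWeight_le hκ b') _
      _ ≤ ENNReal.ofReal (8 * √M / (κ * √δ)) * ENNReal.ofReal (2 / κ) * ENNReal.ofReal (4 / κ) := by
          rw [lintegral_mul_const' _ _ ENNReal.ofReal_ne_top,
            lintegral_mul_const' _ _ ENNReal.ofReal_ne_top]
          exact mul_le_mul_left (mul_le_mul_left hB _) _
      _ ≤ _ := by
          rw [← ENNReal.ofReal_mul (by positivity), ← ENNReal.ofReal_mul (by positivity)]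
          refine ENNReal.ofReal_le_ofReal ?_
          calc 8 * √M / (κ * √δ) * (2 / κ) * (4 / κ) = 8 / κ ^ 3 * (8 * √M / √δ) := by
                field_simp; ring
            _ ≤ 8 / κ ^ 3 * (1 + 8 * √M / √δ) := by gcongr

end

/-! ### Expected number of non-affine holes -/

section
open MeasureTheory

theorem lintegral_pi_sum_le {Ω ι ι' : Type*} [MeasurableSpace Ω] (μ : Measure Ω) [SigmaFinite μ]
    [Fintype ι] [Fintype ι'] (G : (ι ⊕ ι' → Ω) → ENNReal) :
    ∫⁻ x, G x ∂(Measure.pi fun _ => μ) ≤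
      ∫⁻ y : ι → Ω, ∫⁻ z : ι' → Ω, G (Sum.elim y z) ∂(Measure.pi fun _ => μ)
        ∂(Measure.pi fun _ => μ) := by
  have h := measurePreserving_sumPiEquivProdPi (fun _ : ι ⊕ ι' => μ)
  have e : ∫⁻ x, G x ∂(Measure.pi fun _ => μ) =
      ∫⁻ z : (ι → Ω) × (ι' → Ω), G (Sum.elim z.1 z.2)
        ∂((Measure.pi fun _ => μ).prod (Measure.pi fun _ => μ)) := by
    refine Eq.trans ?_ (h.lintegral_comp_emb (MeasurableEquiv.measurableEmbedding _)
      (fun z : (ι → Ω) × (ι' → Ω) => G (Sum.elim z.1 z.2)))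
    refine lintegral_congr fun x => ?_
    congr 1
    ext (i | i) <;> rfl
  rw [e]
  exact lintegral_prod_le _

theorem ae_pi_of_ae {Ω ι : Type*} [MeasurableSpace Ω] {μ : Measure Ω} [IsProbabilityMeasure μ]
    [Fintype ι] {p : Ω → Prop} (h : ∀ᵐ y ∂μ, p y) :
    ∀ᵐ x ∂(Measure.pi fun _ : ι => μ), ∀ i, p (x i) :=
  ae_all_iff.2 fun i => (measurePreserving_eval (fun _ : ι => μ) i).quasiMeasurePreserving.ae h

section
variable {X : Type*} [TopologicalSpace X] [MeasurableSpace X] [OpensMeasurableSpace X]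
  {a b c d : X → Plane}

theorem measurableSet_mem_beyond (ha : Continuous a) (hb : Continuous b) (hc : Continuous c)
    (hd : Continuous d) : MeasurableSet {z : X | d z ∈ beyond (a z) (b z) (c z)} := by
  refine IsOpen.measurableSet ((isOpen_lt continuous_const (continuous_orient ?_ ?_ ?_)).and
    ((isOpen_lt (continuous_orient ?_ ?_ ?_) continuous_const).and
      (isOpen_lt (continuous_orient ?_ ?_ ?_) continuous_const))) <;> assumption

theorem measurableSet_sideGood {τ : ℕ} {x : X → Fin τ → Plane} (ha : Continuous a)
    (hb : Continuous b) (hx : Continuous x) :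
    MeasurableSet {z : X | SideGood τ (a z) (b z) (x z)} := by
  have hx' : ∀ i, Continuous fun z => x z i := fun i => (continuous_apply i).comp hx
  match τ with
  | 0 => exact .univ
  | 1 => exact (isOpen_lt continuous_const (continuous_orient ha hb (hx' 0))).measurableSet
  | 2 => exact measurableSet_uncurry_openTriangle ha hb (hx' 0) (hx' 1)
  | 3 =>
    exact (measurableSet_uncurry_openTriangle ha hb (hx' 0) (hx' 1)).inter
      ((measurableSet_uncurry_openTriangle ha hb (hx' 0) (hx' 2)).inter
      ((isClosed_le (continuous_orient hb (hx' 0) (hx' 2))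
        (continuous_orient hb (hx' 0) (hx' 1))).measurableSet.inter
      ((isOpen_lt continuous_const (continuous_orient hb (hx' 1) (hx' 2))).measurableSet.union
      (isOpen_lt continuous_const (continuous_orient (hx' 1) (hx' 0) (hx' 2))).measurableSet)))
  | _ + 4 => exact .empty

theorem measurableSet_mem_sideEmpty {τ : ℕ} {x : X → Fin τ → Plane} (ha : Continuous a)
    (hb : Continuous b) (hx : Continuous x) (hd : Continuous d) :
    MeasurableSet {z : X | d z ∈ sideEmpty τ (a z) (b z) (x z)} := by
  have hx' : ∀ i, Continuous fun z => x z i := fun i => (continuous_apply i).comp hx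
  match τ with
  | 0 => exact .empty
  | 1 => exact measurableSet_mem_beyond ha hb (hx' 0) hd
  | 2 => exact (measurableSet_mem_beyond ha hb (hx' 0) hd).union
           (measurableSet_uncurry_openTriangle hb (hx' 0) (hx' 1) hd)
  | 3 => exact ((measurableSet_mem_beyond ha hb (hx' 0) hd).union
           (measurableSet_uncurry_openTriangle hb (hx' 0) (hx' 1) hd)).union
           ((measurableSet_uncurry_openTriangle hb (hx' 1) (hx' 2) hd).union
           (measurableSet_uncurry_openTriangle (hx' 1) (hx' 0) (hx' 2) hd))
  | _ + 4 => exact .empty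

theorem measurableSet_mem_sideRest {τ : ℕ} {x : X → Fin τ → Plane} (ha : Continuous a)
    (hb : Continuous b) (hx : Continuous x) (hd : Continuous d) :
    MeasurableSet {z : X | d z ∈ sideRest τ (a z) (b z) (x z)} := by
  have hx' : ∀ i, Continuous fun z => x z i := fun i => (continuous_apply i).comp hx
  match τ with
  | 0 | 1 | 2 | _ + 4 => exact .empty
  | 3 =>
    have he : Continuous fun z => max (orient (b z) (x z 1) (x z 2))
        (orient (x z 1) (x z 0) (x z 2)) :=
      (continuous_orient hb (hx' 1) (hx' 2)).max (continuous_orient (hx' 1) (hx' 0) (hx' 2))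
    have h1 := isClosed_le (continuous_orient hb (hx' 0) hd) (continuous_orient hb (hx' 0) (hx' 1))
    refine MeasurableSet.union (IsClosed.measurableSet ?_) (IsClosed.measurableSet ?_)
    · exact (isClosed_le continuous_const (continuous_orient ha hb hd)).inter
        ((isClosed_le continuous_const (continuous_orient hb (hx' 1) hd)).inter
        (h1.inter (isClosed_le (continuous_orient hb (hx' 1) hd) he)))
    · exact (isClosed_le continuous_const (continuous_orient (hx' 0) ha hd)).inter
        ((isClosed_le continuous_const (continuous_orient (hx' 1) (hx' 0) hd)).inter
        (h1.inter (isClosed_le (continuous_orient (hx' 1) (hx' 0) hd) he)))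

end

variable {τ σ : ℕ}

theorem measurable_indicator_sidesGood :
    Measurable ({z : EdgeConfig τ σ | SidesGood z}.indicator (1 : EdgeConfig τ σ → ENNReal)) := by
  refine measurable_one.indicator (MeasurableSet.inter (measurableSet_sideGood ?_ ?_ ?_)
    (measurableSet_sideGood ?_ ?_ ?_)) <;> fun_prop

theorem measurable_restWeight :
    Measurable (Function.uncurry (restWeight : EdgeConfig τ σ → Plane → ENNReal)) := by
  have hE : MeasurableSet {z : EdgeConfig τ σ × Plane | z.2 ∈ sidesEmpty z.1} := by
    refine MeasurableSet.union (measurableSet_mem_sideEmpty ?_ ?_ ?_ ?_)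
      (measurableSet_mem_sideEmpty ?_ ?_ ?_ ?_) <;> fun_prop
  have hR : MeasurableSet {z : EdgeConfig τ σ × Plane | z.2 ∈ sidesRest z.1} := by
    refine MeasurableSet.union (measurableSet_mem_sideRest ?_ ?_ ?_ ?_)
      (measurableSet_mem_sideRest ?_ ?_ ?_ ?_) <;> fun_prop
  have h1 : Measurable ({z : EdgeConfig τ σ × Plane | z.2 ∈ sidesRest z.1}.indicator
      (1 : EdgeConfig τ σ × Plane → ENNReal)) := measurable_one.indicator hR
  exact (measurable_const.add h1).indicator hE.compl

variable {K : Set Plane}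

/-- The mean weight `1 - |E| / 5` of one remaining point becomes exponential decay at rate `n / 5`,
which factors over the two sides. -/
theorem indicator_mul_lintegral_restWeight_pow_le [IsProbabilityMeasure (volume.restrict K)]
    (hK : Convex ℝ K) {z : EdgeConfig τ σ} (hz : ∀ i, z i ∈ K) (n m : ℕ) :
    {z : EdgeConfig τ σ | SidesGood z}.indicator 1 z *
      (∫⁻ y, restWeight z y ∂(volume.restrict K)) ^ (n - m) ≤
    ENNReal.ofReal (Real.exp m) *
      (sideWeight K (n / 5) τ (z (.inl 0)) (z (.inl 1)) (fun i => z (.inr (.inl i))) *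
        sideWeight K (n / 5) σ (z (.inl 1)) (z (.inl 0)) (fun i => z (.inr (.inr i)))) := by
  by_cases hg : SidesGood z
  swap
  · rw [Set.indicator_of_notMem (by exact hg), zero_mul]
    exact zero_le
  have h := lintegral_restWeight_le hK hz hg
  rw [Set.indicator_of_mem (by exact hg), Pi.one_apply, one_mul, sideWeight, sideWeight,
    Set.indicator_of_mem (by exact hg.1), Set.indicator_of_mem (by exact hg.2),
    ← ENNReal.ofReal_mul (Real.exp_pos _).le, ← Real.exp_add,
    ← ENNReal.ofReal_mul (Real.exp_pos _).le]
  set V₁ := (volume.restrict K).real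
    (sideEmpty τ (z (.inl 0)) (z (.inl 1)) (fun i => z (.inr (.inl i))))
  set V₂ := (volume.restrict K).real
    (sideEmpty σ (z (.inl 1)) (z (.inl 0)) (fun i => z (.inr (.inr i))))
  have h1 : V₁ ≤ 1 := measureReal_le_one
  have h2 : V₂ ≤ 1 := measureReal_le_one
  refine (pow_le_pow_left₀ zero_le h _).trans
    ((one_sub_pow_le_exp (by linarith) n m).trans_eq ?_)
  congr 3
  ring

theorem lintegral_mul_sideWeight_le [IsProbabilityMeasure (volume.restrict K)] (hKc : IsCompact K)
    (hK : Convex ℝ K) {M : ℝ} (hM : ∀ p ∈ K, ∀ q ∈ K, dist p q ≤ M) (hτ : τ < 4) (hσ : σ < 4)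
    {a b : Plane} (ha : a ∈ K) (hb : b ∈ K) (hδa : 0 < Metric.infDist a Kᶜ)
    (hδb : 0 < Metric.infDist b Kᶜ) {κ : ℝ} (hκ : 0 < κ) :
    ∫⁻ w : Fin τ ⊕ Fin σ → Plane, sideWeight K κ τ a b (fun i => w (.inl i)) *
      sideWeight K κ σ b a (fun i => w (.inr i)) ∂(Measure.pi fun _ => volume.restrict K) ≤
    ENNReal.ofReal (8 / κ ^ τ) * ENNReal.ofReal (8 / κ ^ σ) *
      (ENNReal.ofReal (1 + 8 * √M / √(Metric.infDist a Kᶜ)) *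
      ENNReal.ofReal (1 + 8 * √M / √(Metric.infDist b Kᶜ))) := by
  have h1 := lintegral_sideWeight_le (a := a) hKc hK hM hτ hb hδb hκ
  have h2 := lintegral_sideWeight_le (a := b) hKc hK hM hσ ha hδa hκ
  have hne : ∀ x, sideWeight K κ τ a b x ≠ ⊤ := by
    intro x
    unfold sideWeight Set.indicator
    split_ifs <;> simp
  calc _ ≤ ∫⁻ x : Fin τ → Plane, ∫⁻ y : Fin σ → Plane, sideWeight K κ τ a b x *
        sideWeight K κ σ b a y ∂(Measure.pi fun _ => volume.restrict K)
        ∂(Measure.pi fun _ => volume.restrict K) := lintegral_pi_sum_le _ _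
    _ = (∫⁻ x, sideWeight K κ τ a b x ∂(Measure.pi fun _ => volume.restrict K)) *
        ∫⁻ y, sideWeight K κ σ b a y ∂(Measure.pi fun _ => volume.restrict K) := by
        rw [← lintegral_mul_const']
        · exact lintegral_congr fun x => lintegral_const_mul' _ _ (hne x)
        · exact ne_top_of_le_ne_top (ENNReal.mul_ne_top ENNReal.ofReal_ne_top ENNReal.ofReal_ne_top) h2
    _ ≤ _ := (mul_le_mul' h1 h2).trans_eq (by ring)

open Classical in
-- At most `n ^ (2 + τ + σ)` selections are weighed against `(5 / n) ^ (τ + σ)` from the vertices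
-- other than `a` and `b`. What remains is `n ^ 2` times the integrals over the two endpoints, which
-- are finite by integrability of the boundary weight.
theorem exists_lintegral_config_le (hKc : IsCompact K) (hK : Convex ℝ K) (hK1 : volume K = 1)
    (hτ : τ < 4) (hσ : σ < 4) : ∃ C : ℝ, 0 ≤ C ∧ ∀ n : ℕ, ∫⁻ ω,
      (∑ e : Fin 2 ⊕ (Fin τ ⊕ Fin σ) ↪ Fin n,
        {z : EdgeConfig τ σ | SidesGood z}.indicator 1 (ω ∘ e) *
        ∏ j ∈ Finset.univ.filter (fun j => j ∉ Set.range e), restWeight (ω ∘ e) (ω j) : ENNReal)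
        ∂(uniformPoints K n) ≤ ENNReal.ofReal (C * n ^ 2) := by
  have : IsProbabilityMeasure (volume.restrict K) := ⟨by simp [hK1]⟩
  obtain ⟨M, hM⟩ := Metric.isBounded_iff.1 hKc.isBounded
  have hM : ∀ p ∈ K, ∀ q ∈ K, dist p q ≤ M := fun p hp q hq => hM hp hq
  set Ψ : Plane → ENNReal := fun b => ENNReal.ofReal (1 + 8 * √M / √(Metric.infDist b Kᶜ)) with hΨ
  have hΨ_ne : ∀ b, Ψ b ≠ ⊤ := fun b => ENNReal.ofReal_ne_top
  have hI : ∫⁻ b, Ψ b ∂(volume.restrict K) < ⊤ := by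
    have e : ∀ b, Ψ b =
        1 + ENNReal.ofReal (8 * √M) * ENNReal.ofReal (1 / √(Metric.infDist b Kᶜ)) := by
      intro b
      rw [hΨ, ← ENNReal.ofReal_mul (by positivity), ← ENNReal.ofReal_one,
        ← ENNReal.ofReal_add (by norm_num) (by positivity), mul_one_div]
    rw [lintegral_congr e, lintegral_add_left measurable_const,
      lintegral_const_mul' _ _ ENNReal.ofReal_ne_top]
    exact ENNReal.add_lt_top.2 ⟨by simp, ENNReal.mul_lt_top ENNReal.ofReal_lt_top
      (lintegral_infDist_weight_lt_top hKc hK hK1)⟩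
  set I := (∫⁻ b, Ψ b ∂(volume.restrict K)).toReal with hId
  have hI' : ∫⁻ b, Ψ b ∂(volume.restrict K) = ENNReal.ofReal I := (ENNReal.ofReal_toReal hI.ne).symm
  have hI0 : 0 ≤ I := ENNReal.toReal_nonneg
  set m := Fintype.card (Fin 2 ⊕ (Fin τ ⊕ Fin σ)) with hm
  have hmv : m = 2 + (τ + σ) := by simp [hm]
  -- Here `64 = 8 * 8` comes from the two sides, `5 ^ (τ + σ)` from the rate `n / 5`, and `I ^ 2`
  -- from the two endpoints.
  refine ⟨Real.exp m * (64 * 5 ^ (τ + σ) * I ^ 2), by positivity, fun n => ?_⟩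
  unfold uniformPoints
  rw [lintegral_sum_embedding (volume.restrict K) n measurable_indicator_sidesGood
    measurable_restWeight]
  rcases Nat.eq_zero_or_pos n with rfl | hn
  · have h0 : (0 : ℕ).descFactorial (Fintype.card (Fin 2 ⊕ (Fin τ ⊕ Fin σ))) = 0 := by
      rw [Nat.descFactorial_eq_zero_iff_lt, ← hm, hmv]
      omega
    rw [h0, Nat.cast_zero, zero_mul]
    exact zero_le
  have hn0 : (0 : ℝ) < n := by exact_mod_cast hn
  have hκ : (0 : ℝ) < n / 5 := by positivity
  have hmain : ∫⁻ z : EdgeConfig τ σ, {z : EdgeConfig τ σ | SidesGood z}.indicator 1 z *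
      (∫⁻ y, restWeight z y ∂(volume.restrict K)) ^ (n - m)
      ∂(Measure.pi fun _ => volume.restrict K) ≤
      ENNReal.ofReal (Real.exp m) * (ENNReal.ofReal (8 / (n / 5) ^ τ) *
        ENNReal.ofReal (8 / (n / 5) ^ σ) * (ENNReal.ofReal I * ENNReal.ofReal I)) := by
    calc _ ≤ ∫⁻ z : EdgeConfig τ σ, ENNReal.ofReal (Real.exp m) *
          (sideWeight K (n / 5) τ (z (.inl 0)) (z (.inl 1)) (fun i => z (.inr (.inl i))) *
          sideWeight K (n / 5) σ (z (.inl 1)) (z (.inl 0)) (fun i => z (.inr (.inr i))))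
          ∂(Measure.pi fun _ => volume.restrict K) := by
          refine lintegral_mono_ae ((ae_pi_mem hKc.measurableSet).mono fun z hz => ?_)
          exact indicator_mul_lintegral_restWeight_pow_le hK hz n m
      _ ≤ ENNReal.ofReal (Real.exp m) * ∫⁻ y : Fin 2 → Plane,
          ENNReal.ofReal (8 / (n / 5) ^ τ) * ENNReal.ofReal (8 / (n / 5) ^ σ) *
          (Ψ (y 0) * Ψ (y 1)) ∂(Measure.pi fun _ => volume.restrict K) := by
          rw [lintegral_const_mul' _ _ ENNReal.ofReal_ne_top]
          refine mul_le_mul_right ((lintegral_pi_sum_le _ _).trans ?_) _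
          refine lintegral_mono_ae ?_
          filter_upwards [ae_pi_mem (ι := Fin 2) hKc.measurableSet,
            ae_pi_of_ae (ι := Fin 2) (ae_infDist_pos hKc hK hK1)] with y hy hδ
          exact lintegral_mul_sideWeight_le hKc hK hM hτ hσ (hy 0) (hy 1) (hδ 0) (hδ 1) hκ
      _ ≤ _ := by
          rw [lintegral_const_mul' _ _ (ENNReal.mul_ne_top ENNReal.ofReal_ne_top
            ENNReal.ofReal_ne_top)]
          refine mul_le_mul_right (mul_le_mul_right ?_ _) _
          calc _ ≤ ∫⁻ a, ∫⁻ b, Ψ a * Ψ b ∂(volume.restrict K) ∂(volume.restrict K) := by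
                refine (lintegral_pi_succ_le _ _ _).trans (lintegral_mono fun a => ?_)
                refine (lintegral_pi_succ_le _ _ _).trans (lintegral_mono fun b => ?_)
                rw [lintegral_pi_zero]
                exact le_rfl
            _ = ENNReal.ofReal I * ENNReal.ofReal I := by
                rw [lintegral_congr fun a => lintegral_const_mul' (Ψ a) Ψ (hΨ_ne a), hI',
                  lintegral_mul_const' _ _ ENNReal.ofReal_ne_top, hI']
  refine (mul_le_mul' (Nat.cast_le.2 (Nat.descFactorial_le_pow n m)) hmain).trans ?_
  rw [← ENNReal.ofReal_mul hI0, ← ENNReal.ofReal_mul (by positivity),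
    ← ENNReal.ofReal_mul (by positivity), ← ENNReal.ofReal_mul (by positivity),
    ← ENNReal.ofReal_natCast, ← ENNReal.ofReal_mul (by positivity)]
  refine ENNReal.ofReal_le_ofReal (le_of_eq ?_)
  push_cast
  rw [hmv, div_pow, div_pow, pow_add, pow_add, pow_add]
  field_simp
  ring

open Classical in
/-- The expected number of holes that are not affine is at most quadratic. -/
theorem exists_lintegral_nonaffine_le (hKc : IsCompact K) (hK : Convex ℝ K) (hK1 : volume K = 1) :
    ∃ C : ℝ, 0 ≤ C ∧ ∀ n : ℕ, ∫⁻ ω,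
      (∑ τ : Fin 4, ∑ σ : Fin 4, ∑ e : Fin 2 ⊕ (Fin τ ⊕ Fin σ) ↪ Fin n,
        {z : EdgeConfig τ σ | SidesGood z}.indicator 1 (ω ∘ e) *
        ∏ j ∈ Finset.univ.filter (fun j => j ∉ Set.range e), restWeight (ω ∘ e) (ω j) : ENNReal)
        ∂(uniformPoints K n) ≤ ENNReal.ofReal (C * n ^ 2) := by
  choose C hC h using fun τ σ : Fin 4 => exists_lintegral_config_le hKc hK hK1 τ.2 σ.2
  have hmeas : ∀ (n : ℕ) (τ σ : Fin 4), Measurable fun ω : Fin n → Plane =>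
      (∑ e : Fin 2 ⊕ (Fin τ ⊕ Fin σ) ↪ Fin n,
        {z : EdgeConfig τ σ | SidesGood z}.indicator 1 (ω ∘ e) *
        ∏ j ∈ Finset.univ.filter (fun j => j ∉ Set.range e),
          restWeight (ω ∘ e) (ω j) : ENNReal) := by
    intro n τ σ
    refine Finset.measurable_fun_sum _ fun e _ => ?_
    have hc : Measurable fun ω : Fin n → Plane => ω ∘ e :=
      measurable_pi_lambda _ fun i => measurable_pi_apply _
    exact (measurable_indicator_sidesGood.comp hc).mul (Finset.measurable_fun_prod _ fun j _ =>
      measurable_restWeight.comp (hc.prodMk (measurable_pi_apply j)))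
  refine ⟨∑ τ, ∑ σ, C τ σ, Finset.sum_nonneg fun τ _ => Finset.sum_nonneg fun σ _ => hC τ σ,
    fun n => ?_⟩
  rw [lintegral_finsetSum _ fun τ _ => Finset.measurable_fun_sum _ fun σ _ => hmeas n τ σ,
    Finset.sum_mul, ENNReal.ofReal_sum_of_nonneg fun τ _ => mul_nonneg
      (Finset.sum_nonneg fun σ _ => hC τ σ) (by positivity)]
  refine Finset.sum_le_sum fun τ _ => ?_
  rw [lintegral_finsetSum _ fun σ _ => hmeas n τ σ, Finset.sum_mul,
    ENNReal.ofReal_sum_of_nonneg fun σ _ => mul_nonneg (hC τ σ) (by positivity)]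
  exact Finset.sum_le_sum fun σ _ => h τ σ n

end

/-! ### Conclusion -/

section
open MeasureTheory Filter

theorem isTheta_integral_natCast {Ω : ℕ → Type*} [∀ n, MeasurableSpace (Ω n)]
    {ν : ∀ n, Measure (Ω n)} [∀ n, IsProbabilityMeasure (ν n)] {X : ∀ n, Ω n → ℕ}
    (hX : ∀ n, Integrable (fun ω => (X n ω : ℝ)) (ν n))
    (hlow : ∀ n, 3 ≤ n → ∀ᵐ ω ∂(ν n), n * n - n ≤ 9 * X n ω) {C : ℝ} (hC : 0 ≤ C)
    (hup : ∀ n, ∫⁻ ω, (X n ω : ENNReal) ∂(ν n) ≤ ENNReal.ofReal (C * n ^ 2)) :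
    Asymptotics.IsTheta atTop (fun n : ℕ => ∫ ω, (X n ω : ℝ) ∂(ν n))
      (fun n : ℕ => (n : ℝ) ^ 2) := by
  have h0 : ∀ n, 0 ≤ ∫ ω, (X n ω : ℝ) ∂(ν n) := fun n =>
    integral_nonneg fun ω => Nat.cast_nonneg _
  constructor
  · refine Asymptotics.IsBigO.of_bound C (Eventually.of_forall fun n => ?_)
    rw [Real.norm_of_nonneg (h0 n), Real.norm_of_nonneg (by positivity)]
    rw [integral_eq_lintegral_of_nonneg_ae (Eventually.of_forall fun ω => Nat.cast_nonneg _)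
      (hX n).aestronglyMeasurable]
    refine ENNReal.toReal_le_of_le_ofReal (by positivity) ((le_of_eq ?_).trans (hup n))
    exact lintegral_congr fun ω => ENNReal.ofReal_natCast _
  · refine Asymptotics.IsBigO.of_bound 18 ?_
    filter_upwards [eventually_ge_atTop 3] with n hn
    rw [Real.norm_of_nonneg (h0 n), Real.norm_of_nonneg (by positivity)]
    -- For `n ≥ 3` one has `n ^ 2 - n ≥ n ^ 2 / 2`, whence `18 = 2 * 9`.
    have h1 : ∀ᵐ ω ∂(ν n), (n : ℝ) ^ 2 / 18 ≤ X n ω := by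
      filter_upwards [hlow n hn] with ω hω
      have h2 : n * n ≤ 9 * X n ω + n := by omega
      have h3 : (n : ℝ) * n ≤ 9 * X n ω + n := by exact_mod_cast h2
      have h4 : (3 : ℝ) ≤ n := by exact_mod_cast hn
      nlinarith
    have h2 := integral_mono_ae (integrable_const _) (hX n) h1
    rw [integral_const, probReal_univ, one_smul] at h2
    linarith

theorem lintegral_natCast_le {n : ℕ} {ν : Measure (Fin n → Plane)}
    (hν : ∀ᵐ ω ∂ν, GeneralPosition ω) {X : (Fin n → Plane) → ℕ}
    {Y : (Fin n → Plane) → ENNReal} (h : ∀ ω, GeneralPosition ω → (X ω : ENNReal) ≤ Y ω) {c : ℝ}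
    (hY : ∫⁻ ω, Y ω ∂ν ≤ ENNReal.ofReal c) :
    ∫⁻ ω, (X ω : ENNReal) ∂ν ≤ ENNReal.ofReal c :=
  (lintegral_mono_ae (hν.mono h)).trans hY

end

theorem mainTheorem8 (K : Set Plane) (hK_compact : IsCompact K) (hK_convex : Convex ℝ K)
    (hK_area : MeasureTheory.volume K = 1) :
    ((∀ n : ℕ, MeasureTheory.Integrable
        (fun ω : Fin n → Plane => (numProj3Holes (Set.range ω) : ℝ)) (uniformPoints K n)) ∧
      Asymptotics.IsTheta Filter.atTop
        (fun n : ℕ => ∫ ω, (numProj3Holes (Set.range ω) : ℝ) ∂(uniformPoints K n))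
        (fun n : ℕ => (n : ℝ) ^ 2)) ∧
    ((∀ n : ℕ, MeasureTheory.Integrable
        (fun ω : Fin n → Plane => (numNonaffineProjHoles (Set.range ω) : ℝ))
        (uniformPoints K n)) ∧
      Asymptotics.IsTheta Filter.atTop
        (fun n : ℕ => ∫ ω, (numNonaffineProjHoles (Set.range ω) : ℝ) ∂(uniformPoints K n))
        (fun n : ℕ => (n : ℝ) ^ 2)) := by
  classical
  have : MeasureTheory.IsProbabilityMeasure (MeasureTheory.volume.restrict K) := ⟨by simp [hK_area]⟩
  have : ∀ n, MeasureTheory.IsProbabilityMeasure (uniformPoints K n) := fun n => by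
    unfold uniformPoints; infer_instance
  have hGP : ∀ n, ∀ᵐ ω ∂(uniformPoints K n), GeneralPosition ω := fun n =>
    ae_generalPosition MeasureTheory.Measure.absolutelyContinuous_restrict n
  -- Almost surely the count equals the cardinality of a subset of a fixed finite type depending
  -- measurably on `ω`, hence a bounded measurable function.
  have hI3 : ∀ n : ℕ, MeasureTheory.Integrable
      (fun ω : Fin n → Plane => (numProj3Holes (Set.range ω) : ℝ)) (uniformPoints K n) := fun n =>
    integrable_natCast_of_ae_eq ((hGP n).mono fun ω hω => by convert numProj3Holes_eq hω)
      (measurable_card_signedHoles _) (fun ω => Finset.card_le_univ _)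
  have hIN : ∀ n : ℕ, MeasureTheory.Integrable
      (fun ω : Fin n → Plane => (numNonaffineProjHoles (Set.range ω) : ℝ)) (uniformPoints K n) :=
    fun n => integrable_natCast_of_ae_eq
      ((hGP n).mono fun ω hω => by convert numNonaffineProjHoles_eq hω)
      (measurable_card_signedHoles _) (fun ω => Finset.card_le_univ _)
  obtain ⟨C₁, hC₁, hA⟩ := exists_lintegral_affine_le hK_compact.measurableSet hK_convex hK_area
  obtain ⟨C₂, hC₂, hN⟩ := exists_lintegral_nonaffine_le hK_compact hK_convex hK_area
  have hNle : ∀ n, ∫⁻ ω : Fin n → Plane, (numNonaffineProjHoles (Set.range ω) : ENNReal)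
      ∂(uniformPoints K n) ≤ ENNReal.ofReal (C₂ * n ^ 2) := fun n =>
    lintegral_natCast_le (hGP n) (fun ω hω => by
      rw [numNonaffineProjHoles_eq hω]; convert card_nonaffine_le hω) (hN n)
  have h3le : ∀ n, ∫⁻ ω : Fin n → Plane, (numProj3Holes (Set.range ω) : ENNReal)
      ∂(uniformPoints K n) ≤ ENNReal.ofReal ((C₁ + C₂) * n ^ 2) := fun n => by
    -- A projective 3-hole is either an empty affine triangle, counted by `X`, or one of the
    -- non-affine holes already bounded.
    let X : (Fin n → Plane) → ℕ := fun ω =>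
      (Finset.univ.filter fun p : Finset (Fin n) × Finset (Fin n) =>
        IsNormalized p ∧ IsSignedHole ω p.1 p.2 ∧ (p.1.card = 3 ∧ p.2 = ∅)).card
    have hX : Measurable X := by convert measurable_card_signedHoles _
    have hX' : Measurable fun ω => (X ω : ENNReal) := measurable_from_top.comp hX
    have hle : ∀ ω : Fin n → Plane, GeneralPosition ω → (numProj3Holes (Set.range ω) : ENNReal) ≤
        X ω + (numNonaffineProjHoles (Set.range ω) : ENNReal) := by
      intro ω hω
      rw [numProj3Holes_eq hω, numNonaffineProjHoles_eq hω]
      norm_cast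
      refine (Finset.card_le_card fun p hp => ?_).trans (Finset.card_union_le _ _)
      simp only [Finset.mem_filter, Finset.mem_univ, true_and, Finset.mem_union] at hp ⊢
      rcases p.2.eq_empty_or_nonempty with h | h
      · exact Or.inl ⟨hp.1, hp.2.1, hp.2.2, h⟩
      · exact Or.inr ⟨hp.1, hp.2.1, h⟩
    refine lintegral_natCast_le (hGP n) hle ?_
    rw [MeasureTheory.lintegral_add_left hX', add_mul,
      ENNReal.ofReal_add (by positivity) (by positivity)]
    refine add_le_add ((MeasureTheory.lintegral_mono fun ω => ?_).trans (hA n)) (hNle n)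
    convert card_affine_le ω
  exact ⟨⟨hI3, isTheta_integral_natCast hI3
      (fun n hn => (hGP n).mono fun ω hω => le_numProj3Holes hω hn) (by positivity) h3le⟩,
    ⟨hIN, isTheta_integral_natCast hIN
      (fun n hn => (hGP n).mono fun ω hω => le_numNonaffineProjHoles hω hn) hC₂ hNle⟩⟩
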